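/- **Setting.** Let $O=(0,0)$, $a=(\tfrac12,\tfrac{\sqrt3}{2})$, $b=(1,0)$. Let $F'_0$ be the graph of the three vertices and three edges of the triangle $Oab$, and $F'_{N+1}=f_1(F'_N)\cup f_2(F'_N)\cup f_3(F'_N)$ with $f_1(x)=\tfrac x2$, $f_2(x)=\tfrac{x+a}2$, $f_3(x)=\tfrac{x+b}2$. Let $F_N$ be the union of $F'_N$ and its reflection in the $y$-axis, $F_N^V=F_N\cup(F_N'+b)$, and let $G_N$, $G_N^V$ be their vertex sets. A $2^{-M}$-triangle is an upward triangle of side $2^{-M}$ with vertices in $G_M$ (in $G^V_M$ for paths on $F_N^V$). For a path $w=(w(0),\dots,w(n))$ put $\ell(w)=n$, $T^M_0=0$, $T^M_i=\inf\{j>T^M_{i-1}: w(j)\in G_M\setminus\{w(T^M_{i-1})\}\}$ (with $G^V_M$ for paths on $F_N^V$) and $Q_Mw=(w(T_0^M),w(T_1^M),\dots)$. Let $W_N$ be the set of finite nearest-neighbour paths on $F_N$ from $O$, stopped at the first visit to $a$, that visit no vertex of $G_0\setminus\{O\}$ before; let $V_N$ be the set of finite paths on $F_N^V$ from $O$, stopped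 at the first visit to $a$, with $Q_0w=(O,b,a)$. **Walks.** Let $0<u\le1$. For $w\in W_1$ let $N(w)$ be the number of $1\le i\le \ell(w)-1$ with $w(i)\notin G_0$ and $(w(i)-w(i-1))\cdot(w(i+1)-w(i))<0$, and $M(w)$ the number of $i\ge1$ with $w(i)=O$. Let $x_u>0$ be the fixed point of $x\mapsto\Phi(x,u)=\sum_{w\in W_1}u^{N(w)+M(w)}x^{\ell(w)}$. Put $P_1^u(w)=u^{N(w)+M(w)}x_u^{\ell(w)-1}$ on $W_1$ and recursively $P^u_{N+1}(w)=P^u_N(Q_Nw)\prod_iP^u_1(w_i)$ on $W_{N+1}$, where $w_i$ is the segment of $w$ between $T^N_{i-1}$ and $T^N_i$, identified with an element of $W_1$; on $V_N$ let $P'^u_N(w)=P_N^u(w')P_N^u(w'')$, where $w',w''$ are the segments of $w$ from $O$ to $b$ and from $b$ to $a$, identified with elements of $W_N$. **Erasing larger loops first.** Let $w\in W_N\cup V_N$ and $w^{(0)}=w$. Given $w^{(M)}$, $M<N$, cut it at the exit times from the successive $2^{-M}$-triangles that $Q_Mw^{(M)}$ passes through. For each piece, erase chronologically the loops of its coarse-graining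 $Q_{M+1}$ and keep the fine structure of the remaining steps; concatenating the pieces gives $w^{(M+1)}$. Put $\hat Q_Mw=Q_Mw^{(M)}$. For a path $\gamma=\hat Q_Nw$ let $S_j^N(\gamma)$, $j=1,2$, be the number of $2^{-N}$-triangles that $\gamma$ passes through in exactly $j$ steps. **Limit variables.** Let $\mathbf M$ be the $2\times2$ mean matrix whose first row is the expectation of $(S_1^1,S_2^1)(\hat Q_1w)$ under $P_1^u$ and whose second row is its expectation under $P'^u_1$. Let $\lambda$ be its larger eigenvalue, ${}^t(u_1,u_2)$ and $\mathbf v=(v_1,v_2)$ the positive right and left eigenvectors for $\lambda$ with $u_1v_1+u_2v_2=1$ and $u_1+u_2=1$, and $\nu=\log2/\log\lambda$. Let $(Y^{(1)}_N)_{N\ge0}$ be a random sequence such that for every $N$ the law of $(Y^{(1)}_0,\dots,Y^{(1)}_N)$ is that of $(\hat Q_0w,\dots,\hat Q_Nw)$ under $P_N^u$, and let $(Y_N^{(2)})_{N\ge0}$ be defined in the same way with $P'^u_N$. Let $B_i$, $i=1,2$, be real random variables such that $\lambda^{-N}\bigl(S^N_1(Y^{(i)}_N),S^N_2(Y^{(i)}_N)\bigr)$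 converges almost surely as $N\to\infty$ to a random vector that has the same distribution as $B_i\mathbf v$. Put $g_i(t)=E[\exp(-tB_i)]$, $h_i(t)=-t^{-\nu}\log g_i(t)$ and $\tilde B_i=(v_1+2v_2)B_i$. **Theorem.** 1. There exist positive constants $C_1,C_2,t_0$ such that $C_2\le h_i(t)\le C_1$ for $i=1,2$ and all $t\ge t_0$. 2. There exist positive constants $C_5,C_6,x_0$ such that $$e^{-C_5x^{-\nu/(1-\nu)}}\le P[\tilde B_i\le x]\le e^{-C_6x^{-\nu/(1-\nu)}},\qquad i=1,2,$$ for all $0<x\le x_0$. -/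

import Mathlib

open MeasureTheory ProbabilityTheory Filter Topology

namespace ELLF

/-- Points of the plane occurring in the pre-Sierpinski gaskets, in oblique coordinates:
the pair `(s, t)` stands for the point `s • (1, 0) + t • (1/2, √3/2)`. -/
abbrev Pt : Type := ℚ × ℚ

/-- The origin. -/
def ptO : Pt := (0, 0)
/-- The point `a = (1/2, √3/2)`. -/
def ptA : Pt := (0, 1)
/-- The point `b = (1, 0)`. -/
def ptB : Pt := (1, 0)

/-- The Euclidean inner product in oblique coordinates. -/
def dotp (p q : Pt) : ℚ := p.1 * q.1 + p.2 * q.2 + (p.1 * q.2 + p.2 * q.1) / 2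

/-- Reflection with respect to the `y`-axis: `b ↦ -b` and `a ↦ a - b`. -/
def reflY (p : Pt) : Pt := (-p.1 - p.2, p.2)

/-- The similarity `x ↦ (x + c) / 2`; the three maps are the cases `c = O, a, b`. -/
def half (c p : Pt) : Pt := (1 / 2 : ℚ) • (p + c)

/-- Vertices of the one-sided pre-gasket `F'_N`. -/
def G' : ℕ → Finset Pt
  | 0 => {ptO, ptA, ptB}
  | N + 1 => (G' N).image (half ptO) ∪ (G' N).image (half ptA) ∪ (G' N).image (half ptB)

/-- Edges of the one-sided pre-gasket `F'_N`. -/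
def E' : ℕ → Finset (Sym2 Pt)
  | 0 => {s(ptO, ptA), s(ptO, ptB), s(ptA, ptB)}
  | N + 1 => (E' N).image (Sym2.map (half ptO)) ∪ (E' N).image (Sym2.map (half ptA)) ∪
      (E' N).image (Sym2.map (half ptB))

/-- Vertices of `F_N`, the union of `F'_N` and its reflection. -/
def G (N : ℕ) : Finset Pt := G' N ∪ (G' N).image reflY

/-- Edges of `F_N`. -/
def E (N : ℕ) : Finset (Sym2 Pt) := E' N ∪ (E' N).image (Sym2.map reflY)

/-- Vertices of `F_N^V = F_N ∪ (F'_N + b)`. -/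
def GV (N : ℕ) : Finset Pt := G N ∪ (G' N).image (fun p => p + ptB)

/-- Edges of `F_N^V`. -/
def EV (N : ℕ) : Finset (Sym2 Pt) := E N ∪ (E' N).image (Sym2.map (fun p => p + ptB))

/-- A finite path `(w(0), …, w(n))`, as the list of its vertices. -/
abbrev Path : Type := List Pt

/-- The number of steps `ℓ(w)`. -/
def steps (w : Path) : ℕ := w.length - 1

/-- Auxiliary to `blocks`: `p` is the last recorded point of `A`, `acc` the path since then. -/
def blocksAux (A : Finset Pt) : Pt → Path → List Pt → List Path
  | _, _, [] => []
  | p, acc, q :: l =>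
      if q ∈ A ∧ q ≠ p then (acc ++ [q]) :: blocksAux A q [q] l
      else blocksAux A p (acc ++ [q]) l

/-- The segments `(w(T_{i-1}), …, w(T_i))`, `1 ≤ i ≤ m`, between the successive hitting times
`T_0 = 0`, `T_i = inf {j > T_{i-1} : w(j) ∈ A \ {w(T_{i-1})}}` of `A`. -/
def blocks (A : Finset Pt) : Path → List Path
  | [] => []
  | p :: l => blocksAux A p [p] l

/-- The coarse-graining map `Q_M`, giving `(w(T_0^M), …, w(T_m^M))`. On paths of `F_N` the hits of
the vertex set of `F_M^V` and of `F_M` are the same. -/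
def coarse (M : ℕ) : Path → Path
  | [] => []
  | p :: l => p :: (blocks (GV M) (p :: l)).map (fun s => s.getLast?.getD p)

/-- `W_N`: paths on `F_N` from `O`, stopped at the first hitting of `a`, which do not hit the
vertices of `F_0` other than `O` on the way. -/
def W (N : ℕ) : Set Path :=
  {w | w.head? = some ptO ∧ w.getLast? = some ptA ∧ w.IsChain (fun p q => s(p, q) ∈ E N) ∧
    ∀ p ∈ w.dropLast, p ∉ G 0 \ {ptO}}

/-- `V_N`: paths on `F_N^V` from `O`, stopped at the first hitting of `a`, with
`Q_0 w = (O, b, a)`. -/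
def V (N : ℕ) : Set Path :=
  {w | w.head? = some ptO ∧ w.getLast? = some ptA ∧ w.IsChain (fun p q => s(p, q) ∈ EV N) ∧
    (∀ p ∈ w.dropLast, p ≠ ptA) ∧ coarse 0 w = [ptO, ptB, ptA]}

/-- The number of sharp turns and backtracks at points outside `A`. -/
def reversals (A : Finset Pt) : Path → ℕ
  | p :: q :: r :: l =>
      (if dotp (q - p) (r - q) < 0 ∧ q ∉ A then 1 else 0) + reversals A (q :: r :: l)
  | _ => 0

/-- The number of revisits to the starting point. -/
def revisits : Path → ℕ
  | [] => 0
  | p :: l => l.count p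

/-- The weight `u^{N(w)+M(w)} x^{ℓ(w)-1}` of a path segment `w` of `F_{M+1}` between two successive
hits of `G_M`. The numbers `N`, `M`, `ℓ` are invariant under the identification of the
segment with an element of `W_1` (its first point with `O`, its last with `a`, the points of
`G_M` with those of `G_0`). -/
noncomputable def segWeight (u x : ℝ) (M : ℕ) (w : Path) : ℝ :=
  u ^ (reversals (GV M) w + revisits w) * x ^ (steps w - 1)

/-- The probability `P_N^u` on `W_N`: `P_{N+1}^u(w) = P_N^u(Q_N w) ∏_i P_1^u(w_i)`, where the `w_i`
are the segments of `w` between successive hits of `G_N`. -/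
noncomputable def prob (u x : ℝ) : ℕ → Path → ℝ
  | 0, _ => 1
  | N + 1, w => prob u x N (coarse N w) * ((blocks (GV N) w).map (segWeight u x N)).prod

/-- The probability `P'_N^u` on `V_N`: the product of the probabilities of the segments from `O` to
`b` and from `b` to `a`. -/
noncomputable def prob' (u x : ℝ) (N : ℕ) (w : Path) : ℝ :=
  ((blocks (GV 0) w).map (prob u x N)).prod

/-- `x` is the positive fixed point `x_u` of `Φ(·, u)`, where
`Φ(x, u) = ∑_{w ∈ W_1} u^{N(w)+M(w)} x^{ℓ(w)}`. -/
def IsFixedPoint (u x : ℝ) : Prop :=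
  0 < x ∧ HasSum (fun w : W 1 => u ^ (reversals (GV 0) w.1 + revisits w.1) * x ^ steps w.1) x

/-- `p, q, r` are vertices of a common upward triangle of side `2^{-M}` with vertices in the
vertex set at level `M`. -/
def InTriangle (M : ℕ) (p q r : Pt) : Prop :=
  ∃ c ∈ GV M, c + ((1 / 2 : ℚ) ^ M) • ptA ∈ GV M ∧ c + ((1 / 2 : ℚ) ^ M) • ptB ∈ GV M ∧
    ∀ z ∈ [p, q, r], z ∈ [c, c + ((1 / 2 : ℚ) ^ M) • ptA, c + ((1 / 2 : ℚ) ^ M) • ptB]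

instance (M : ℕ) (p q r : Pt) : Decidable (InTriangle M p q r) := by
  unfold InTriangle; infer_instance

/-- Two successive segments between hits of `G_M` run in the same `2^{-M}`-triangle. -/
def sameTriangle (M : ℕ) (s t : Path) : Bool :=
  decide (InTriangle M (s.head?.getD ptO) (t.head?.getD ptO) (t.getLast?.getD ptO))

/-- The `2^{-M}`-skeleton with the path: the segments between hits of `G_M`, grouped according to
the successive `2^{-M}`-triangles which the path passes through (that is, cut at the exit times). -/
def skeleton (M : ℕ) (w : Path) : List (List Path) :=
  (blocks (GV M) w).splitBy (sameTriangle M)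

/-- `S_j^M(w)`: the number of `2^{-M}`-triangles of Type `j` in the `2^{-M}`-skeleton, those
passed in `j` steps of `Q_M w`. -/
def typeCount (M j : ℕ) (w : Path) : ℕ :=
  (skeleton M w).countP (fun g => g.length = j)

/-- Concatenation of segments, the last point of each being the first of the next. -/
def joinPath : List Path → Path
  | [] => []
  | [s] => s
  | s :: t :: l => s.dropLast ++ joinPath (t :: l)

/-- Chronological loop erasure for a path cut into segments, which play the part of the steps:
from the current position `p`, keep the last segment that starts at `p` and move to its
end point. -/
def eraseLoops : Pt → List Path → List Path
  | _, [] => []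
  | p, s :: l =>
      if s.head? = some p ∧ ∀ t ∈ l, t.head? ≠ some p then
        s :: eraseLoops (s.getLast?.getD p) l
      else eraseLoops p l

/-- Erase chronologically the loops of `Q_M w`, and keep the fine structure of the steps of `Q_M w`
that remain. -/
def eraseAt (M : ℕ) (w : Path) : Path :=
  joinPath (eraseLoops (w.head?.getD ptO) (blocks (GV M) w))

/-- The path after the loops of scales `2^{-1}, …, 2^{-M}` have been erased, larger loops
first: at each stage the loops of scale `2^{-(M+1)}` are erased from the path
segment in each triangle of the `2^{-M}`-skeleton. -/
def erased : ℕ → Path → Path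
  | 0, w => w
  | M + 1, w =>
      joinPath ((skeleton M (erased M w)).map (fun g => eraseAt (M + 1) (joinPath g)))

/-- The map `Q̂_M`; on `W_N ∪ V_N` the map `Q̂_N` is the loop-erasing operator `L`. -/
def hatQ (M : ℕ) (w : Path) : Path := coarse M (erased M w)

/-- `Y_0, Y_1, …` are coupled loop-erased walks on `F_0, F_1, …`: for every `N` the joint
law of `(Y_0, …, Y_N)` is that of `(Q̂_0 w, …, Q̂_N w)`, where `w` is distributed
on `S N` with the probabilities `P N`. -/
def IsErasedSequence {Ω : Type*} [MeasurableSpace Ω] (μ : Measure Ω)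
    (S : ℕ → Set Path) (P : ℕ → Path → ℝ) (Y : ℕ → Ω → Path) : Prop :=
  (∀ N γ, MeasurableSet {ω | Y N ω = γ}) ∧
  ∀ (N : ℕ) (γ : ℕ → Path),
    μ {ω | ∀ i ≤ N, Y i ω = γ i} =
      ∑' w : {w : Path // w ∈ S N ∧ ∀ i ≤ N, hatQ i w = γ i}, ENNReal.ofReal (P N w.1)

/-- The mean matrix: its first row is the expectation of the numbers of Type 1 and Type 2 triangles
in the loop erasure of a `P_1^u`-distributed path, its second row the same for `P'_1^u`. -/
noncomputable def meanMatrix (u x : ℝ) : Matrix (Fin 2) (Fin 2) ℝ :=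
  !![∑' w : W 1, prob u x 1 w.1 * typeCount 1 1 (hatQ 1 w.1),
     ∑' w : W 1, prob u x 1 w.1 * typeCount 1 2 (hatQ 1 w.1);
     ∑' w : V 1, prob' u x 1 w.1 * typeCount 1 1 (hatQ 1 w.1),
     ∑' w : V 1, prob' u x 1 w.1 * typeCount 1 2 (hatQ 1 w.1)]

/-- `lam` is the larger eigenvalue of the matrix `A`, and `r`, `v` are the positive right and left
eigenvectors with `(r, v) = 1` and `(r, 1) = 1`. -/
structure IsPerronData (A : Matrix (Fin 2) (Fin 2) ℝ) (lam : ℝ) (r v : Fin 2 → ℝ) : Prop where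
  isGreatest : IsGreatest {c : ℝ | Module.End.HasEigenvalue (Matrix.toLin' A) c} lam
  right : A.mulVec r = lam • r
  left : Matrix.vecMul v A = lam • v
  right_pos : ∀ i, 0 < r i
  left_pos : ∀ i, 0 < v i
  inner_eq : r ⬝ᵥ v = 1
  sum_eq : ∑ i, r i = 1

/-- The law of `B` is that of the branching limit of the sequence `Y`: almost surely
`lam^{-N} (S_1^N(Y_N), S_2^N(Y_N))` converges, and the limit is distributed as `B v`. -/
def IsBranchingLimit {Ω Ω' : Type*} [MeasurableSpace Ω] [MeasurableSpace Ω'] (μ : Measure Ω)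
    (Y : ℕ → Ω → Path) (lam : ℝ) (v : Fin 2 → ℝ) (P : Measure Ω') (B : Ω' → ℝ) : Prop :=
  ∃ T : Ω → ℝ × ℝ,
    (∀ᵐ ω ∂μ, Tendsto
      (fun N : ℕ => ((lam ^ N)⁻¹ * (typeCount N 1 (Y N ω) : ℝ),
        (lam ^ N)⁻¹ * (typeCount N 2 (Y N ω) : ℝ))) atTop (𝓝 (T ω))) ∧
    IdentDistrib T (fun ω' => (B ω' * v 0, B ω' * v 1)) μ P

/-- The Laplace transform `g(t) = E[exp(-t B)]`. -/
noncomputable def laplace {Ω : Type*} [MeasurableSpace Ω] (P : Measure Ω) (B : Ω → ℝ)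
    (t : ℝ) : ℝ := ∫ ω, Real.exp (-t * B ω) ∂P

/-- The exponent `ν = log 2 / log lam`. -/
noncomputable def nu (lam : ℝ) : ℝ := Real.log 2 / Real.log lam

/-- `h(t) = -t^{-ν} log g(t)`. -/
noncomputable def h {Ω : Type*} [MeasurableSpace Ω] (P : Measure Ω) (B : Ω → ℝ) (ν t : ℝ) : ℝ :=
  -t ^ (-ν) * Real.log (laplace P B t)

end ELLF

/-! The numbers of triangles of Types 1 and 2 form a two-type Galton-Watson process, and the theorem
describes the left tail of its normalised limit when every individual has at least two children.

The branching property is `gen_succ`. A path of level N+1 is a path of level N with each step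
replaced by a segment (`exists_fits`, `tsum_X_succ`), and the weights of the possible segments of
one step sum to one because x is the fixed point (`tsum_seg_eq_one`). Loop erasure at scales down to
2^{-N} looks at the end points of the segments only (`gErased_eq_sel`), so the coarse path decides
which segments survive; the others sum to one and drop out (`lsum_sel`). The surviving segments,
grouped by triangles of level N, are independent (`lsum_splitBy`). Erasing the loops of the next
scale inside one triangle gives a law of the new triangles which depends only on whether the
triangle was crossed in one or two steps (`lsum_passage`), and new triangles coming from different
groups never merge (`not_sameTriangle`, `groups_succ`). Independence of place and orientation is
obtained by encoding segments as sequences of labels (`IsAt.seg_eq`); what remains is a finite check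
over `Config`.

Consequently the Laplace transforms g_i of the limits satisfy g_i(λt) = Φ_i(g_1(t), g_2(t)), with
polynomials Φ_i having nonnegative coefficients of sum one. Two facts about Φ suffice. All monomials
have degree at least 2, since a triangle cannot be crossed inside a single triangle of half the size
(`two_le_length_shapeL`), so the maximum of the g_i is at least squared when t is multiplied by λ.
The coefficient of the square of the first variable is positive in both Φ_i (`coef_short_pos`), so
g_i(λt) is at least a constant times g_1(t)². Hence -log g_i doubles, up to a bounded error, each
time t is multiplied by λ; as λ^ν = 2 this is growth of order t^ν (`log_bounds`). The iteration must
start from a t with g_i(t) < 1, that is, the limit must not vanish almost surely; this is a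
quadratic bound on the iterates, uniform in N (`iterate_genR_le`). A path yielding three triangles
gives λ > 2 (`two_lt_lam`), hence ν < 1.

The tails follow from the exponential Chebyshev inequality and from its converse, the splitting of
the Laplace integral at y, with t such that ty is a constant multiple of t^ν (`tail_bounds`). -/

namespace ELLF

/-! ### Walks as lists of abstract steps: cutting and loop erasure -/

section Walks

variable {α β : Type*}

/-- The list `S` of steps, `s` leading from `src s` to `tgt s`, leads from `p` to `q`. -/
def IsWalk {V : Type*} (src tgt : α → V) : V → List α → V → Prop
  | p, [], q => p = q
  | p, s :: S, q => src s = p ∧ IsWalk src tgt (tgt s) S q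

/-- The starting point of a list of steps. -/
def gsrc (src : α → Pt) (S : List α) : Pt := (S.head?.map src).getD ptO

/-- The end point of a list of steps. -/
def gtgt (tgt : α → Pt) (S : List α) : Pt := (S.getLast?.map tgt).getD ptO

/-- The version of `blocksAux` for lists of steps. -/
def gBlocksAux (tgt : α → Pt) (A : Finset Pt) : Pt → List α → List α → List (List α)
  | _, _, [] => []
  | p, acc, s :: l =>
      if tgt s ∈ A ∧ tgt s ≠ p then (acc ++ [s]) :: gBlocksAux tgt A (tgt s) [] l
      else gBlocksAux tgt A p (acc ++ [s]) l

/-- The version of `blocks` for lists of steps. -/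
def gBlocks (src tgt : α → Pt) (A : Finset Pt) (S : List α) : List (List α) :=
  gBlocksAux tgt A (gsrc src S) [] S

/-- The version of `eraseLoops` for lists of steps. -/
def gErase {V : Type*} [DecidableEq V] (src tgt : α → V) : V → List α → List α
  | _, [] => []
  | p, s :: l =>
      if src s = p ∧ ∀ t ∈ l, src t ≠ p then s :: gErase src tgt (tgt s) l
      else gErase src tgt p l

/-- `b` is a segment between two successive hits of `A`. -/
structure IsBlock (src tgt : α → Pt) (A : Finset Pt) (b : List α) : Prop where
  ne_nil : b ≠ []
  walk : IsWalk src tgt (gsrc src b) b (gtgt tgt b)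
  tgt_mem : gtgt tgt b ∈ A
  src_mem : gsrc src b ∈ A
  tgt_ne : gtgt tgt b ≠ gsrc src b
  src_eq : ∀ s ∈ b, src s ∈ A → src s = gsrc src b

section

variable {V : Type*} {src tgt : α → V}

lemma isWalk_append {p q : V} {S T : List α} :
    IsWalk src tgt p (S ++ T) q ↔ ∃ m, IsWalk src tgt p S m ∧ IsWalk src tgt m T q := by
  induction S generalizing p with
  | nil => simp [IsWalk]
  | cons s S ih => simp [IsWalk, ih, and_assoc]

lemma IsWalk.append {p m q : V} {S T : List α} (h : IsWalk src tgt p S m)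
    (h' : IsWalk src tgt m T q) : IsWalk src tgt p (S ++ T) q := isWalk_append.2 ⟨m, h, h'⟩

variable [DecidableEq V]

lemma gErase_sublist (p : V) (l : List α) : (gErase src tgt p l).Sublist l := by
  induction l generalizing p with
  | nil => simp [gErase]
  | cons s l ih =>
    unfold gErase
    split_ifs
    · exact (ih _).cons_cons _
    · exact (ih _).cons _

/-- The search for the last departure from `p` skips steps, so the current position `c` and the
wanted start `p` drift apart; that `p` is still left later on is the invariant. -/
lemma gErase_walk_aux {p c q : V} {l : List α} (hl : IsWalk src tgt c l q)
    (h : ∃ t ∈ l, src t = p) :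
    IsWalk src tgt p (gErase src tgt p l) q ∧ gErase src tgt p l ≠ [] := by
  induction l generalizing p c with
  | nil => simp at h
  | cons s l ih =>
    unfold gErase
    split_ifs with hif
    · refine ⟨⟨hif.1, ?_⟩, by simp⟩
      rcases eq_or_ne l [] with rfl | hne
      · simpa [gErase, IsWalk] using hl.2
      · refine (ih hl.2 ?_).1
        cases l with
        | nil => exact absurd rfl hne
        | cons t l => exact ⟨t, by simp, hl.2.1⟩
    · refine ih hl.2 ?_
      by_contra hcon
      push Not at hcon
      refine hif ⟨?_, hcon⟩
      obtain ⟨t, ht, htp⟩ := h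
      rcases List.mem_cons.1 ht with rfl | ht
      · exact htp
      · exact absurd htp (hcon t ht)

lemma gErase_walk {p q : V} {l : List α} (hl : IsWalk src tgt p l q) (hne : l ≠ []) :
    IsWalk src tgt p (gErase src tgt p l) q ∧ gErase src tgt p l ≠ [] := by
  refine gErase_walk_aux hl ?_
  cases l with
  | nil => exact absurd rfl hne
  | cons t l => exact ⟨t, by simp, hl.1⟩

/-- A kept step is the last one to leave its starting point. -/
lemma gErase_nodup (p : V) (l : List α) : ((gErase src tgt p l).map src).Nodup := by
  induction l generalizing p with
  | nil => simp [gErase]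
  | cons s l ih =>
    unfold gErase
    split_ifs with hif
    · rw [List.map_cons, List.nodup_cons]
      refine ⟨?_, ih _⟩
      intro hm
      obtain ⟨t, ht, hts⟩ := List.mem_map.1 hm
      exact hif.2 t ((gErase_sublist _ _).subset ht) (hts.trans hif.1)
    · exact ih _

end

variable {src tgt : α → Pt} {A : Finset Pt}

@[simp] lemma gsrc_cons (s : α) (S : List α) : gsrc src (s :: S) = src s := rfl

@[simp] lemma gtgt_append_singleton (S : List α) (s : α) : gtgt tgt (S ++ [s]) = tgt s := by
  simp [gtgt]

@[simp] lemma gtgt_singleton (s : α) : gtgt tgt [s] = tgt s := rfl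

lemma gtgt_append {S T : List α} (hT : T ≠ []) : gtgt tgt (S ++ T) = gtgt tgt T := by
  simp [gtgt, List.getLast?_append_of_ne_nil _ hT]

lemma gtgt_cons {s : α} {T : List α} (hT : T ≠ []) : gtgt tgt (s :: T) = gtgt tgt T :=
  gtgt_append (S := [s]) hT

lemma IsWalk.gsrc_eq {p q : Pt} {S : List α} (h : IsWalk src tgt p S q) (hS : S ≠ []) :
    gsrc src S = p := by
  cases S with
  | nil => exact absurd rfl hS
  | cons s S => exact h.1

lemma IsWalk.gtgt_eq {p q : Pt} {S : List α} (h : IsWalk src tgt p S q) (hS : S ≠ []) :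
    gtgt tgt S = q := by
  induction S generalizing p with
  | nil => exact absurd rfl hS
  | cons s S ih =>
    rcases eq_or_ne S [] with rfl | hS'
    · simpa [IsWalk] using h.2
    · rw [gtgt_cons hS', ih h.2 hS']

/-- Nonempty segments serve as steps of a coarser walk, so the same notions of walk, block and
erasure apply again at the next scale. -/
lemma isWalk_flatten {p q : Pt} {L : List (List α)} (h0 : ∀ b ∈ L, b ≠ []) :
    IsWalk src tgt p L.flatten q ↔ IsWalk (gsrc src) (gtgt tgt) p L q ∧
      ∀ b ∈ L, IsWalk src tgt (gsrc src b) b (gtgt tgt b) := by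
  induction L generalizing p with
  | nil => simp [IsWalk]
  | cons b L ih =>
    have hb : b ≠ [] := h0 b (by simp)
    have hL : ∀ c ∈ L, c ≠ [] := fun c hc => h0 c (by simp [hc])
    rw [List.flatten_cons, isWalk_append]
    constructor
    · rintro ⟨m, h1, h2⟩
      rw [ih hL] at h2
      have e1 := h1.gsrc_eq hb
      have e2 := h1.gtgt_eq hb
      refine ⟨⟨e1, ?_⟩, ?_⟩
      · rw [e2]; exact h2.1
      · intro c hc
        rcases List.mem_cons.1 hc with rfl | hc
        · rwa [e1, e2]
        · exact h2.2 c hc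
    · rintro ⟨⟨h1, h2⟩, h3⟩
      refine ⟨gtgt tgt b, ?_, (ih hL).2 ⟨h2, fun c hc => h3 c (by simp [hc])⟩⟩
      rw [← h1]
      exact h3 b (by simp)

/-- Used to replace the piece in each triangle by its loop erasure, which has the same ends. -/
lemma isWalk_flatMap {p q : Pt} {L : List (List α)} (f : List α → List β) {src' tgt' : β → Pt}
    (h : IsWalk (gsrc src) (gtgt tgt) p L q)
    (hf : ∀ b ∈ L, IsWalk src' tgt' (gsrc src b) (f b) (gtgt tgt b)) :
    IsWalk src' tgt' p (L.flatMap f) q := by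
  induction L generalizing p with
  | nil => simpa [IsWalk] using h
  | cons b L ih =>
    rw [List.flatMap_cons]
    have h1 := hf b (by simp)
    rw [show gsrc src b = p from h.1] at h1
    exact h1.append (ih h.2 fun c hc => hf c (by simp [hc]))

/-- Loop invariant of the scan: `p` is the last recorded hit, and since then `A` has been met at `p`
only, including at the current position `c`. -/
lemma gBlocksAux_isBlock {p c q : Pt} {acc S : List α} (hacc : IsWalk src tgt p acc c)
    (hS : IsWalk src tgt c S q) (hp : p ∈ A) (hc : c ∈ A → c = p)
    (h : ∀ s ∈ acc, src s ∈ A → src s = p) :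
    ∀ b ∈ gBlocksAux tgt A p acc S, IsBlock src tgt A b := by
  induction S generalizing p c acc with
  | nil => simp [gBlocksAux]
  | cons s S ih =>
    obtain ⟨rfl, hS⟩ := hS
    have hw : IsWalk src tgt p (acc ++ [s]) (tgt s) := hacc.append ⟨rfl, rfl⟩
    have hs : ∀ t ∈ acc ++ [s], src t ∈ A → src t = p := by
      intro t ht
      rcases List.mem_append.1 ht with ht | ht
      · exact h t ht
      · rw [List.mem_singleton.1 ht]; exact hc
    unfold gBlocksAux
    split_ifs with hif
    · intro b hb
      rcases List.mem_cons.1 hb with rfl | hb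
      · have e1 := hw.gsrc_eq (by simp)
        have e2 := hw.gtgt_eq (by simp)
        exact ⟨by simp, by rwa [e1, e2], by rw [e2]; exact hif.1, by rwa [e1],
          by rw [e1, e2]; exact hif.2, by rwa [e1]⟩
      · exact ih (p := tgt s) (c := tgt s) (acc := []) rfl hS hif.1 (fun _ => rfl) (by simp) b hb
    · exact ih hw hS hp (fun hA => by
        by_contra hne
        exact hif ⟨hA, hne⟩) hs

lemma gBlocks_isBlock {p q : Pt} {S : List α} (hS : IsWalk src tgt p S q) (hp : p ∈ A) :
    ∀ b ∈ gBlocks src tgt A S, IsBlock src tgt A b := by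
  rcases eq_or_ne S [] with rfl | hne
  · simp [gBlocks, gBlocksAux]
  unfold gBlocks
  rw [hS.gsrc_eq hne]
  exact gBlocksAux_isBlock (c := p) rfl hS hp (fun _ => rfl) (by simp)

/-- The recorded point differs from `q` until the last step arrives there, so this step closes a
block. -/
lemma gBlocksAux_flatten_of_last {p c q : Pt} {acc b : List α} (hb : IsWalk src tgt c b q)
    (hne : b ≠ []) (hq : q ∈ A) (hpq : p ≠ q) (h : ∀ s ∈ b, src s ≠ q) :
    (gBlocksAux tgt A p acc b).flatten = acc ++ b := by
  induction b generalizing p c acc with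
  | nil => exact absurd rfl hne
  | cons s b ih =>
    unfold gBlocksAux
    rcases eq_or_ne b [] with rfl | hb'
    · obtain ⟨-, h2⟩ := hb
      simp only [IsWalk] at h2
      rw [if_pos ⟨h2 ▸ hq, by rw [h2]; exact hpq.symm⟩]
      simp [gBlocksAux]
    · have hn : tgt s ≠ q := by
        cases b with
        | nil => exact absurd rfl hb'
        | cons t b =>
          have := hb.2.1
          rw [← this]
          exact h t (by simp)
      split_ifs with hif
      · simp [ih (acc := []) hb.2 hb' hn fun t ht => h t (by simp [ht])]
      · simp [ih (acc := acc ++ [s]) hb.2 hb' hpq fun t ht => h t (by simp [ht])]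

lemma gBlocksAux_flatten {p c q : Pt} {acc S b : List α} (hS : IsWalk src tgt c (S ++ b) q)
    (hc : c ∈ A → c = p) (hne : b ≠ []) (hb : gsrc src b ∈ A) (hq : q ∈ A)
    (h : ∀ s ∈ b, src s ≠ q) :
    (gBlocksAux tgt A p acc (S ++ b)).flatten = acc ++ (S ++ b) := by
  induction S generalizing p c acc with
  | nil =>
    have e : gsrc src b = c := hS.gsrc_eq hne
    refine gBlocksAux_flatten_of_last hS hne hq ?_ h
    rw [← hc (e ▸ hb)]
    cases b with
    | nil => exact absurd rfl hne
    | cons t b => rw [← e]; exact h t (by simp)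
  | cons s S ih =>
    simp only [List.cons_append]
    unfold gBlocksAux
    split_ifs with hif
    · simp [ih (acc := []) hS.2 (fun _ => rfl)]
    · rw [ih (acc := acc ++ [s]) hS.2 (fun hA => by
        by_contra hn
        exact hif ⟨hA, hn⟩)]
      simp

/-- If the last part of a walk leads from a point of `A` to a point of `A` not met before,
nothing is left over after the last hit. -/
lemma gBlocks_flatten {p q : Pt} {S b : List α} (hS : IsWalk src tgt p (S ++ b) q)
    (hne : b ≠ []) (hb : gsrc src b ∈ A) (hq : q ∈ A)
    (h : ∀ s ∈ b, src s ≠ q) : (gBlocks src tgt A (S ++ b)).flatten = S ++ b := by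
  unfold gBlocks
  rw [hS.gsrc_eq (by simp [hne])]
  exact gBlocksAux_flatten hS (fun _ => rfl) hne hb hq h

/-- Steps after the last hit are dropped, so in general only an initial part of the walk is
recovered. -/
lemma gBlocksAux_prefix (p : Pt) (acc S : List α) (hS : gBlocksAux tgt A p acc S ≠ []) :
    (gBlocksAux tgt A p acc S).flatten <+: acc ++ S := by
  induction S generalizing p acc with
  | nil => simp [gBlocksAux] at hS
  | cons s S ih =>
    unfold gBlocksAux at hS ⊢
    split_ifs at hS ⊢ with hif
    · by_cases h : gBlocksAux tgt A (tgt s) [] S = []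
      · simp [h]
      · have := ih _ _ h
        simp only [List.flatten_cons, List.append_assoc, List.cons_append, List.nil_append] at this ⊢
        simpa [List.prefix_append_right_inj] using this
    · simpa using ih _ _ hS

lemma gBlocks_flatten_sublist (S : List α) : (gBlocks src tgt A S).flatten.Sublist S := by
  by_cases h : gBlocks src tgt A S = []
  · simp [h]
  · exact (gBlocksAux_prefix _ _ _ h).sublist

/-! ### Naturality -/

variable {src' tgt' : β → Pt} {f : α → β}

lemma isWalk_map (hs : ∀ a, src' (f a) = src a) (ht : ∀ a, tgt' (f a) = tgt a) (p q : Pt)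
    (S : List α) : IsWalk src' tgt' p (S.map f) q ↔ IsWalk src tgt p S q := by
  induction S generalizing p with
  | nil => simp [IsWalk]
  | cons s S ih => simp [IsWalk, hs, ht, ih]

lemma gsrc_map (hs : ∀ a, src' (f a) = src a) (S : List α) :
    gsrc src' (S.map f) = gsrc src S := by
  cases S <;> simp [gsrc, hs]

lemma gtgt_map (ht : ∀ a, tgt' (f a) = tgt a) (S : List α) :
    gtgt tgt' (S.map f) = gtgt tgt S := by
  have : tgt' ∘ f = tgt := funext ht
  simp [gtgt, List.getLast?_map, this]

lemma gBlocksAux_map (ht : ∀ a, tgt' (f a) = tgt a) (p : Pt) (acc S : List α) :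
    gBlocksAux tgt' A p (acc.map f) (S.map f) = (gBlocksAux tgt A p acc S).map (List.map f) := by
  induction S generalizing p acc with
  | nil => simp [gBlocksAux]
  | cons s S ih =>
    have h1 := ih (tgt s) []
    have h2 := ih p (acc ++ [s])
    simp only [List.map_append, List.map_cons, List.map_nil] at h1 h2
    simp only [List.map_cons, gBlocksAux, ht, h1, h2]
    split_ifs <;> simp

lemma gBlocks_map (hs : ∀ a, src' (f a) = src a) (ht : ∀ a, tgt' (f a) = tgt a) (S : List α) :
    gBlocks src' tgt' A (S.map f) = (gBlocks src tgt A S).map (List.map f) := by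
  unfold gBlocks
  rw [gsrc_map hs, ← gBlocksAux_map ht]
  rfl

/-- Compatibility is required on `l` only: for `f = joinPath` the end points are right only for
nonempty pieces that fit together. -/
lemma gErase_map {l : List α} (hs : ∀ a ∈ l, src' (f a) = src a)
    (ht : ∀ a ∈ l, tgt' (f a) = tgt a) (p : Pt) :
    gErase src' tgt' p (l.map f) = (gErase src tgt p l).map f := by
  induction l generalizing p with
  | nil => simp [gErase]
  | cons s l ih =>
    have e : (∀ t ∈ l.map f, src' t ≠ p) ↔ ∀ t ∈ l, src t ≠ p := by
      rw [List.forall_mem_map]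
      exact forall₂_congr fun t ht => by rw [hs t (by simp [ht])]
    simp only [List.map_cons, gErase, hs s (by simp), ht s (by simp), e,
      ih (fun a ha => hs a (by simp [ha])) (fun a ha => ht a (by simp [ha]))]
    split_ifs <;> simp

end Walks

lemma splitBy_map {α β : Type*} {r : α → α → Bool} {r' : β → β → Bool} {f : α → β} {l : List α}
    (h : ∀ a ∈ l, ∀ b ∈ l, r' (f a) (f b) = r a b) :
    (l.map f).splitBy r' = (l.splitBy r).map (List.map f) := by
  rw [List.splitBy_eq_iff]
  have hmem : ∀ m ∈ l.splitBy r, ∀ a ∈ m, a ∈ l := by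
    intro m hm a ha
    rw [← List.flatten_splitBy r l]
    exact List.mem_flatten.2 ⟨m, hm, ha⟩
  refine ⟨?_, ?_, ?_, ?_⟩
  · rw [← List.map_flatten, List.flatten_splitBy]
  · simp
  · intro m' hm'
    obtain ⟨m, hm, rfl⟩ := List.mem_map.1 hm'
    rw [List.isChain_map]
    refine (List.isChain_of_mem_splitBy hm).imp_of_mem_imp ?_
    intro a b ha hb hr
    rw [h a (hmem m hm a ha) b (hmem m hm b hb)]
    exact hr
  · rw [List.isChain_map]
    refine (List.isChain_getLast_head_splitBy r l).imp_of_mem_imp ?_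
    rintro a b ha hb ⟨hna, hnb, hr⟩
    refine ⟨by simpa using hna, by simpa using hnb, ?_⟩
    rw [List.getLast_map, List.head_map,
      h _ (hmem a ha _ (List.getLast_mem hna)) _ (hmem b hb _ (List.head_mem hnb))]
    exact hr

/-! ### Paths as concatenations of segments -/

/-- The first point of a path. -/
def psrc (s : Path) : Pt := s.head?.getD ptO

/-- The last point of a path. -/
def ptgt (s : Path) : Pt := s.getLast?.getD ptO

/-- The steps of a path, as paths of length one. -/
def pairs : Path → List Path
  | p :: q :: l => [p, q] :: pairs (q :: l)
  | _ => []

/-- A nontrivial path whose interior points lie outside `A` or coincide with its first point. -/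
structure IsSegment (A : Finset Pt) (s : Path) : Prop where
  two_le : 2 ≤ s.length
  interior : ∀ x ∈ s.tail.dropLast, x ∈ A → x = psrc s

lemma IsSegment.mono {A A' : Finset Pt} {s : Path} (h : IsSegment A s) (hA : A' ⊆ A) :
    IsSegment A' s := ⟨h.two_le, fun x hx hxA => h.interior x hx (hA hxA)⟩

lemma eq_psrc_cons {s : Path} (h : s ≠ []) : s = psrc s :: s.tail := by
  cases s with
  | nil => exact absurd rfl h
  | cons a s => rfl

lemma eq_dropLast_ptgt {s : Path} (h : s ≠ []) : s = s.dropLast ++ [ptgt s] := by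
  conv_lhs => rw [← List.dropLast_append_getLast h]
  rw [ptgt, List.getLast?_eq_some_getLast h]
  rfl

lemma eq_psrc_interior_ptgt {s : Path} (h : 2 ≤ s.length) :
    s = psrc s :: (s.tail.dropLast ++ [ptgt s]) := by
  match s, h with
  | a :: b :: s, _ =>
    have h1 : ptgt (a :: b :: s) = ptgt (b :: s) := by
      simp [ptgt, List.getLast?_cons]
    rw [h1, List.tail_cons, ← eq_dropLast_ptgt (by simp)]
    rfl

lemma ptgt_cons {a : Pt} {s : Path} (h : s ≠ []) : ptgt (a :: s) = ptgt s := by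
  obtain ⟨b, s, rfl⟩ := List.exists_cons_of_ne_nil h
  simp [ptgt, List.getLast?_cons]

lemma ptgt_append {s t : Path} (h : t ≠ []) : ptgt (s ++ t) = ptgt t := by
  simp [ptgt, List.getLast?_append_of_ne_nil _ h]

/-- Dropping the first point of each segment instead of the last gives a uniform formula, in the
form in which `blocks` reads a path. -/
lemma joinPath_eq {p q : Pt} {S : List Path} (h : IsWalk psrc ptgt p S q)
    (hne : ∀ s ∈ S, s ≠ []) (hS : S ≠ []) : joinPath S = p :: S.flatMap List.tail := by
  induction S generalizing p with
  | nil => exact absurd rfl hS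
  | cons s S ih =>
    have hs := hne s (by simp)
    cases S with
    | nil =>
      simp only [joinPath, List.flatMap_cons, List.flatMap_nil, List.append_nil]
      rw [← h.1]
      exact eq_psrc_cons hs
    | cons t S =>
      have e : p :: (s :: t :: S).flatMap List.tail = s ++ (t :: S).flatMap List.tail := by
        rw [← h.1, List.flatMap_cons, ← List.cons_append, ← eq_psrc_cons hs]
      rw [joinPath, ih h.2 (fun r hr => hne r (by simp [hr])) (by simp), e]
      conv_rhs => rw [eq_dropLast_ptgt hs]
      simp

lemma ptgt_cons_flatMap_tail {p q : Pt} {S : List Path} (h : IsWalk psrc ptgt p S q)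
    (h2 : ∀ s ∈ S, 2 ≤ s.length) : ptgt (p :: S.flatMap List.tail) = q := by
  induction S generalizing p with
  | nil => simpa [ptgt, IsWalk] using h
  | cons s S ih =>
    have hs := h2 s (by simp)
    have hne : s ≠ [] := by rintro rfl; simp at hs
    have := ih h.2 fun r hr => h2 r (by simp [hr])
    rw [List.flatMap_cons, ← h.1, ← List.cons_append, ← eq_psrc_cons hne]
    rw [eq_dropLast_ptgt hne, List.append_assoc, List.singleton_append,
      ptgt_append (by simp), this]

section Nice

variable {p q : Pt} {S : List Path}

lemma joinPath_eq' (h : IsWalk psrc ptgt p S q) (h2 : ∀ s ∈ S, 2 ≤ s.length) (hS : S ≠ []) :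
    joinPath S = p :: S.flatMap List.tail :=
  joinPath_eq h (fun s hs => by rintro rfl; have := h2 _ hs; simp at this) hS

lemma psrc_joinPath (h : IsWalk psrc ptgt p S q) (h2 : ∀ s ∈ S, 2 ≤ s.length) (hS : S ≠ []) :
    psrc (joinPath S) = p := by
  rw [joinPath_eq' h h2 hS]; rfl

lemma ptgt_joinPath (h : IsWalk psrc ptgt p S q) (h2 : ∀ s ∈ S, 2 ≤ s.length) (hS : S ≠ []) :
    ptgt (joinPath S) = q := by
  rw [joinPath_eq' h h2 hS]; exact ptgt_cons_flatMap_tail h h2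

lemma two_le_length_joinPath (h : IsWalk psrc ptgt p S q) (h2 : ∀ s ∈ S, 2 ≤ s.length)
    (hS : S ≠ []) : 2 ≤ (joinPath S).length := by
  rw [joinPath_eq' h h2 hS]
  obtain ⟨s, S, rfl⟩ := List.exists_cons_of_ne_nil hS
  have := h2 s (by simp)
  simp only [List.flatMap_cons, List.length_cons, List.length_append, List.length_tail]
  omega

/-- Associativity of concatenation. -/
lemma joinPath_map_joinPath {L : List (List Path)} (h : IsWalk psrc ptgt p L.flatten q)
    (h2 : ∀ s ∈ L.flatten, 2 ≤ s.length) (hL : ∀ b ∈ L, b ≠ []) :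
    joinPath (L.map joinPath) = joinPath L.flatten := by
  rcases eq_or_ne L [] with rfl | hne
  · rfl
  have hf : L.flatten ≠ [] := by
    obtain ⟨b, L, rfl⟩ := List.exists_cons_of_ne_nil hne
    simp [hL b (by simp)]
  obtain ⟨h3, h4⟩ := (isWalk_flatten hL).1 h
  have h5 : ∀ b ∈ L, ∀ s ∈ b, 2 ≤ s.length := fun b hb s hs =>
    h2 s (List.mem_flatten.2 ⟨b, hb, hs⟩)
  have hid : IsWalk psrc ptgt p (L.map joinPath) q := by
    rw [List.map_eq_flatMap]
    refine isWalk_flatMap (fun b => [joinPath b]) h3 fun b hb => ⟨?_, ?_⟩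
    · exact psrc_joinPath (h4 b hb) (h5 b hb) (hL b hb)
    · exact ptgt_joinPath (h4 b hb) (h5 b hb) (hL b hb)
  have h6 : ∀ s ∈ L.map joinPath, 2 ≤ s.length := by
    intro s hs
    obtain ⟨b, hb, rfl⟩ := List.mem_map.1 hs
    exact two_le_length_joinPath (h4 b hb) (h5 b hb) (hL b hb)
  rw [joinPath_eq' hid h6 (by simpa using hne), joinPath_eq' h h2 hf]
  congr 1
  rw [List.flatMap_map, ← List.flatMap_id, List.flatMap_assoc]
  refine List.flatMap_congr fun b hb => ?_
  rw [joinPath_eq' (h4 b hb) (h5 b hb) (hL b hb)]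
  rfl

end Nice

lemma blocksAux_step (A : Finset Pt) (p q : Pt) (acc i rest : Path)
    (hi : ∀ x ∈ i, x ∈ A → x = p) :
    blocksAux A p acc (i ++ q :: rest) =
      if q ∈ A ∧ q ≠ p then (acc ++ (i ++ [q])) :: blocksAux A q [q] rest
      else blocksAux A p (acc ++ (i ++ [q])) rest := by
  induction i generalizing acc with
  | nil => simp [blocksAux]
  | cons a i ih =>
    rw [List.cons_append, blocksAux, if_neg fun h => h.2 (hi a (by simp) h.1),
      ih _ fun x hx => hi x (by simp [hx])]
    simp

/-- Interior points of a segment are outside `A` or equal to its start, which is a hit only if it is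
the recorded point; so the scan of points can change state only at ends of segments and runs
parallel to the scan of segments. -/
lemma blocksAux_flatMap_tail {A : Finset Pt} {p c q : Pt} {acc S : List Path}
    (hacc : IsWalk psrc ptgt p acc c) (hS : IsWalk psrc ptgt c S q) (hc : c ∈ A → c = p)
    (h1 : ∀ s ∈ acc, 2 ≤ s.length) (h2 : ∀ s ∈ S, IsSegment A s) :
    blocksAux A p (p :: acc.flatMap List.tail) (S.flatMap List.tail) =
      (gBlocksAux ptgt A p acc S).map joinPath := by
  induction S generalizing p c acc with
  | nil => simp [gBlocksAux, blocksAux]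
  | cons s S ih =>
    obtain ⟨rfl, hS⟩ := hS
    have hs := h2 s (by simp)
    have hw : IsWalk psrc ptgt p (acc ++ [s]) (ptgt s) := hacc.append ⟨rfl, rfl⟩
    have htail : s.tail = s.tail.dropLast ++ [ptgt s] := by
      have := eq_psrc_interior_ptgt hs.two_le
      conv_lhs => rw [this]
      rfl
    have h1' : ∀ t ∈ acc ++ [s], 2 ≤ t.length := by
      intro t ht
      rcases List.mem_append.1 ht with ht | ht
      · exact h1 t ht
      · rw [List.mem_singleton.1 ht]; exact hs.two_le
    have e : (p :: acc.flatMap List.tail) ++ s.tail = p :: (acc ++ [s]).flatMap List.tail := by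
      simp
    rw [List.flatMap_cons, htail, List.append_assoc, List.singleton_append,
      blocksAux_step _ _ _ _ _ _ (fun x hx hxA => by
        have := hs.interior x hx hxA
        rw [this]
        exact hc (this ▸ hxA)), ← htail, gBlocksAux, e]
    split_ifs with hif
    · rw [List.map_cons, ← ih (acc := []) (c := ptgt s) rfl hS (fun _ => rfl) (by simp)
        fun t ht => h2 t (by simp [ht]), joinPath_eq' hw h1' (by simp)]
      simp
    · exact ih hw hS (fun hA => by
        by_contra hn
        exact hif ⟨hA, hn⟩) h1' fun t ht => h2 t (by simp [ht])

/-- The segments of a path between the hits of `A`, when the path is cut into finer segments. -/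
lemma blocks_joinPath {A : Finset Pt} {p q : Pt} {S : List Path} (hS : IsWalk psrc ptgt p S q)
    (h : ∀ s ∈ S, IsSegment A s) :
    blocks A (joinPath S) = (gBlocks psrc ptgt A S).map joinPath := by
  rcases eq_or_ne S [] with rfl | hne
  · rfl
  rw [joinPath_eq' hS (fun s hs => (h s hs).two_le) hne, gBlocks, hS.gsrc_eq hne]
  exact blocksAux_flatMap_tail (acc := []) rfl hS (fun _ => rfl) (by simp) h

lemma coarse_joinPath {M : ℕ} {p q : Pt} {S : List Path} (hS : IsWalk psrc ptgt p S q)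
    (h : ∀ s ∈ S, IsSegment (GV M) s) (hne : S ≠ []) (hp : p ∈ GV M) :
    coarse M (joinPath S) = p :: (gBlocks psrc ptgt (GV M) S).map (gtgt ptgt) := by
  have hj := joinPath_eq' hS (fun s hs => (h s hs).two_le) hne
  have hb := blocks_joinPath hS h
  rw [hj] at hb ⊢
  rw [coarse, hb, List.map_map]
  congr 1
  refine List.map_congr_left fun b hbm => ?_
  have hB := gBlocks_isBlock hS hp b hbm
  have hmem : ∀ s ∈ b, 2 ≤ s.length := fun s hs => (h s
    ((gBlocks_flatten_sublist S).subset (List.mem_flatten.2 ⟨b, hbm, hs⟩))).two_le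
  have h2 := two_le_length_joinPath hB.walk hmem hB.ne_nil
  have h3 := ptgt_joinPath hB.walk hmem hB.ne_nil
  rw [← h3, Function.comp, ptgt]
  have hne : joinPath b ≠ [] := by intro h0; rw [h0] at h2; simp at h2
  rw [List.getLast?_eq_some_getLast hne]
  rfl

/-! ### Steps -/

@[simp] lemma psrc_pair (p q : Pt) : psrc [p, q] = p := rfl
@[simp] lemma ptgt_pair (p q : Pt) : ptgt [p, q] = q := rfl

lemma pairs_walk (p : Pt) (l : Path) : IsWalk psrc ptgt p (pairs (p :: l)) (ptgt (p :: l)) := by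
  induction l generalizing p with
  | nil => simp [pairs, IsWalk, ptgt]
  | cons q l ih =>
    refine ⟨rfl, ?_⟩
    rw [ptgt_cons (by simp)]
    exact ih q

lemma mem_pairs_length {w : Path} {s : Path} (h : s ∈ pairs w) : s.length = 2 := by
  induction w with
  | nil => simp [pairs] at h
  | cons p w ih =>
    cases w with
    | nil => simp [pairs] at h
    | cons q w =>
      rw [pairs, List.mem_cons] at h
      rcases h with rfl | h
      · rfl
      · exact ih h

lemma isSegment_of_length {s : Path} (h : s.length = 2) (A : Finset Pt) : IsSegment A s := by
  match s, h with
  | [p, q], _ => exact ⟨by simp, by simp⟩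

lemma flatMap_tail_pairs (p : Pt) (l : Path) : (pairs (p :: l)).flatMap List.tail = l := by
  induction l generalizing p with
  | nil => simp [pairs]
  | cons q l ih => simp [pairs, ih]

lemma joinPath_pairs {w : Path} (h : 2 ≤ w.length) : joinPath (pairs w) = w := by
  match w, h with
  | p :: q :: l, _ =>
    rw [joinPath_eq' (pairs_walk p (q :: l)) (fun s hs => (mem_pairs_length hs).ge)
      (by simp [pairs]), flatMap_tail_pairs]

lemma pairs_joinPath {p q : Pt} {D : List Path} (h : IsWalk psrc ptgt p D q)
    (h2 : ∀ d ∈ D, d.length = 2) (hD : D ≠ []) : pairs (joinPath D) = D := by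
  rw [joinPath_eq' h (fun s hs => (h2 s hs).ge) hD]
  clear hD
  induction D generalizing p with
  | nil => simp [pairs]
  | cons d D ih =>
    obtain ⟨a, b, rfl⟩ : ∃ a b, d = [a, b] := List.length_eq_two.1 (h2 d (by simp))
    obtain ⟨rfl, h⟩ := h
    have := ih h fun d hd => h2 d (by simp [hd])
    simpa [pairs] using this

/-- The step from the first to the last point of a path. -/
def ends (s : Path) : Path := [psrc s, ptgt s]

@[simp] lemma psrc_ends (s : Path) : psrc (ends s) = psrc s := rfl
@[simp] lemma ptgt_ends (s : Path) : ptgt (ends s) = ptgt s := rfl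

/-! ### Loop erasure of lists of steps -/

section Erased

variable {α β : Type*} (src tgt : α → Pt)

/-- The version of `skeleton` for lists of steps. -/
def gSkeleton (M : ℕ) (S : List α) : List (List (List α)) :=
  (gBlocks src tgt (GV M) S).splitBy
    fun g h => decide (InTriangle M (gsrc src g) (gsrc src h) (gtgt tgt h))

/-- The version of `eraseAt` for lists of steps. -/
def gEraseAt (M : ℕ) (S : List α) : List α :=
  (gErase (gsrc src) (gtgt tgt) (gsrc src S) (gBlocks src tgt (GV M) S)).flatten

/-- The version of `erased` for lists of steps. -/
def gErased : ℕ → List α → List α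
  | 0, S => S
  | M + 1, S => (gSkeleton src tgt M (gErased M S)).flatMap
      fun g => gEraseAt src tgt (M + 1) g.flatten

variable {src tgt}

lemma gEraseAt_sublist (M : ℕ) (S : List α) : (gEraseAt src tgt M S).Sublist S :=
  (gErase_sublist _ _).flatten.trans (gBlocks_flatten_sublist S)

lemma flatMap_sublist_flatten_flatten {L : List (List (List α))} {f : List (List α) → List α}
    (h : ∀ g ∈ L, (f g).Sublist g.flatten) : (L.flatMap f).Sublist L.flatten.flatten := by
  induction L with
  | nil => simp
  | cons g L ih =>
    rw [List.flatMap_cons, List.flatten_cons, List.flatten_append]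
    exact (h g (by simp)).append (ih fun g hg => h g (by simp [hg]))

lemma gErased_sublist (M : ℕ) (S : List α) : (gErased src tgt M S).Sublist S := by
  induction M with
  | zero => exact List.Sublist.refl _
  | succ M ih =>
    refine List.Sublist.trans ?_ ((gBlocks_flatten_sublist (A := GV M) (src := src)
      (tgt := tgt) _).trans ih)
    rw [gErased, gSkeleton]
    conv_rhs => rw [← List.flatten_splitBy (fun g h => decide (InTriangle M (gsrc src g)
      (gsrc src h) (gtgt tgt h))) (gBlocks src tgt (GV M) (gErased src tgt M S))]
    exact flatMap_sublist_flatten_flatten fun g _ => gEraseAt_sublist _ _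

variable {src' tgt' : β → Pt} {f : α → β}

/-- Cutting, grouping and erasing all inspect end points only. -/
lemma gErased_map (hs : ∀ a, src' (f a) = src a) (ht : ∀ a, tgt' (f a) = tgt a) (M : ℕ)
    (S : List α) : gErased src' tgt' M (S.map f) = (gErased src tgt M S).map f := by
  induction M with
  | zero => rfl
  | succ M ih =>
    rw [gErased, gErased, ih, gSkeleton, gSkeleton, gBlocks_map hs ht,
      splitBy_map (r := fun g h => decide (InTriangle M (gsrc src g) (gsrc src h) (gtgt tgt h)))
        (fun a _ b _ => by simp only [gsrc_map hs, gtgt_map ht]), List.flatMap_map,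
      List.map_flatMap]
    refine List.flatMap_congr fun g _ => ?_
    rw [← List.map_flatten, gEraseAt, gEraseAt, gBlocks_map hs ht, gsrc_map hs,
      gErase_map (src := gsrc src) (tgt := gtgt tgt) (fun a _ => gsrc_map hs a)
        (fun a _ => gtgt_map ht a), List.map_flatten]

end Erased

/-! ### The set of steps surviving loop erasure -/

/-- The sublist of the entries with index in `J`, indices starting from `k`. -/
def sel {α : Type*} (J : List ℕ) : ℕ → List α → List α
  | _, [] => []
  | k, a :: l => if k ∈ J then a :: sel J (k + 1) l else sel J (k + 1) l

lemma sel_cons_of_lt {α : Type*} {J : List ℕ} {i k : ℕ} (h : i < k) (l : List α) :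
    sel (i :: J) k l = sel J k l := by
  induction l generalizing k with
  | nil => rfl
  | cons a l ih => simp [sel, ih (h.trans k.lt_succ_self), h.ne']

/-- The indices attached to the entries increase along the list, so a sublist is determined by its
set of indices. -/
lemma map_fst_eq_sel {α : Type*} {k : ℕ} {S : List α} {T : List (α × ℕ)}
    (h : T.Sublist (S.zipIdx k)) : T.map Prod.fst = sel (T.map Prod.snd) k S := by
  induction S generalizing k T with
  | nil =>
    simp only [List.zipIdx_nil, List.sublist_nil] at h
    simp [h, sel]
  | cons a S ih =>
    rw [List.zipIdx_cons] at h
    cases h with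
    | cons _ h =>
      have : k ∉ T.map Prod.snd := by
        intro hk
        obtain ⟨x, hx, hxk⟩ := List.mem_map.1 hk
        have := List.le_snd_of_mem_zipIdx (h.subset hx)
        omega
      rw [sel, if_neg this, ih h]
    | cons_cons _ h =>
      rw [List.map_cons, List.map_cons, sel, if_pos (by simp), ih h,
        sel_cons_of_lt (Nat.lt_succ_self k)]

/-- The indices of the steps kept by `gErased`. -/
def keptIdx (M : ℕ) (e : List Path) : List ℕ :=
  (gErased (fun x : Path × ℕ => psrc x.1) (fun x => ptgt x.1) M e.zipIdx).map Prod.snd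

/-- Which steps are kept depends on the end points of the steps only. -/
lemma gErased_eq_sel (M : ℕ) (S : List Path) :
    gErased psrc ptgt M S = sel (keptIdx M (S.map ends)) 0 S := by
  -- The erasure is run on steps that carry their index. Forgetting the index gives the erasure of
  -- `S`; forgetting the path gives the kept indices, which do not change when each path is replaced
  -- by its end points.
  set T := gErased (fun x : Path × ℕ => psrc x.1) (fun x => ptgt x.1) M S.zipIdx with hT
  have h1 : T.map Prod.fst = gErased psrc ptgt M S := by
    rw [hT, ← gErased_map (f := Prod.fst) (src' := psrc) (tgt' := ptgt) (fun _ => rfl)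
      (fun _ => rfl), List.zipIdx_map_fst]
  have h2 : keptIdx M (S.map ends) = T.map Prod.snd := by
    have : (S.map ends).zipIdx = S.zipIdx.map (Prod.map ends id) := by
      rw [List.zipIdx_map]
    rw [keptIdx, this, gErased_map (src := fun x : Path × ℕ => psrc x.1)
      (tgt := fun x : Path × ℕ => ptgt x.1) (src' := fun x : Path × ℕ => psrc x.1)
      (tgt' := fun x : Path × ℕ => ptgt x.1) (f := Prod.map ends id) (fun _ => rfl)
      (fun _ => rfl), List.map_map]
    rfl
  rw [← h1, h2]
  exact map_fst_eq_sel (gErased_sublist M _)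

lemma G'_mono (N : ℕ) : G' N ⊆ G' (N + 1) := by
  induction N with
  | zero => decide +kernel
  | succ N ih =>
    rw [G', G']
    exact Finset.union_subset_union (Finset.union_subset_union (Finset.image_subset_image ih)
      (Finset.image_subset_image ih)) (Finset.image_subset_image ih)

lemma GV_mono_succ (N : ℕ) : GV N ⊆ GV (N + 1) :=
  Finset.union_subset_union (Finset.union_subset_union (G'_mono N)
    (Finset.image_subset_image (G'_mono N))) (Finset.image_subset_image (G'_mono N))

lemma GV_mono {M N : ℕ} (h : M ≤ N) : GV M ⊆ GV N := by
  induction h with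
  | refl => exact subset_rfl
  | step _ ih => exact ih.trans (GV_mono_succ _)

/-! ### Stopped walks and the triangles they pass through -/

section Groups

variable {α : Type*} {src tgt : α → Pt} {A A' : Finset Pt}

/-- A sequence of segments between hits of a smaller set. -/
lemma gBlocks_flatten_of_blocks {a b : Pt} {g : List (List α)} (hA : A ⊆ A')
    (hw : IsWalk (gsrc src) (gtgt tgt) a g b) (hne : g ≠ []) (hB : ∀ c ∈ g, IsBlock src tgt A c) :
    IsWalk src tgt a g.flatten b ∧ (gBlocks src tgt A' g.flatten).flatten = g.flatten ∧
      g.flatten ≠ [] ∧ a ∈ A ∧ b ∈ A := by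
  have hflat : IsWalk src tgt a g.flatten b :=
    (isWalk_flatten fun c hc => (hB c hc).ne_nil).2 ⟨hw, fun c hc => (hB c hc).walk⟩
  obtain ⟨g', c, rfl⟩ := (List.eq_nil_or_concat' g).resolve_left hne
  have hc := hB c (by simp)
  have hb : gtgt tgt c = b := by
    have := hw.gtgt_eq (by simp)
    simpa using this
  have ha : a ∈ A := by
    have := hw.gsrc_eq (by simp)
    rw [← this]
    rcases eq_or_ne g' [] with rfl | hg'
    · exact hc.src_mem
    · obtain ⟨d, g', rfl⟩ := List.exists_cons_of_ne_nil hg'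
      exact (hB d (by simp)).src_mem
  refine ⟨hflat, ?_, ?_, ha, hb ▸ hc.tgt_mem⟩
  · rw [List.flatten_append, List.flatten_singleton] at hflat ⊢
    refine gBlocks_flatten hflat hc.ne_nil (hA hc.src_mem) (hA (hb ▸ hc.tgt_mem)) ?_
    -- An earlier visit to the end `b` inside the last block would be a visit to `A`, hence to the
    -- start of the block, which differs from `b`.
    intro s hs hsb
    have := hc.src_eq s hs (by rw [hsb, ← hb]; exact hc.tgt_mem)
    exact hc.tgt_ne (by rw [hb, ← hsb, this])
  · simp [hc.ne_nil]

lemma gEraseAt_walk {M : ℕ} {a b : Pt} {S : List α} (hw : IsWalk src tgt a S b) (hne : S ≠ [])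
    (ha : a ∈ GV M) (hf : (gBlocks src tgt (GV M) S).flatten = S) :
    IsWalk src tgt a (gEraseAt src tgt M S) b ∧ gEraseAt src tgt M S ≠ [] := by
  have hB := gBlocks_isBlock hw ha
  have hbne : ∀ c ∈ gBlocks src tgt (GV M) S, c ≠ [] := fun c hc => (hB c hc).ne_nil
  have hw' : IsWalk (gsrc src) (gtgt tgt) a (gBlocks src tgt (GV M) S) b :=
    ((isWalk_flatten hbne).1 (hf.symm ▸ hw)).1
  have hBne : gBlocks src tgt (GV M) S ≠ [] := by
    intro h
    rw [h] at hf
    exact hne (by simpa using hf.symm)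
  obtain ⟨h1, h2⟩ := gErase_walk hw' hBne
  have hsub := (gErase_sublist (src := gsrc src) (tgt := gtgt tgt) a
    (gBlocks src tgt (GV M) S)).subset
  rw [gEraseAt, hw.gsrc_eq hne]
  refine ⟨(isWalk_flatten fun c hc => hbne c (hsub hc)).2
    ⟨h1, fun c hc => (hB c (hsub hc)).walk⟩, ?_⟩
  obtain ⟨c, l, hl⟩ := List.exists_cons_of_ne_nil h2
  rw [hl]
  have := hbne c (hsub (by rw [hl]; simp))
  simp [this]

/-- A walk from `O` stopped at the first hit of `q`, where `q` is a vertex of level `0`. -/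
structure IsStopped (src tgt : α → Pt) (q : Pt) (S : List α) : Prop where
  walk : IsWalk src tgt ptO S q
  mem : q ∈ GV 0
  ne : ∀ s ∈ S, src s ≠ q
  ne_nil : S ≠ []

lemma ptO_mem (M : ℕ) : ptO ∈ GV M := GV_mono (Nat.zero_le M) (by decide +kernel)

/-- The end `q` is a vertex at every level and is not met before, so the whole walk can play the
part of the last stretch in the general criterion. -/
lemma IsStopped.gBlocks_flatten {q : Pt} {S : List α} (h : IsStopped src tgt q S) (M : ℕ) :
    (gBlocks src tgt (GV M) S).flatten = S := by
  have := ELLF.gBlocks_flatten (A := GV M) (S := []) (b := S) (src := src) (tgt := tgt) h.walk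
    h.ne_nil (by rw [h.walk.gsrc_eq h.ne_nil]; exact ptO_mem M) (GV_mono (Nat.zero_le M) h.mem) h.ne
  simpa using this

/-- The triangles of level `M` passed through by a stopped walk. -/
lemma IsStopped.skeleton {q : Pt} {S : List α} (h : IsStopped src tgt q S) (M : ℕ) :
    IsWalk (gsrc (gsrc src)) (gtgt (gtgt tgt)) ptO (gSkeleton src tgt M S) q ∧
    ∀ g ∈ gSkeleton src tgt M S, IsWalk (gsrc src) (gtgt tgt) (gsrc (gsrc src) g) g
      (gtgt (gtgt tgt) g) ∧ g ≠ [] ∧ ∀ c ∈ g, IsBlock src tgt (GV M) c := by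
  have hB := gBlocks_isBlock h.walk (ptO_mem M)
  have hw : IsWalk (gsrc src) (gtgt tgt) ptO (gBlocks src tgt (GV M) S) q :=
    ((isWalk_flatten fun c hc => (hB c hc).ne_nil).1 ((h.gBlocks_flatten M).symm ▸ h.walk)).1
  have hflat : (gSkeleton src tgt M S).flatten = gBlocks src tgt (GV M) S :=
    List.flatten_splitBy _ _
  have hne : ∀ g ∈ gSkeleton src tgt M S, g ≠ [] := fun g hg => List.ne_nil_of_mem_splitBy hg
  obtain ⟨h1, h2⟩ := (isWalk_flatten hne).1 (hflat.symm ▸ hw)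
  exact ⟨h1, fun g hg => ⟨h2 g hg, hne g hg, fun c hc =>
    hB c (hflat ▸ List.mem_flatten.2 ⟨g, hg, hc⟩)⟩⟩

lemma gEraseAt_flatten_walk {M : ℕ} {g : List (List α)}
    (hw : IsWalk (gsrc src) (gtgt tgt) (gsrc (gsrc src) g) g (gtgt (gtgt tgt) g)) (hne : g ≠ [])
    (hB : ∀ c ∈ g, IsBlock src tgt (GV M) c) :
    IsWalk src tgt (gsrc (gsrc src) g) (gEraseAt src tgt (M + 1) g.flatten)
      (gtgt (gtgt tgt) g) ∧ gEraseAt src tgt (M + 1) g.flatten ≠ [] := by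
  obtain ⟨h1, h2, h3, h4, -⟩ := gBlocks_flatten_of_blocks (GV_mono_succ M) hw hne hB
  exact gEraseAt_walk h1 h3 (GV_mono_succ M h4) h2

/-- Erasure within a triangle preserves the entrance and exit points, so the pieces still join. -/
lemma IsStopped.gErased {q : Pt} {S : List α} (h : IsStopped src tgt q S) (M : ℕ) :
    IsStopped src tgt q (gErased src tgt M S) := by
  induction M with
  | zero => exact h
  | succ M ih =>
    obtain ⟨h1, h2⟩ := ih.skeleton M
    have hw : IsWalk src tgt ptO (ELLF.gErased src tgt (M + 1) S) q :=
      isWalk_flatMap _ h1 fun g hg =>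
        (gEraseAt_flatten_walk (h2 g hg).1 (h2 g hg).2.1 (h2 g hg).2.2).1
    refine ⟨hw, h.mem, fun s hs => h.ne s ((gErased_sublist _ _).subset hs), ?_⟩
    -- An empty list would force `O = q`, but the first step starts at `O` and no step starts at
    -- `q`.
    intro h0
    rw [h0] at hw
    obtain ⟨s, S, rfl⟩ := List.exists_cons_of_ne_nil h.ne_nil
    exact h.ne s (by simp) (h.walk.1.trans hw)

end Groups

/-! ### Operations on paths expressed through their segments -/

lemma eraseLoops_eq (p : Pt) (l : List Path) (h : ∀ s ∈ l, s ≠ []) :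
    eraseLoops p l = gErase psrc ptgt p l := by
  have key : ∀ s : Path, s ≠ [] → ∀ p, s.head? = some p ↔ psrc s = p := by
    intro s hs p
    obtain ⟨a, s, rfl⟩ := List.exists_cons_of_ne_nil hs
    simp [psrc]
  induction l generalizing p with
  | nil => rfl
  | cons s l ih =>
    have e1 := key s (h s (by simp)) p
    have e2 : (∀ t ∈ l, t.head? ≠ some p) ↔ ∀ t ∈ l, psrc t ≠ p :=
      forall₂_congr fun t ht => not_congr (key t (h t (by simp [ht])) p)
    have e3 : s.getLast?.getD p = ptgt s := by
      rw [ptgt, List.getLast?_eq_some_getLast (h s (by simp))]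
      rfl
    simp only [eraseLoops, gErase, e1, e2, e3, ih _ fun t ht => h t (by simp [ht])]

lemma eraseAt_joinPath {M : ℕ} {a b : Pt} {S : List Path} (hw : IsWalk psrc ptgt a S b)
    (hne : S ≠ []) (hs : ∀ s ∈ S, IsSegment (GV M) s) (ha : a ∈ GV M)
    (hf : (gBlocks psrc ptgt (GV M) S).flatten = S) :
    eraseAt M (joinPath S) = joinPath (gEraseAt psrc ptgt M S) := by
  have hB := gBlocks_isBlock hw ha
  have h2 : ∀ s ∈ S, 2 ≤ s.length := fun s h => (hs s h).two_le
  have hbl : ∀ c ∈ gBlocks psrc ptgt (GV M) S, ∀ s ∈ c, 2 ≤ s.length := fun c hc s hs =>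
    h2 s (hf ▸ List.mem_flatten.2 ⟨c, hc, hs⟩)
  have hhead : (joinPath S).head?.getD ptO = a := psrc_joinPath hw h2 hne
  rw [eraseAt, hhead, blocks_joinPath hw hs, eraseLoops_eq, gErase_map (src := gsrc psrc)
    (tgt := gtgt ptgt), gEraseAt, hw.gsrc_eq hne, joinPath_map_joinPath (p := a) (q := b)]
  · have := (gEraseAt_walk hw hne ha hf).1
    rwa [gEraseAt, hw.gsrc_eq hne] at this
  · intro s hs
    obtain ⟨c, hc, hsc⟩ := List.mem_flatten.1 hs
    exact hbl c ((gErase_sublist _ _).subset hc) s hsc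
  · exact fun c hc => (hB c ((gErase_sublist _ _).subset hc)).ne_nil
  · exact fun c hc => psrc_joinPath (hB c hc).walk (hbl c hc) (hB c hc).ne_nil
  · exact fun c hc => ptgt_joinPath (hB c hc).walk (hbl c hc) (hB c hc).ne_nil
  · intro s hs
    obtain ⟨c, hc, rfl⟩ := List.mem_map.1 hs
    have := two_le_length_joinPath (hB c hc).walk (hbl c hc) (hB c hc).ne_nil
    intro h0
    rw [h0] at this
    simp at this

lemma skeleton_joinPath {M : ℕ} {a : Pt} {S : List Path} (h : IsStopped psrc ptgt a S)
    (hs : ∀ s ∈ S, IsSegment (GV M) s) :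
    skeleton M (joinPath S) = (gSkeleton psrc ptgt M S).map (List.map joinPath) := by
  have hB := gBlocks_isBlock h.walk (ptO_mem M)
  have hbl : ∀ c ∈ gBlocks psrc ptgt (GV M) S, ∀ s ∈ c, 2 ≤ s.length := fun c hc s hsc =>
    (hs s (h.gBlocks_flatten M ▸ List.mem_flatten.2 ⟨c, hc, hsc⟩)).two_le
  rw [skeleton, blocks_joinPath h.walk hs, gSkeleton]
  refine splitBy_map fun c hc d hd => ?_
  have e1 := psrc_joinPath (hB c hc).walk (hbl c hc) (hB c hc).ne_nil
  have e2 := psrc_joinPath (hB d hd).walk (hbl d hd) (hB d hd).ne_nil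
  have e3 := ptgt_joinPath (hB d hd).walk (hbl d hd) (hB d hd).ne_nil
  rw [← e1, ← e2, ← e3]
  rfl

/-- Loop erasure at the scales up to `2^{-N}` of a path cut into segments of level `N`
consists in leaving out some of these segments. -/
lemma erased_joinPath {N M : ℕ} (hMN : M ≤ N) {a : Pt} {S : List Path}
    (h : IsStopped psrc ptgt a S) (hs : ∀ s ∈ S, IsSegment (GV N) s) :
    erased M (joinPath S) = joinPath (gErased psrc ptgt M S) := by
  induction M with
  | zero => rfl
  | succ M ih =>
    have hst := h.gErased M
    have hs' : ∀ s ∈ gErased psrc ptgt M S, IsSegment (GV N) s := fun s hsm =>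
      hs s ((gErased_sublist M S).subset hsm)
    obtain ⟨h1, h2⟩ := hst.skeleton M
    have hmem : ∀ g ∈ gSkeleton psrc ptgt M (gErased psrc ptgt M S), ∀ s ∈ g.flatten,
        IsSegment (GV N) s := by
      intro g hg s hsg
      refine hs' s ?_
      rw [← hst.gBlocks_flatten M]
      obtain ⟨c, hc, hsc⟩ := List.mem_flatten.1 hsg
      refine List.mem_flatten.2 ⟨c, ?_, hsc⟩
      have : (gSkeleton psrc ptgt M (gErased psrc ptgt M S)).flatten = _ :=
        List.flatten_splitBy _ _
      rw [← this]
      exact List.mem_flatten.2 ⟨g, hg, hc⟩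
    rw [erased, ih (by omega), skeleton_joinPath hst fun s hsm =>
      (hs' s hsm).mono (GV_mono (by omega)), List.map_map, gErased, List.flatMap_def,
      ← joinPath_map_joinPath (p := ptO) (q := a), List.map_map]
    · congr 1
      refine List.map_congr_left fun g hg => ?_
      obtain ⟨hg1, hg2, hg3⟩ := h2 g hg
      obtain ⟨k1, k2, k3, k4, -⟩ := gBlocks_flatten_of_blocks (GV_mono_succ M) hg1 hg2 hg3
      have hseg : ∀ s ∈ g.flatten, IsSegment (GV (M + 1)) s := fun s hsm =>
        (hmem g hg s hsm).mono (GV_mono hMN)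
      rw [Function.comp, Function.comp, joinPath_map_joinPath k1
        (fun s hs => (hseg s hs).two_le) fun c hc => (hg3 c hc).ne_nil,
        eraseAt_joinPath k1 k3 hseg (GV_mono_succ M k4) k2]
    · rw [← List.flatMap_def]
      exact (h.gErased (M + 1)).walk
    · rw [← List.flatMap_def]
      exact fun s hsm => (hs s ((gErased_sublist (M + 1) S).subset hsm)).two_le
    · intro b hb
      obtain ⟨g, hg, rfl⟩ := List.mem_map.1 hb
      exact (gEraseAt_flatten_walk (h2 g hg).1 (h2 g hg).2.1 (h2 g hg).2.2).2

lemma gBlocks_singletons {α : Type*} {src tgt : α → Pt} {A : Finset Pt} {p q : Pt} {S : List α}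
    (hw : IsWalk src tgt p S q) (h : ∀ s ∈ S, tgt s ∈ A ∧ tgt s ≠ src s) :
    gBlocks src tgt A S = S.map fun s => [s] := by
  rcases eq_or_ne S [] with rfl | hne
  · rfl
  rw [gBlocks, hw.gsrc_eq hne]
  clear hne
  induction S generalizing p with
  | nil => rfl
  | cons s S ih =>
    have hs := h s (by simp)
    rw [gBlocksAux, if_pos ⟨hs.1, hw.1 ▸ hs.2⟩, ih hw.2 fun t ht => h t (by simp [ht])]
    rfl

/-- The list `S` cuts a path, stopped at the first hit of `q`, at the hits of `G_N`. -/
structure IsCut (N : ℕ) (q : Pt) (S : List Path) : Prop extends IsStopped psrc ptgt q S where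
  seg : ∀ s ∈ S, IsSegment (GV N) s
  hits : ∀ s ∈ S, ptgt s ∈ GV N ∧ ptgt s ≠ psrc s

lemma IsCut.gErased {N : ℕ} {q : Pt} {S : List Path} (h : IsCut N q S) (M : ℕ) :
    IsCut N q (gErased psrc ptgt M S) :=
  ⟨h.toIsStopped.gErased M, fun s hs => h.seg s ((gErased_sublist M S).subset hs),
    fun s hs => h.hits s ((gErased_sublist M S).subset hs)⟩

lemma IsCut.ends {N : ℕ} {q : Pt} {S : List Path} (h : IsCut N q S) :
    IsCut N q (S.map ends) := by
  refine ⟨⟨(isWalk_map (fun _ => rfl) (fun _ => rfl) _ _ _).2 h.walk, h.mem, ?_,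
    by simpa using h.ne_nil⟩, ?_, ?_⟩
  · simpa [List.forall_mem_map] using h.ne
  · simp only [List.forall_mem_map]
    exact fun s _ => isSegment_of_length rfl _
  · simpa [List.forall_mem_map] using h.hits

lemma IsCut.blocks_eq {N : ℕ} {q : Pt} {S : List Path} (h : IsCut N q S) :
    blocks (GV N) (joinPath S) = S := by
  rw [blocks_joinPath h.walk h.seg, gBlocks_singletons h.walk h.hits, List.map_map]
  exact (List.map_congr_left fun s _ => rfl).trans (List.map_id S)

lemma IsCut.coarse_eq {N : ℕ} {q : Pt} {S : List Path} (h : IsCut N q S) :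
    coarse N (joinPath S) = joinPath (S.map ELLF.ends) := by
  have hw := h.ends.walk
  rw [coarse_joinPath h.walk h.seg h.ne_nil (ptO_mem N), gBlocks_singletons h.walk h.hits,
    joinPath_eq' hw (fun s hs => (h.ends.seg s hs).two_le) h.ends.ne_nil, List.map_map,
    List.flatMap_map]
  simp [ELLF.ends, Function.comp_def, List.map_eq_flatMap]

/-- Hits of the coarser vertex set can be read off the end points of the level-`N` segments, whence
`Q_M Q_N = Q_M`. -/
lemma IsCut.coarse_coarse {N M : ℕ} (hMN : M ≤ N) {q : Pt} {S : List Path} (h : IsCut N q S) :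
    coarse M (joinPath (S.map ELLF.ends)) = coarse M (joinPath S) := by
  rw [coarse_joinPath h.walk (fun s hs => (h.seg s hs).mono (GV_mono hMN)) h.ne_nil (ptO_mem M),
    coarse_joinPath h.ends.walk (fun s hs => (h.ends.seg s hs).mono (GV_mono hMN)) h.ends.ne_nil
    (ptO_mem M), gBlocks_map (f := ELLF.ends) (src := psrc) (tgt := ptgt) (fun _ => rfl) (fun _ => rfl),
    List.map_map]
  congr 1
  refine List.map_congr_left fun s _ => ?_
  exact gtgt_map (fun _ => rfl) s

/-- The steps grouped according to the triangles of level `N`. -/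
def groups (N : ℕ) (S : List Path) : List (List Path) :=
  (gErased psrc ptgt N S).splitBy (sameTriangle N)

lemma groups_map_ends (N : ℕ) (S : List Path) :
    groups N (S.map ends) = (groups N S).map (List.map ends) := by
  rw [groups, gErased_map (f := ends) (src := psrc) (tgt := ptgt) (fun _ => rfl) (fun _ => rfl)]
  exact splitBy_map fun _ _ _ _ => rfl

lemma IsCut.skeleton_erased {N : ℕ} {q : Pt} {S : List Path} (h : IsCut N q S) :
    skeleton N (erased N (joinPath S)) = groups N S := by
  rw [erased_joinPath le_rfl h.toIsStopped h.seg, skeleton, (h.gErased N).blocks_eq]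
  rfl

lemma IsCut.erased_succ {N : ℕ} {q : Pt} {S : List Path} (h : IsCut N q S) :
    erased (N + 1) (joinPath S) =
      joinPath ((groups N S).map fun g => eraseAt (N + 1) (joinPath g)) := by
  rw [erased, h.skeleton_erased]

/-! ### Integer coordinates for vertices, edges and triangles -/

/-- The point of the lattice of mesh `2^{-N}` with given oblique integer coordinates. -/
def lp (N : ℕ) (z : ℤ × ℤ) : Pt := ((z.1 : ℚ) / 2 ^ N, (z.2 : ℚ) / 2 ^ N)

/-- The corners `O`, `b`, `a` of the unit triangle. -/
def corner : Fin 3 → ℤ × ℤ := ![(0, 0), (1, 0), (0, 1)]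

/-- The lower left corners of the triangles of level `N`, those of level `0` being in `B`. -/
def cells (B : Set (ℤ × ℤ)) : ℕ → Set (ℤ × ℤ)
  | 0 => B
  | N + 1 => {t | ∃ T ∈ cells B N, ∃ i, t = (2 : ℤ) • T + corner i}

/-- The triangles of level `0` of `F_0^V`. -/
def base : Set (ℤ × ℤ) := {(0, 0), (-1, 0), (1, 0)}

lemma lp_injective (N : ℕ) : Function.Injective (lp N) := by
  intro z w h
  have h1 := congrArg Prod.fst h
  have h2 := congrArg Prod.snd h
  simp only [lp] at h1 h2
  have : (2 : ℚ) ^ N ≠ 0 := by positivity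
  field_simp at h1 h2
  exact Prod.ext (by exact_mod_cast h1) (by exact_mod_cast h2)

lemma half_lp (N : ℕ) (o z : ℤ × ℤ) : half (lp 0 o) (lp N z) = lp (N + 1) (z + (2 : ℤ) ^ N • o) := by
  have : (2 : ℚ) ^ N ≠ 0 := by positivity
  ext <;> simp [half, lp, pow_succ] <;> field_simp

lemma lp_corner : lp 0 (corner 0) = ptO ∧ lp 0 (corner 1) = ptB ∧ lp 0 (corner 2) = ptA := by
  simp [lp, corner, ptO, ptA, ptB]

lemma lp_succ (N : ℕ) (z : ℤ × ℤ) : lp (N + 1) ((2 : ℤ) • z) = lp N z := by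
  ext <;> simp [lp, pow_succ] <;> field_simp

/-- A triangle has an address of `N + 1` ternary digits. `cells` appends the finest digit, whereas
`G'` and `E'` prepend the coarsest one; the two constructions agree. -/
lemma mem_cells_succ_outer {N : ℕ} {t : ℤ × ℤ} : t ∈ cells {0} (N + 1) ↔
    ∃ T ∈ cells {0} N, ∃ i, t = T + (2 : ℤ) ^ N • corner i := by
  induction N generalizing t with
  | zero => simp [cells]
  | succ N ih =>
    constructor
    · rintro ⟨T, hT, i, rfl⟩
      obtain ⟨T', hT', j, rfl⟩ := ih.1 hT
      refine ⟨(2 : ℤ) • T' + corner i, ⟨T', hT', i, rfl⟩, j, ?_⟩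
      rw [smul_add, smul_smul, ← pow_succ']
      abel
    · rintro ⟨T, ⟨T', hT', i, rfl⟩, j, rfl⟩
      refine ⟨T' + (2 : ℤ) ^ N • corner j, ih.2 ⟨T', hT', j, rfl⟩, i, ?_⟩
      rw [smul_add, smul_smul, ← pow_succ']
      abel

lemma mem_G' {N : ℕ} {p : Pt} : p ∈ G' N ↔ ∃ t ∈ cells {0} N, ∃ i, p = lp N (t + corner i) := by
  obtain ⟨h0, h1, h2⟩ := lp_corner
  induction N generalizing p with
  | zero => simp [G', cells, Fin.exists_fin_succ, h0, h1, h2]; tauto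
  | succ N ih =>
    simp only [G', Finset.mem_union, Finset.mem_image, ih, mem_cells_succ_outer]
    rw [← h0, ← h1, ← h2]
    have key : ∀ j, (∃ a, (∃ t ∈ cells {0} N, ∃ i, a = lp N (t + corner i)) ∧
        half (lp 0 (corner j)) a = p) ↔ ∃ T ∈ cells {0} N, ∃ i,
          p = lp (N + 1) (T + (2 : ℤ) ^ N • corner j + corner i) := by
      intro j
      constructor
      · rintro ⟨_, ⟨t, ht, i, rfl⟩, rfl⟩
        refine ⟨t, ht, i, ?_⟩
        rw [half_lp]
        congr 1
        abel
      · rintro ⟨t, ht, i, rfl⟩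
        refine ⟨_, ⟨t, ht, i, rfl⟩, ?_⟩
        rw [half_lp]
        congr 1
        abel
    simp only [key]
    constructor
    · rintro ((⟨T, hT, i, rfl⟩ | ⟨T, hT, i, rfl⟩) | ⟨T, hT, i, rfl⟩)
      · exact ⟨_, ⟨T, hT, 0, rfl⟩, i, rfl⟩
      · exact ⟨_, ⟨T, hT, 2, rfl⟩, i, rfl⟩
      · exact ⟨_, ⟨T, hT, 1, rfl⟩, i, rfl⟩
    · rintro ⟨_, ⟨T, hT, j, rfl⟩, i, rfl⟩
      fin_cases j
      · exact Or.inl (Or.inl ⟨T, hT, i, rfl⟩)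
      · exact Or.inr ⟨T, hT, i, rfl⟩
      · exact Or.inl (Or.inr ⟨T, hT, i, rfl⟩)

lemma mem_E' {N : ℕ} {e : Sym2 Pt} : e ∈ E' N ↔ ∃ t ∈ cells {0} N, ∃ i j, i ≠ j ∧
    e = s(lp N (t + corner i), lp N (t + corner j)) := by
  obtain ⟨h0, h1, h2⟩ := lp_corner
  induction N generalizing e with
  | zero =>
    have s1 := Sym2.eq_swap (a := ptO) (b := ptA)
    have s2 := Sym2.eq_swap (a := ptO) (b := ptB)
    have s3 := Sym2.eq_swap (a := ptA) (b := ptB)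
    simp only [E', cells, Fin.exists_fin_succ, h0, Finset.mem_insert,
      Finset.mem_singleton, Set.mem_singleton_iff, exists_eq_left, zero_add]
    simp [h1, h2]
    rw [s1, s2, s3]
    tauto
  | succ N ih =>
    simp only [E', Finset.mem_union, Finset.mem_image, ih, mem_cells_succ_outer]
    rw [← h0, ← h1, ← h2]
    have key : ∀ k, (∃ a, (∃ t ∈ cells {0} N, ∃ i j, i ≠ j ∧
        a = s(lp N (t + corner i), lp N (t + corner j))) ∧
        Sym2.map (half (lp 0 (corner k))) a = e) ↔ ∃ T ∈ cells {0} N, ∃ i j, i ≠ j ∧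
          e = s(lp (N + 1) (T + (2 : ℤ) ^ N • corner k + corner i),
            lp (N + 1) (T + (2 : ℤ) ^ N • corner k + corner j)) := by
      intro k
      constructor
      · rintro ⟨_, ⟨t, ht, i, j, hij, rfl⟩, rfl⟩
        refine ⟨t, ht, i, j, hij, ?_⟩
        rw [Sym2.map_mk, half_lp, half_lp, add_right_comm, add_right_comm t (corner j)]
      · rintro ⟨t, ht, i, j, hij, rfl⟩
        refine ⟨_, ⟨t, ht, i, j, hij, rfl⟩, ?_⟩
        rw [Sym2.map_mk, half_lp, half_lp, add_right_comm, add_right_comm t (corner j)]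
    simp only [key]
    constructor
    · rintro ((⟨T, hT, h⟩ | ⟨T, hT, h⟩) | ⟨T, hT, h⟩)
      · exact ⟨_, ⟨T, hT, 0, rfl⟩, h⟩
      · exact ⟨_, ⟨T, hT, 2, rfl⟩, h⟩
      · exact ⟨_, ⟨T, hT, 1, rfl⟩, h⟩
    · rintro ⟨_, ⟨T, hT, j, rfl⟩, h⟩
      fin_cases j
      · exact Or.inl (Or.inl ⟨T, hT, h⟩)
      · exact Or.inr ⟨T, hT, h⟩
      · exact Or.inl (Or.inr ⟨T, hT, h⟩)

lemma mem_cells {B : Set (ℤ × ℤ)} {N : ℕ} {t : ℤ × ℤ} :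
    t ∈ cells B N ↔ ∃ T ∈ cells {0} N, ∃ o ∈ B, t = T + (2 : ℤ) ^ N • o := by
  induction N generalizing t with
  | zero =>
    refine ⟨fun h => ⟨0, rfl, t, h, by simp⟩, ?_⟩
    rintro ⟨T, rfl, o, ho, rfl⟩
    simpa [cells] using ho
  | succ N ih =>
    constructor
    · rintro ⟨T, hT, i, rfl⟩
      obtain ⟨T', hT', o, ho, rfl⟩ := ih.1 hT
      refine ⟨_, ⟨T', hT', i, rfl⟩, o, ho, ?_⟩
      rw [smul_add, smul_smul, ← pow_succ']
      abel
    · rintro ⟨_, ⟨T', hT', i, rfl⟩, o, ho, rfl⟩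
      refine ⟨_, ih.2 ⟨T', hT', o, ho, rfl⟩, i, ?_⟩
      rw [smul_add, smul_smul, ← pow_succ']
      abel

/-- The reflection of a triangle of level `N`. -/
def reflCell (t : ℤ × ℤ) : ℤ × ℤ := (-t.1 - t.2 - 1, t.2)

lemma reflCell_mem {N : ℕ} {t : ℤ × ℤ} (h : t ∈ cells {0} N) :
    reflCell t + (2 : ℤ) ^ N • (1, 0) ∈ cells {0} N := by
  induction N generalizing t with
  | zero => simp [cells, reflCell] at h ⊢; subst h; simp
  | succ N ih =>
    obtain ⟨T, hT, i, rfl⟩ := h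
    -- The reflection exchanges the lower corners and fixes the top one.
    refine ⟨_, ih hT, ![1, 0, 2] i, ?_⟩
    fin_cases i <;> ext <;> simp [reflCell, corner, pow_succ] <;> ring

/-- `F'_N` is symmetric about the vertical line through the midpoint of `Ob`, so its reflection in
the y-axis is also a translate. This makes `F_N` and `F_N^V` unions of translates of `F'_N`. -/
lemma reflCell_mem_iff {N : ℕ} {t : ℤ × ℤ} :
    (∃ T ∈ cells {0} N, t = reflCell T) ↔ ∃ T ∈ cells {0} N, t = T + (2 : ℤ) ^ N • (-1, 0) := by
  constructor
  · rintro ⟨T, hT, rfl⟩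
    refine ⟨_, reflCell_mem hT, ?_⟩
    ext <;> simp
  · rintro ⟨T, hT, rfl⟩
    refine ⟨_, reflCell_mem hT, ?_⟩
    ext <;> simp [reflCell]; ring

lemma reflY_lp (N : ℕ) (t : ℤ × ℤ) (i : Fin 3) :
    reflY (lp N (t + corner i)) = lp N (reflCell t + corner (![1, 0, 2] i)) := by
  have : (2 : ℚ) ^ N ≠ 0 := by positivity
  fin_cases i <;> ext <;> simp [reflY, lp, reflCell, corner] <;> field_simp <;> ring

lemma lp_add_ptB (N : ℕ) (z : ℤ × ℤ) : lp N z + ptB = lp N (z + (2 : ℤ) ^ N • (1, 0)) := by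
  have : (2 : ℚ) ^ N ≠ 0 := by positivity
  ext <;> simp [lp, ptB]; field_simp

lemma mem_G {N : ℕ} {p : Pt} :
    p ∈ G N ↔ ∃ t ∈ cells {(0, 0), (-1, 0)} N, ∃ i, p = lp N (t + corner i) := by
  simp only [G, Finset.mem_union, Finset.mem_image, mem_G']
  have key : (∃ a, (∃ t ∈ cells {0} N, ∃ i, a = lp N (t + corner i)) ∧ reflY a = p) ↔
      ∃ t, (∃ T ∈ cells {0} N, t = reflCell T) ∧ ∃ i, p = lp N (t + corner i) := by
    constructor
    · rintro ⟨_, ⟨t, ht, i, rfl⟩, rfl⟩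
      exact ⟨_, ⟨t, ht, rfl⟩, _, reflY_lp N t i⟩
    · rintro ⟨_, ⟨t, ht, rfl⟩, i, rfl⟩
      refine ⟨_, ⟨t, ht, ![1, 0, 2] i, rfl⟩, ?_⟩
      rw [reflY_lp]
      fin_cases i <;> rfl
  simp only [key, reflCell_mem_iff]
  constructor
  · rintro (⟨t, ht, h⟩ | ⟨t, ⟨T, hT, rfl⟩, h⟩)
    · exact ⟨t, mem_cells.2 ⟨t, ht, (0, 0), by simp, by ext <;> simp⟩, h⟩
    · exact ⟨_, mem_cells.2 ⟨T, hT, (-1, 0), by simp, rfl⟩, h⟩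
  · rintro ⟨t, ht, h⟩
    obtain ⟨T, hT, o, ho, rfl⟩ := mem_cells.1 ht
    rcases ho with rfl | rfl
    · left; refine ⟨T, hT, ?_⟩; convert h using 5; ext <;> simp
    · exact Or.inr ⟨_, ⟨T, hT, rfl⟩, h⟩

lemma mem_GV {N : ℕ} {p : Pt} :
    p ∈ GV N ↔ ∃ t ∈ cells base N, ∃ i, p = lp N (t + corner i) := by
  simp only [GV, Finset.mem_union, Finset.mem_image, mem_G', mem_G]
  constructor
  · rintro (⟨t, ht, h⟩ | ⟨_, ⟨t, ht, i, rfl⟩, rfl⟩)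
    · obtain ⟨T, hT, o, ho, rfl⟩ := mem_cells.1 ht
      exact ⟨_, mem_cells.2 ⟨T, hT, o, by rcases ho with rfl | rfl <;> simp [base], rfl⟩, h⟩
    · refine ⟨_, mem_cells.2 ⟨t, ht, (1, 0), by simp [base], rfl⟩, i, ?_⟩
      rw [lp_add_ptB, add_right_comm]
  · rintro ⟨t, ht, i, rfl⟩
    obtain ⟨T, hT, o, ho, rfl⟩ := mem_cells.1 ht
    rcases ho with rfl | rfl | rfl
    · exact Or.inl ⟨_, mem_cells.2 ⟨T, hT, (0, 0), by simp, rfl⟩, i, rfl⟩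
    · exact Or.inl ⟨_, mem_cells.2 ⟨T, hT, (-1, 0), by simp, rfl⟩, i, rfl⟩
    · refine Or.inr ⟨_, ⟨T, hT, i, rfl⟩, ?_⟩
      rw [lp_add_ptB, add_right_comm]

lemma mem_E {N : ℕ} {e : Sym2 Pt} : e ∈ E N ↔ ∃ t ∈ cells {(0, 0), (-1, 0)} N, ∃ i j, i ≠ j ∧
    e = s(lp N (t + corner i), lp N (t + corner j)) := by
  simp only [E, Finset.mem_union, Finset.mem_image, mem_E']
  have key : (∃ a, (∃ t ∈ cells {0} N, ∃ i j, i ≠ j ∧ a = s(lp N (t + corner i),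
      lp N (t + corner j))) ∧ Sym2.map reflY a = e) ↔
      ∃ t, (∃ T ∈ cells {0} N, t = reflCell T) ∧ ∃ i j, i ≠ j ∧
        e = s(lp N (t + corner i), lp N (t + corner j)) := by
    have hinv : ∀ i : Fin 3, ![1, 0, 2] (![1, 0, 2] i) = i := by decide
    constructor
    · rintro ⟨_, ⟨t, ht, i, j, hij, rfl⟩, rfl⟩
      refine ⟨_, ⟨t, ht, rfl⟩, ![1, 0, 2] i, ![1, 0, 2] j, ?_, ?_⟩
      · intro h
        have := congrArg (![1, 0, 2] : Fin 3 → Fin 3) h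
        rw [hinv, hinv] at this
        exact hij this
      · rw [Sym2.map_mk, reflY_lp, reflY_lp]
    · rintro ⟨_, ⟨t, ht, rfl⟩, i, j, hij, rfl⟩
      refine ⟨_, ⟨t, ht, ![1, 0, 2] i, ![1, 0, 2] j, ?_, rfl⟩, ?_⟩
      · intro h
        have := congrArg (![1, 0, 2] : Fin 3 → Fin 3) h
        rw [hinv, hinv] at this
        exact hij this
      · rw [Sym2.map_mk, reflY_lp, reflY_lp, hinv, hinv]
  simp only [key, reflCell_mem_iff]
  constructor
  · rintro (⟨t, ht, h⟩ | ⟨t, ⟨T, hT, rfl⟩, h⟩)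
    · exact ⟨t, mem_cells.2 ⟨t, ht, (0, 0), by simp, by ext <;> simp⟩, h⟩
    · exact ⟨_, mem_cells.2 ⟨T, hT, (-1, 0), by simp, rfl⟩, h⟩
  · rintro ⟨t, ht, h⟩
    obtain ⟨T, hT, o, ho, rfl⟩ := mem_cells.1 ht
    rcases ho with rfl | rfl
    · left
      refine ⟨T, hT, ?_⟩
      have e0 : T + (2 : ℤ) ^ N • ((0, 0) : ℤ × ℤ) = T := by ext <;> simp
      rwa [e0] at h
    · exact Or.inr ⟨_, ⟨T, hT, rfl⟩, h⟩

lemma mem_EV {N : ℕ} {e : Sym2 Pt} : e ∈ EV N ↔ ∃ t ∈ cells base N, ∃ i j, i ≠ j ∧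
    e = s(lp N (t + corner i), lp N (t + corner j)) := by
  simp only [EV, Finset.mem_union, Finset.mem_image, mem_E', mem_E]
  constructor
  · rintro (⟨t, ht, h⟩ | ⟨_, ⟨t, ht, i, j, hij, rfl⟩, rfl⟩)
    · obtain ⟨T, hT, o, ho, rfl⟩ := mem_cells.1 ht
      exact ⟨_, mem_cells.2 ⟨T, hT, o, by rcases ho with rfl | rfl <;> simp [base], rfl⟩, h⟩
    · refine ⟨_, mem_cells.2 ⟨t, ht, (1, 0), by simp [base], rfl⟩, i, j, hij, ?_⟩
      rw [Sym2.map_mk, lp_add_ptB, lp_add_ptB, add_right_comm, add_right_comm t (corner j)]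
  · rintro ⟨t, ht, i, j, hij, rfl⟩
    obtain ⟨T, hT, o, ho, rfl⟩ := mem_cells.1 ht
    rcases ho with rfl | rfl | rfl
    · exact Or.inl ⟨_, mem_cells.2 ⟨T, hT, (0, 0), by simp, rfl⟩, i, j, hij, rfl⟩
    · exact Or.inl ⟨_, mem_cells.2 ⟨T, hT, (-1, 0), by simp, rfl⟩, i, j, hij, rfl⟩
    · refine Or.inr ⟨_, ⟨T, hT, i, j, hij, rfl⟩, ?_⟩
      rw [Sym2.map_mk, lp_add_ptB, lp_add_ptB, add_right_comm, add_right_comm T (corner j)]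

/-- The three corners are distinct modulo 2. -/
lemma two_smul_add_corner_inj {T T' : ℤ × ℤ} {i j : Fin 3}
    (h : (2 : ℤ) • T + corner i = (2 : ℤ) • T' + corner j) : T = T' ∧ i = j := by
  have h1 := congrArg Prod.fst h
  have h2 := congrArg Prod.snd h
  fin_cases i <;> fin_cases j <;> simp [corner] at h1 h2 ⊢ <;>
    first
    | exact Prod.ext (by omega) (by omega)
    | (exfalso; omega)

lemma mem_cells_succ {B : Set (ℤ × ℤ)} {N : ℕ} {T : ℤ × ℤ} {i : Fin 3} :
    (2 : ℤ) • T + corner i ∈ cells B (N + 1) ↔ T ∈ cells B N := by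
  constructor
  · rintro ⟨T', hT', j, h⟩
    rwa [(two_smul_add_corner_inj h).1]
  · exact fun h => ⟨T, h, i, rfl⟩

/-- `z` is a corner of exactly two triangles of level `N`. -/
def IsInner (N : ℕ) (z : ℤ × ℤ) : Prop := ∃ k, ∀ i, z - corner i ∈ cells base N ↔ i ≠ k

/-- Of the seven vertices of `F_0^V`, only `O` and `b` belong to two triangles; the set lists the
other five. -/
lemma isInner_zero {z : ℤ × ℤ} {i : Fin 3} (h : z - corner i ∈ cells base 0) :
    IsInner 0 z ∨ z ∈ ({(0, 1), (-1, 0), (-1, 1), (1, 1), (2, 0)} : Set (ℤ × ℤ)) := by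
  obtain ⟨t, ht, rfl⟩ : ∃ t ∈ base, z = t + corner i := ⟨_, h, by simp⟩
  have key : ∀ k, (∀ j, t + corner i - corner j ∈ base ↔ j ≠ k) →
      IsInner 0 (t + corner i) := fun k hk => ⟨k, hk⟩
  rcases ht with rfl | rfl | rfl <;> fin_cases i
  · exact Or.inl (key 2 (by simp [corner, base, Fin.forall_fin_succ, Prod.ext_iff]))
  · exact Or.inl (key 2 (by simp [corner, base, Fin.forall_fin_succ, Prod.ext_iff]))
  · exact Or.inr (by simp [corner])
  · exact Or.inr (by simp [corner])
  · exact Or.inl (key 2 (by simp [corner, base, Fin.forall_fin_succ, Prod.ext_iff]))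
  · exact Or.inr (by simp [corner])
  · exact Or.inl (key 2 (by simp [corner, base, Fin.forall_fin_succ, Prod.ext_iff]))
  · exact Or.inr (by simp [corner])
  · exact Or.inr (by simp [corner])

/-- A vertex already present one level earlier keeps its number of triangles, and a new vertex is
the midpoint of a side, shared by the two subtriangles at the ends of that side. -/
lemma isInner_or {N : ℕ} {z : ℤ × ℤ} {i : Fin 3} (h : z - corner i ∈ cells base N) :
    IsInner N z ∨ ∃ o ∈ ({(0, 1), (-1, 0), (-1, 1), (1, 1), (2, 0)} : Set (ℤ × ℤ)),
      z = (2 : ℤ) ^ N • o := by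
  induction N generalizing z i with
  | zero =>
    rcases isInner_zero h with h | h
    · exact Or.inl h
    · exact Or.inr ⟨z, h, by simp⟩
  | succ N ih =>
    obtain ⟨T, hT, j, hz⟩ := h
    have hz : z = (2 : ℤ) • T + corner j + corner i := by rw [← hz]; abel
    -- Equal indices mean that `z` is twice a vertex of `T`, an old vertex; different ones that it
    -- is a midpoint.
    rcases eq_or_ne i j with rfl | hij
    · have e : ∀ m, z - corner m = (2 : ℤ) • (T + corner i - corner m) + corner m := by
        intro m
        rw [hz, smul_sub, smul_add, two_smul ℤ (corner i), two_smul ℤ (corner m)]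
        abel
      have h' : (T + corner i) - corner i ∈ cells base N := by simpa using hT
      rcases ih h' with ⟨k, hk⟩ | ⟨o, ho, hzo⟩
      · left
        refine ⟨k, fun m => ?_⟩
        rw [e, mem_cells_succ, hk]
      · right
        refine ⟨o, ho, ?_⟩
        rw [pow_succ', ← smul_smul, ← hzo, hz, smul_add, two_smul ℤ (corner i)]
        abel
    · left
      have hk : ∀ i j : Fin 3, i ≠ j → ∃ k, k ≠ i ∧ k ≠ j ∧ ∀ m, m ≠ k → m = i ∨ m = j := by
        decide
      have hk := hk i j hij
      obtain ⟨k, hki, hkj, hk⟩ := hk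
      refine ⟨k, fun m => ⟨?_, fun hm => ?_⟩⟩
      · rintro hmem rfl
        obtain ⟨T', hT', n, hn⟩ := hmem
        rw [hz] at hn
        have h1 := congrArg Prod.fst hn
        have h2 := congrArg Prod.snd hn
        clear hn hT' hk hz ih
        fin_cases i <;> fin_cases j <;> fin_cases m <;> fin_cases n <;>
          simp [corner] at hki hkj hij h1 h2 <;> omega
      · rcases hk m hm with rfl | rfl
        · exact ⟨T, hT, j, by rw [hz]; abel⟩
        · exact ⟨T, hT, i, by rw [hz]; abel⟩

lemma lp_sub (N : ℕ) (z w : ℤ × ℤ) : lp N z - lp N w = lp N (z - w) := by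
  ext <;> simp [lp, sub_div]

lemma lp_mem_GV_succ {N : ℕ} {z : ℤ × ℤ} (h : lp (N + 1) z ∈ GV N) : ∃ y, z = (2 : ℤ) • y := by
  obtain ⟨t, -, i, ht⟩ := mem_GV.1 h
  exact ⟨_, lp_injective _ (ht.trans (lp_succ _ _).symm)⟩

lemma corner_sub_inj {t s : ℤ × ℤ} {i j m n : Fin 3} (hij : i ≠ j) (h : t + corner i = s + corner m)
    (h' : t + corner j = s + corner n) : t = s := by
  have h1 := congrArg Prod.fst h
  have h2 := congrArg Prod.snd h
  have h3 := congrArg Prod.fst h'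
  have h4 := congrArg Prod.snd h'
  clear h h'
  fin_cases i <;> fin_cases j <;> fin_cases m <;> fin_cases n <;>
    simp [corner] at hij h1 h2 h3 h4 <;> exact Prod.ext (by omega) (by omega)

lemma lp_add_corner (M : ℕ) (t : ℤ × ℤ) : lp M (t + corner 0) = lp M t ∧
    lp M t + ((1 / 2 : ℚ) ^ M) • ptB = lp M (t + corner 1) ∧
    lp M t + ((1 / 2 : ℚ) ^ M) • ptA = lp M (t + corner 2) := by
  refine ⟨?_, ?_, ?_⟩ <;> ext <;> simp [lp, corner, ptA, ptB, add_div]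

/-- A triangle containing an edge is determined by the edge. -/
lemma inTriangle_iff {M : ℕ} {t z : ℤ × ℤ} (ht : t ∈ cells base M) {i j : Fin 3} (hij : i ≠ j) :
    InTriangle M (lp M z) (lp M (t + corner i)) (lp M (t + corner j)) ↔
      ∃ m, z = t + corner m := by
  have hmem : ∀ s : ℤ × ℤ, ∀ p, p ∈ [lp M s, lp M s + ((1 / 2 : ℚ) ^ M) • ptA,
      lp M s + ((1 / 2 : ℚ) ^ M) • ptB] ↔ ∃ m, p = lp M (s + corner m) := by
    intro s p
    obtain ⟨h0, h1, h2⟩ := lp_add_corner M s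
    rw [h1, h2]
    simp only [List.mem_cons, List.not_mem_nil, or_false, Fin.exists_fin_succ]
    simp [h0]
    tauto
  constructor
  · rintro ⟨c, hc, -, -, h⟩
    obtain ⟨s, -, m, rfl⟩ := mem_GV.1 hc
    simp only [hmem] at h
    obtain ⟨a, ha⟩ := h (lp M z) (by simp)
    obtain ⟨b, hb⟩ := h (lp M (t + corner i)) (by simp)
    obtain ⟨d, hd⟩ := h (lp M (t + corner j)) (by simp)
    have := corner_sub_inj hij (lp_injective M hb) (lp_injective M hd)
    rw [this]
    exact ⟨a, lp_injective M ha⟩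
  · rintro ⟨m, rfl⟩
    obtain ⟨h0, h1, h2⟩ := lp_add_corner M t
    refine ⟨lp M t, mem_GV.2 ⟨t, ht, 0, h0.symm⟩, ?_, ?_, ?_⟩
    · rw [h2]; exact mem_GV.2 ⟨t, ht, 2, rfl⟩
    · rw [h1]; exact mem_GV.2 ⟨t, ht, 1, rfl⟩
    · simp only [hmem]
      intro p hp
      simp only [List.mem_cons, List.not_mem_nil, or_false] at hp
      rcases hp with rfl | rfl | rfl <;> exact ⟨_, rfl⟩

lemma corner_injective : Function.Injective corner := by decide

/-- Any side of an upward triangle determines the lower left corner by coordinatewise minima; this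
makes the triangle of an edge computable in `Config.inTri`. -/
lemma min_corners {t : ℤ × ℤ} {i j : Fin 3} (hij : i ≠ j) :
    t = (min (t + corner i).1 (t + corner j).1, min (t + corner i).2 (t + corner j).2) := by
  fin_cases i <;> fin_cases j <;> simp [corner] at hij ⊢

/-! ### Labels -/

/-- Labels for the vertices visited by a path from `p` to `q`, or from `p` via `q` to `r`, where
`p`, `q`, `r` are the corners of a triangle: corners and midpoints of the triangle `pqr`,
midpoints of the second triangle at `p`, midpoints of the second triangle at `q`. -/
inductive Label
  | P | Q | R | PQ | PR | QR | PP1 | PP2 | P12 | QQ1 | QQ2 | Q12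
  deriving DecidableEq

open Label

instance : Fintype Label where
  elems := {P, Q, R, PQ, PR, QR, PP1, PP2, P12, QQ1, QQ2, Q12}
  complete x := by cases x <;> decide

/-- The neighbours of a vertex. -/
def nb : Label → List Label
  | P => [PQ, PR, PP1, PP2]
  | Q => [PQ, QR, QQ1, QQ2]
  | R => [PR, QR]
  | PQ => [P, PR, Q, QR]
  | PR => [P, PQ, R, QR]
  | QR => [Q, PQ, R, PR]
  | PP1 => [P, PP2, P12]
  | PP2 => [P, PP1, P12]
  | P12 => [PP1, PP2]
  | QQ1 => [Q, QQ2, Q12]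
  | QQ2 => [Q, QQ1, Q12]
  | Q12 => [QQ1, QQ2]

/-- The corners of the triangle `pqr`. -/
def isCorner : Label → Bool
  | P | Q | R => true
  | _ => false

/-- Positions of `p` and `q` as corners: `i`, `j` in the triangle `pqr`, and `i'`, `j'` in the second
triangles at `p` and `q`. -/
structure Config where
  i : Fin 3
  j : Fin 3
  i' : Fin 3
  j' : Fin 3
  hij : i ≠ j
  hi : i ≠ i'
  hj : j ≠ j'

namespace Config

/-- The position of the vertex with a given label relative to `p`, in units of the level `N + 1`. -/
def pos (i j i' j' : Fin 3) : Label → ℤ × ℤ := fun l =>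
  let e := corner j - corner i
  -- In `Fin 3` the three indices sum to zero, so `-(i + j)` is the third corner; likewise `i' + 1`
  -- and `i' + 2` are the two corners other than `i'`.
  let f := corner (-(i + j)) - corner i
  let e' := corner (i' + 1) - corner i'
  let f' := corner (i' + 2) - corner i'
  let e'' := corner (j' + 1) - corner j'
  let f'' := corner (j' + 2) - corner j'
  match l with
  | P => 0
  | Q => e + e
  | R => f + f
  | PQ => e
  | PR => f
  | QR => e + f
  | PP1 => e'
  | PP2 => f'
  | P12 => e' + f'
  | QQ1 => e + e + e''
  | QQ2 => e + e + f''
  | Q12 => e + e + e'' + f''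

variable (c : Config)

/-- The position of the vertex with a given label. -/
def off (l : Label) : ℤ × ℤ := pos c.i c.j c.i' c.j' l

/-- The reference configuration. -/
def ref : Config := ⟨0, 1, 1, 0, by decide, by decide, by decide⟩

/-- There are finitely many configurations, so geometric statements relative to `p` can be proved by
evaluation. -/
lemma forall_config {p : (i j i' j' : Fin 3) → Prop}
    (h : ∀ i j i' j' : Fin 3, i ≠ j → i ≠ i' → j ≠ j' → p i j i' j') : p c.i c.j c.i' c.j' :=
  h _ _ _ _ c.hij c.hi c.hj

lemma off_injective : Function.Injective c.off := by
  have := c.forall_config (p := fun i j i' j' => ∀ x y, pos i j i' j' x = pos i j i' j' y → x = y)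
    (by decide +kernel)
  exact fun x y h => this x y h

end Config

/-- The first label of the paths from `p` (`false`) or from `q` (`true`). -/
def startL : Bool → Label
  | false => P
  | true => Q

/-- The last label of the paths from `p` (`false`) or from `q` (`true`). -/
def endL : Bool → Label
  | false => Q
  | true => R

/-- Labels which a path from `startL` may visit before it ends. -/
def active : Bool → List Label
  | false => [P, PQ, PR, QR, PP1, PP2, P12]
  | true => [Q, PQ, PR, QR, QQ1, QQ2, Q12]

/-- Twice the inner product, in integer oblique coordinates. -/
def dotZ (z w : ℤ × ℤ) : ℤ := 2 * (z.1 * w.1 + z.2 * w.2) + (z.1 * w.2 + z.2 * w.1)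

lemma dotp_lp (N : ℕ) (z w : ℤ × ℤ) :
    dotp (lp N z) (lp N w) = (dotZ z w : ℚ) / (2 * (2 ^ N * 2 ^ N)) := by
  have : (2 : ℚ) ^ N ≠ 0 := by positivity
  simp [dotp, lp, dotZ]
  field_simp

lemma dotp_lp_neg (N : ℕ) (z w : ℤ × ℤ) : dotp (lp N z) (lp N w) < 0 ↔ dotZ z w < 0 := by
  rw [dotp_lp, div_neg_iff]
  have : (0 : ℚ) < 2 * (2 ^ N * 2 ^ N) := by positivity
  constructor
  · rintro (h | h)
    · exact absurd h.2 this.le.not_gt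
    · exact_mod_cast h.1
  · intro h
    exact Or.inr ⟨by exact_mod_cast h, this⟩

namespace Config

/-- The triangle `pqr` (`false` for both) and the second triangles, relative to `p`. -/
def tri (i j i' j' : Fin 3) : Bool → Bool → ℤ × ℤ
  | _, false => -corner i
  | false, true => -corner i'
  | true, true => corner j - corner i - corner j'

/-- The vertex `p` or `q` relative to `p`. -/
def vert (i j : Fin 3) : Bool → ℤ × ℤ
  | false => 0
  | true => corner j - corner i

variable (c : Config)

lemma off_startL (s : Bool) : c.off (startL s) = (2 : ℤ) • vert c.i c.j s := by
  cases s
  · rfl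
  · simp [startL, off, pos, vert, two_smul]

/-- These labels are midpoints of sides, and a midpoint lies in one triangle of level `N` only. -/
lemma exists_tri_of_active (s : Bool) (y : Label) (hy : y ∈ active s) (hys : y ≠ startL s)
    (m n : Fin 3) {T : ℤ × ℤ} (h : c.off y = (2 : ℤ) • T + corner m + corner n) :
    ∃ d, T = tri c.i c.j c.i' c.j' s d := by
  -- Parity conditions and division by 2 replace the unknown integer pair `T`, so that the statement
  -- becomes decidable.
  have := c.forall_config (p := fun i j i' j' => ∀ (s : Bool), ∀ y ∈ active s, y ≠ startL s →
    ∀ m n : Fin 3,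
    (pos i j i' j' y - (corner m + corner n)).1 % 2 = 0 →
    (pos i j i' j' y - (corner m + corner n)).2 % 2 = 0 →
    ∃ d, ((pos i j i' j' y - (corner m + corner n)).1 / 2,
      (pos i j i' j' y - (corner m + corner n)).2 / 2) = tri i j i' j' s d)
    (by decide +kernel) s y hy hys m n
  have e : pos c.i c.j c.i' c.j' y - (corner m + corner n) = (2 : ℤ) • T := by
    rw [← off, h]; abel
  rw [e] at this
  obtain ⟨d, hd⟩ := this (by simp) (by simp)
  refine ⟨d, hd ▸ ?_⟩
  ext <;> simp

/-- A neighbour inside the triangle has a label adjacent to `y`, or else it is a far corner of a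
second triangle: a vertex of level `N` other than `p`, `q`, `r`, where a segment cannot go. -/
lemma exists_nb_of_tri (s : Bool) (y : Label) (hy : y ∈ active s) (d : Bool)
    (m n n' : Fin 3) (hn : n ≠ n')
    (h : c.off y = (2 : ℤ) • tri c.i c.j c.i' c.j' s d + corner m + corner n) :
    (∃ y' ∈ nb y, (2 : ℤ) • tri c.i c.j c.i' c.j' s d + corner m + corner n' = c.off y') ∨
    (m = n' ∧ ∀ y', isCorner y' = true →
      (2 : ℤ) • tri c.i c.j c.i' c.j' s d + corner m + corner n' ≠ c.off y') :=
  c.forall_config (p := fun i j i' j' => ∀ (s : Bool), ∀ y ∈ active s, ∀ (d : Bool)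
    (m n n' : Fin 3), n ≠ n' →
    pos i j i' j' y = (2 : ℤ) • tri i j i' j' s d + corner m + corner n →
    (∃ y' ∈ nb y, (2 : ℤ) • tri i j i' j' s d + corner m + corner n' = pos i j i' j' y') ∨
    (m = n' ∧ ∀ y', isCorner y' = true →
      (2 : ℤ) • tri i j i' j' s d + corner m + corner n' ≠ pos i j i' j' y'))
    (by decide +kernel) s y hy d m n n' hn h

lemma exists_tri_of_nb (s : Bool) (x y : Label) (hx : x ∈ active s) (hxy : y ∈ nb x)
    (hy : y ∈ active s ∨ isCorner y = true) :
    ∃ d m n n', n ≠ n' ∧ c.off x = (2 : ℤ) • tri c.i c.j c.i' c.j' s d + corner m + corner n ∧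
      c.off y = (2 : ℤ) • tri c.i c.j c.i' c.j' s d + corner m + corner n' :=
  c.forall_config (p := fun i j i' j' => ∀ (s : Bool), ∀ x y, x ∈ active s → y ∈ nb x →
    (y ∈ active s ∨ isCorner y = true) → ∃ d, ∃ m n n' : Fin 3, n ≠ n' ∧
    pos i j i' j' x = (2 : ℤ) • tri i j i' j' s d + corner m + corner n ∧
    pos i j i' j' y = (2 : ℤ) • tri i j i' j' s d + corner m + corner n')
    (by decide +kernel) s x y hx hxy hy

lemma even_off_iff (y : Label) : (∃ z, c.off y = (2 : ℤ) • z) ↔ isCorner y = true := by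
  have := c.forall_config (p := fun i j i' j' => ∀ y,
    ((pos i j i' j' y).1 % 2 = 0 ∧ (pos i j i' j' y).2 % 2 = 0) ↔ isCorner y = true)
    (by decide +kernel) y
  rw [← this]
  constructor
  · rintro ⟨z, hz⟩
    rw [← off, hz]
    simp
  · rintro ⟨h1, h2⟩
    refine ⟨((c.off y).1 / 2, (c.off y).2 / 2), ?_⟩
    rw [← off] at h1 h2
    ext <;> simp <;> omega

/-- All neighbours of a midpoint lie in one triangle of level `N`, and these triangles look alike.
At a corner the angle depends on the position of the second triangle, but turns there are not
counted. -/
lemma dotZ_off (x y z : Label) (hxy : y ∈ nb x) (hy : isCorner y = false) (hyz : z ∈ nb y) :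
    dotZ (c.off y - c.off x) (c.off z - c.off y) < 0 ↔
      dotZ (ref.off y - ref.off x) (ref.off z - ref.off y) < 0 :=
  c.forall_config (p := fun i j i' j' => ∀ x, ∀ y ∈ nb x, isCorner y = false → ∀ z ∈ nb y,
    (dotZ (pos i j i' j' y - pos i j i' j' x) (pos i j i' j' z - pos i j i' j' y) < 0 ↔
      dotZ (ref.off y - ref.off x) (ref.off z - ref.off y) < 0))
    (by decide +kernel) x y hxy hy z hyz

/-- `x` lies in the triangle of level `N + 1` which contains the edge `yz`. -/
def inTri (i j i' j' : Fin 3) (x y z : Label) : Prop :=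
  ∃ m, pos i j i' j' x = (min (pos i j i' j' y).1 (pos i j i' j' z).1,
    min (pos i j i' j' y).2 (pos i j i' j' z).2) + corner m

instance (i j i' j' : Fin 3) (x y z : Label) : Decidable (inTri i j i' j' x y z) := by
  unfold inTri; infer_instance

lemma inTri_iff (x y z : Label) (hyz : z ∈ nb y) :
    inTri c.i c.j c.i' c.j' x y z ↔ inTri 0 1 1 0 x y z :=
  c.forall_config (p := fun i j i' j' => ∀ x y, ∀ z ∈ nb y,
    (inTri i j i' j' x y z ↔ inTri 0 1 1 0 x y z)) (by decide +kernel) x y z hyz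

end Config

/-! ### Segments and their label sequences -/

/-- Paths of level `N + 1` between two successive hits `p`, `q` of `G_N`. -/
def Seg (N : ℕ) (p q : Pt) : Set Path :=
  {w | ∃ m, w = p :: (m ++ [q]) ∧ w.IsChain (fun a b => s(a, b) ∈ EV (N + 1)) ∧
    ∀ x ∈ m, x ∈ GV N → x = p}

/-- The label sequences of the elements of `Seg`. -/
def SegL (s : Bool) : Set (List Label) :=
  {l | ∃ m, l = startL s :: (m ++ [endL s]) ∧ l.IsChain (fun x y => y ∈ nb x) ∧
    ∀ x ∈ m, x ∈ active s}

/-- The number of sharp turns and backtracks of a label sequence. -/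
def revL : List Label → ℕ
  | x :: y :: z :: l =>
      (if dotZ (Config.ref.off y - Config.ref.off x) (Config.ref.off z - Config.ref.off y) < 0 ∧
        isCorner y = false then 1 else 0) + revL (y :: z :: l)
  | _ => 0

/-- The weight of a label sequence. -/
noncomputable def wtL (u x : ℝ) (l : List Label) : ℝ :=
  u ^ (revL l + l.tail.count (l.headD P)) * x ^ (l.length - 1 - 1)

/-- The steps of a label sequence. -/
def lpairs : List Label → List (Label × Label)
  | x :: y :: l => (x, y) :: lpairs (y :: l)
  | _ => []

/-- The relation on steps corresponding to `sameTriangle`. -/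
def sameL (a b : Label × Label) : Bool := decide (Config.inTri 0 1 1 0 a.1 b.1 b.2)

/-- The steps of the loop erasure of a label sequence. -/
def loopEraseL (l : List Label) : List (Label × Label) :=
  gErase Prod.fst Prod.snd (l.headD P) (lpairs l)

/-- The numbers of steps in the successive triangles of the loop erasure of a label sequence. -/
def shapeL (l : List Label) : List ℕ := ((loopEraseL l).splitBy sameL).map List.length

/-- The steps of the loop erasure of a path. -/
def loopErase (w : Path) : List Path := eraseLoops (psrc w) (pairs w)

/-- The numbers of steps in the successive triangles of level `N + 1` of the loop erasure of a
path. -/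
def shape (N : ℕ) (w : Path) : List ℕ :=
  ((loopErase w).splitBy (sameTriangle (N + 1))).map List.length

lemma active_or (s : Bool) {x y : Label} (h : x ∈ active s) (hxy : y ∈ nb x)
    (hy : isCorner y = false) : y ∈ active s := by
  have : ∀ s, ∀ x ∈ active s, ∀ y ∈ nb x, isCorner y = false → y ∈ active s := by decide
  exact this s x h y hxy hy

lemma isCorner_startL (s : Bool) : isCorner (startL s) = true := by cases s <;> rfl
lemma isCorner_endL (s : Bool) : isCorner (endL s) = true := by cases s <;> rfl
lemma startL_mem_active (s : Bool) : startL s ∈ active s := by cases s <;> decide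
lemma eq_startL_of_active {s : Bool} {y : Label} (h : y ∈ active s) (hy : isCorner y = true) :
    y = startL s := by
  have : ∀ s, ∀ y ∈ active s, isCorner y = true → y = startL s := by decide
  exact this s y h hy

namespace Config

variable (c : Config)

/-- The vertex with a given label, `p` being a lattice point of level `N`. -/
def emb (N : ℕ) (p : ℤ × ℤ) (l : Label) : Pt := lp (N + 1) ((2 : ℤ) • p + c.off l)

/-- The triangles at `p` (`false`) or `q` (`true`) are those described by the configuration. -/
structure IsAt (N : ℕ) (p : ℤ × ℤ) (s : Bool) : Prop where
  mem : ∀ d, p + tri c.i c.j c.i' c.j' s d ∈ cells base N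
  exists_eq : ∀ m, p + vert c.i c.j s - corner m ∈ cells base N →
    ∃ d, p + vert c.i c.j s - corner m = p + tri c.i c.j c.i' c.j' s d

variable {c} {N : ℕ} {p : ℤ × ℤ} {s : Bool}

lemma emb_injective : Function.Injective (c.emb N p) := by
  intro x y h
  exact c.off_injective (add_left_cancel (lp_injective _ h))

lemma emb_corner : c.emb N p P = lp N p ∧ c.emb N p Q = lp N (p - corner c.i + corner c.j) ∧
    c.emb N p R = lp N (p - corner c.i + corner (-(c.i + c.j))) := by
  refine ⟨?_, ?_, ?_⟩ <;> rw [← lp_succ, emb] <;> congr 1 <;>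
    simp only [off, pos, smul_add, smul_sub, two_smul] <;> abel

lemma emb_mem_GV_iff (h : p - corner c.i ∈ cells base N) (y : Label) :
    c.emb N p y ∈ GV N ↔ isCorner y = true := by
  constructor
  · intro hy
    obtain ⟨z, hz⟩ := lp_mem_GV_succ hy
    rw [← c.even_off_iff]
    refine ⟨z - p, ?_⟩
    rw [smul_sub, ← hz]
    abel
  · obtain ⟨h1, h2, h3⟩ := emb_corner (c := c) (N := N) (p := p)
    intro hy
    rw [mem_GV]
    refine ⟨_, h, ?_⟩
    cases y <;> simp [isCorner] at hy
    · exact ⟨c.i, by rw [h1]; congr 1; abel⟩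
    · exact ⟨c.j, h2⟩
    · exact ⟨_, h3⟩

lemma IsAt.mem_first (h : c.IsAt N p s) : p - corner c.i ∈ cells base N := by
  have := h.mem false
  cases s <;> rwa [tri, ← sub_eq_add_neg] at this

lemma exists_edge (N : ℕ) (p : ℤ × ℤ) {x y : Label} (hx : x ∈ active s) (hxy : y ∈ nb x)
    (hy : y ∈ active s ∨ isCorner y = true) :
    ∃ d m n n', n ≠ n' ∧
      c.emb N p x = lp (N + 1) ((2 : ℤ) • (p + tri c.i c.j c.i' c.j' s d) + corner m + corner n) ∧
      c.emb N p y = lp (N + 1) ((2 : ℤ) • (p + tri c.i c.j c.i' c.j' s d) + corner m + corner n')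
    := by
  obtain ⟨d, m, n, n', hn, h1, h2⟩ := c.exists_tri_of_nb s x y hx hxy hy
  refine ⟨d, m, n, n', hn, ?_, ?_⟩
  · rw [emb, h1, smul_add]; congr 1; abel
  · rw [emb, h2, smul_add]; congr 1; abel

lemma IsAt.edge_mem (h : c.IsAt N p s) {x y : Label} (hx : x ∈ active s) (hxy : y ∈ nb x)
    (hy : y ∈ active s ∨ isCorner y = true) : s(c.emb N p x, c.emb N p y) ∈ EV (N + 1) := by
  obtain ⟨d, m, n, n', hn, h1, h2⟩ := exists_edge (c := c) N p hx hxy hy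
  rw [mem_EV, h1, h2]
  exact ⟨_, ⟨_, h.mem d, m, rfl⟩, n, n', hn, rfl⟩

/-- The edge runs in some triangle of level `N`. If `y` is a midpoint this triangle is unique; if
`y` is the starting corner, `IsAt` leaves only the two triangles of the configuration. -/
lemma IsAt.neighbour (h : c.IsAt N p s) {y : Label} (hy : y ∈ active s) {x' : Pt}
    (hx : s(c.emb N p y, x') ∈ EV (N + 1)) :
    (∃ y' ∈ nb y, x' = c.emb N p y') ∨
      (x' ∈ GV N ∧ ∀ y', isCorner y' = true → x' ≠ c.emb N p y') := by
  obtain ⟨t, ⟨T, hT, m, rfl⟩, n, n', hn, h1, h2⟩ : ∃ t ∈ cells base (N + 1), ∃ n n', n ≠ n' ∧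
      c.emb N p y = lp (N + 1) (t + corner n) ∧ x' = lp (N + 1) (t + corner n') := by
    obtain ⟨t, ht, i, j, hij, he⟩ := mem_EV.1 hx
    rcases Sym2.eq_iff.1 he with ⟨h1, h2⟩ | ⟨h1, h2⟩
    · exact ⟨t, ht, i, j, hij, h1, h2⟩
    · exact ⟨t, ht, j, i, hij.symm, h1, h2⟩
  have h1 := lp_injective _ h1
  obtain ⟨d, rfl⟩ : ∃ d, T = p + tri c.i c.j c.i' c.j' s d := by
    by_cases hys : y = startL s
    · subst hys
      rw [off_startL, ← smul_add] at h1
      have h3 : (2 : ℤ) • T + corner m =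
          (2 : ℤ) • (p + vert c.i c.j s - corner n) + corner n := by
        rw [smul_sub, h1, two_smul ℤ (corner n)]
        abel
      obtain ⟨h4, rfl⟩ := two_smul_add_corner_inj h3
      rw [h4]
      exact h.exists_eq m (h4 ▸ hT)
    · have h3 : c.off y = (2 : ℤ) • (T - p) + corner m + corner n := by
        rw [smul_sub, sub_add_eq_add_sub, sub_add_eq_add_sub, ← h1]
        abel
      obtain ⟨d, hd⟩ := c.exists_tri_of_active s y hy hys m n h3
      exact ⟨d, by rw [← hd]; abel⟩
  have h3 : c.off y = (2 : ℤ) • tri c.i c.j c.i' c.j' s d + corner m + corner n := by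
    rw [smul_add, add_assoc, add_assoc] at h1
    rw [add_left_cancel h1, add_assoc]
  have h4 : (2 : ℤ) • (p + tri c.i c.j c.i' c.j' s d) + corner m + corner n' =
      (2 : ℤ) • p + ((2 : ℤ) • tri c.i c.j c.i' c.j' s d + corner m + corner n') := by
    rw [smul_add]; abel
  rcases c.exists_nb_of_tri s y hy d m n n' hn h3 with ⟨y', hy', h5⟩ | ⟨rfl, h5⟩
  · left
    refine ⟨y', hy', ?_⟩
    rw [h2, h4, h5, emb]
  · right
    refine ⟨?_, fun y' hy' he => h5 y' hy' ?_⟩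
    · rw [h2, add_assoc, ← two_smul ℤ (corner m), ← smul_add, lp_succ]
      exact mem_GV.2 ⟨_, hT, m, rfl⟩
    · rw [h2, h4] at he
      exact add_left_cancel (lp_injective _ he)

/-- A path cannot leave the two triangles at its starting point without hitting another vertex of
level `N`, so it can be labelled step by step. -/
lemma IsAt.exists_labels (h : c.IsAt N p s) {e : Label} (he : isCorner e = true)
    {y : Label} (hy : y ∈ active s) {m : Path}
    (hch : (c.emb N p y :: (m ++ [c.emb N p e])).IsChain fun a b => s(a, b) ∈ EV (N + 1))
    (hm : ∀ x ∈ m, x ∈ GV N → x = c.emb N p (startL s)) :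
    ∃ m', m = m'.map (c.emb N p) ∧ (y :: (m' ++ [e])).IsChain (fun x y => y ∈ nb x) ∧
      ∀ x ∈ m', x ∈ active s := by
  induction m generalizing y with
  | nil =>
    refine ⟨[], rfl, ?_, by simp⟩
    simp only [List.nil_append, List.isChain_cons_cons, List.isChain_singleton, and_true] at hch ⊢
    rcases h.neighbour hy hch with ⟨y', hy', h1⟩ | ⟨-, h1⟩
    · rwa [emb_injective h1]
    · exact absurd rfl (h1 e he)
  | cons a m ih =>
    rw [List.cons_append, List.isChain_cons_cons] at hch
    obtain ⟨y', hy', rfl⟩ : ∃ y' ∈ nb y, a = c.emb N p y' := by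
      rcases h.neighbour hy hch.1 with h1 | ⟨h1, h2⟩
      · exact h1
      · exact absurd (hm a (by simp) h1) (h2 _ (isCorner_startL s))
    have hact : y' ∈ active s := by
      by_cases hc : isCorner y' = true
      · have := hm _ (by simp) ((emb_mem_GV_iff h.mem_first y').2 hc)
        rw [emb_injective this]
        exact startL_mem_active s
      · exact active_or s hy hy' (by simpa using hc)
    obtain ⟨m', rfl, h1, h2⟩ := ih hact hch.2 fun x hx => hm x (by simp [hx])
    refine ⟨y' :: m', rfl, ?_, ?_⟩
    · rw [List.cons_append, List.isChain_cons_cons]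
      exact ⟨hy', h1⟩
    · intro x hx
      rcases List.mem_cons.1 hx with rfl | hx
      · exact hact
      · exact h2 x hx

lemma IsAt.isChain_map (h : c.IsAt N p s) {l : List Label} {e : Label} (he : isCorner e = true)
    (hl : (l ++ [e]).IsChain fun x y => y ∈ nb x) (ha : ∀ x ∈ l, x ∈ active s) :
    ((l ++ [e]).map (c.emb N p)).IsChain fun a b => s(a, b) ∈ EV (N + 1) := by
  induction l with
  | nil => simp
  | cons x l ih =>
    cases l with
    | nil =>
      simp only [List.cons_append, List.nil_append, List.isChain_cons_cons,
        List.isChain_singleton, and_true, List.map_cons, List.map_nil] at hl ⊢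
      exact h.edge_mem (ha x (by simp)) hl (Or.inr he)
    | cons y l =>
      simp only [List.cons_append, List.isChain_cons_cons, List.map_cons] at hl ⊢ ih
      exact ⟨h.edge_mem (ha x (by simp)) hl.1 (Or.inl (ha y (by simp))),
        ih hl.2 fun z hz => ha z (by simp [hz])⟩

/-- The right-hand label set does not mention `N`, `p` or the orientation: this is the
identification of segments with one another, and in particular with elements of `W_1`. -/
lemma IsAt.seg_eq (h : c.IsAt N p s) :
    Seg N (c.emb N p (startL s)) (c.emb N p (endL s)) = List.map (c.emb N p) '' SegL s := by
  ext w
  constructor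
  · rintro ⟨m, rfl, hch, hm⟩
    obtain ⟨m', rfl, h1, h2⟩ := h.exists_labels (isCorner_endL s) (startL_mem_active s) hch hm
    exact ⟨startL s :: (m' ++ [endL s]), ⟨m', rfl, h1, h2⟩, by simp⟩
  · rintro ⟨l, ⟨m, rfl, hch, hm⟩, rfl⟩
    refine ⟨m.map (c.emb N p), by simp, ?_, ?_⟩
    · rw [← List.cons_append] at hch ⊢
      refine h.isChain_map (isCorner_endL s) hch fun x hx => ?_
      rcases List.mem_cons.1 hx with rfl | hx
      · exact startL_mem_active s
      · exact hm x hx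
    · intro x hx hxG
      obtain ⟨y, hy, rfl⟩ := List.mem_map.1 hx
      rw [eq_startL_of_active (hm y hy) ((emb_mem_GV_iff h.mem_first y).1 hxG)]

lemma reversals_map (h : p - corner c.i ∈ cells base N) {l : List Label}
    (hl : l.IsChain fun x y => y ∈ nb x) :
    reversals (GV N) (l.map (c.emb N p)) = revL l := by
  induction l with
  | nil => rfl
  | cons x l ih =>
    match l, hl, ih with
    | [], _, _ => rfl
    | [y], _, _ => rfl
    | y :: z :: l, hl, ih =>
      rw [List.isChain_cons_cons] at hl
      have hyz := (List.isChain_cons_cons.1 hl.2).1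
      have := ih hl.2
      simp only [List.map_cons] at this ⊢
      rw [reversals, revL, this]
      congr 1
      refine if_congr ?_ rfl rfl
      rw [emb_mem_GV_iff h, Bool.not_eq_true]
      refine and_congr_left fun hy => ?_
      rw [emb, emb, emb, lp_sub, lp_sub, dotp_lp_neg, add_sub_add_left_eq_sub,
        add_sub_add_left_eq_sub, dotZ_off c x y z hl.1 hy hyz]

lemma segWeight_map (h : p - corner c.i ∈ cells base N) (u x : ℝ) {l : List Label}
    (hl : l.IsChain fun x y => y ∈ nb x) :
    segWeight u x N (l.map (c.emb N p)) = wtL u x l := by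
  rw [segWeight, wtL, reversals_map h hl, steps, List.length_map]
  congr 3
  cases l with
  | nil => rfl
  | cons y l =>
    simp only [List.map_cons, revisits, List.tail_cons, List.headD_cons]
    exact List.count_map_of_injective _ _ emb_injective _

lemma pairs_map (l : List Label) : pairs (l.map (c.emb N p)) =
    (lpairs l).map fun e => [c.emb N p e.1, c.emb N p e.2] := by
  induction l with
  | nil => rfl
  | cons x l ih =>
    cases l with
    | nil => rfl
    | cons y l => simpa [pairs, lpairs] using ih

end Config

lemma gErase_comp {α V W : Type*} [DecidableEq V] [DecidableEq W] {f : V → W}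
    (hf : Function.Injective f) (src tgt : α → V) (p : V) (l : List α) :
    gErase (f ∘ src) (f ∘ tgt) (f p) l = gErase src tgt p l := by
  induction l generalizing p with
  | nil => rfl
  | cons s l ih => simp [gErase, hf.eq_iff, ih]

lemma mem_lpairs {l : List Label} {r : Label → Label → Prop} (hl : l.IsChain r)
    {e : Label × Label} (he : e ∈ lpairs l) : r e.1 e.2 := by
  induction l with
  | nil => simp [lpairs] at he
  | cons x l ih =>
    cases l with
    | nil => simp [lpairs] at he
    | cons y l =>
      rw [List.isChain_cons_cons] at hl
      rw [lpairs, List.mem_cons] at he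
      rcases he with rfl | he
      · exact hl.1
      · exact ih hl.2 he

namespace Config

variable {c : Config} {N : ℕ} {p : ℤ × ℤ}

lemma loopErase_map {l : List Label} (hl : l ≠ []) : loopErase (l.map (c.emb N p)) =
    (loopEraseL l).map fun e => [c.emb N p e.1, c.emb N p e.2] := by
  obtain ⟨x, l, rfl⟩ := List.exists_cons_of_ne_nil hl
  rw [loopErase, eraseLoops_eq _ _ fun s hs => ?_, pairs_map,
    gErase_map (f := fun e : Label × Label => [c.emb N p e.1, c.emb N p e.2])
      (src := c.emb N p ∘ Prod.fst) (tgt := c.emb N p ∘ Prod.snd) (fun _ _ => rfl)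
    (fun _ _ => rfl)]
  · exact congrArg _ (gErase_comp emb_injective _ _ _ _)
  · rintro rfl
    have := mem_pairs_length hs
    simp at this

lemma sameTriangle_emb {x y z : Label} (hyz : z ∈ nb y)
    (he : s(c.emb N p y, c.emb N p z) ∈ EV (N + 1)) :
    InTriangle (N + 1) (c.emb N p x) (c.emb N p y) (c.emb N p z) ↔ inTri 0 1 1 0 x y z := by
  obtain ⟨t, ht, n, n', hn, h1, h2⟩ : ∃ t ∈ cells base (N + 1), ∃ n n', n ≠ n' ∧
      c.emb N p y = lp (N + 1) (t + corner n) ∧ c.emb N p z = lp (N + 1) (t + corner n') := by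
    obtain ⟨t, ht, i, j, hij, he⟩ := mem_EV.1 he
    rcases Sym2.eq_iff.1 he with ⟨h1, h2⟩ | ⟨h1, h2⟩
    · exact ⟨t, ht, i, j, hij, h1, h2⟩
    · exact ⟨t, ht, j, i, hij.symm, h1, h2⟩
  rw [h1, h2, emb, inTriangle_iff ht hn, ← inTri_iff c x y z hyz, inTri]
  have h1 := lp_injective _ h1
  have h2 := lp_injective _ h2
  have h3 := min_corners (t := t) hn
  rw [← h1, ← h2] at h3
  refine exists_congr fun m => ?_
  conv_lhs => rw [h3]
  rw [← off, ← off, ← off]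
  simp only [Prod.ext_iff, Prod.fst_add, Prod.snd_add, min_add_add_left]
  constructor <;> rintro ⟨h4, h5⟩ <;> constructor <;> omega

lemma shape_map {l : List Label} (hl : l.IsChain fun x y => y ∈ nb x)
    (he : (l.map (c.emb N p)).IsChain fun a b => s(a, b) ∈ EV (N + 1)) (hne : l ≠ []) :
    (loopErase (l.map (c.emb N p))).splitBy (sameTriangle (N + 1)) =
      ((loopEraseL l).splitBy sameL).map
        (List.map fun e => [c.emb N p e.1, c.emb N p e.2]) := by
  rw [loopErase_map hne]
  refine splitBy_map fun a _ b hb => ?_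
  have hb := (gErase_sublist _ _).subset hb
  rw [List.isChain_map] at he
  rw [sameTriangle, sameL]
  exact decide_eq_decide.2 (sameTriangle_emb (mem_lpairs hl hb)
    (mem_lpairs (r := fun a b => s(c.emb N p a, c.emb N p b) ∈ EV (N + 1)) he hb))

end Config

/-! ### Loop erasure of label sequences -/

section Walks

variable {α V : Type*} {src tgt : α → V}

lemma IsWalk.exists_cons {c e : V} {l : List α} (h : IsWalk src tgt c l e) :
    ∃ t, l.map src ++ [e] = c :: t := by
  cases l with
  | nil => exact ⟨[], by rw [show c = e from h]; rfl⟩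
  | cons s l => exact ⟨l.map src ++ [e], by rw [← h.1]; rfl⟩

/-- The first step kept is the last departure from `p`; this locates the walk after it. -/
lemma gErase_cons_split [DecidableEq V] {p : V} {l : List α} {s : α} {r : List α}
    (h : gErase src tgt p l = s :: r) :
    ∃ l₁ l₂, l = l₁ ++ s :: l₂ ∧ src s = p ∧ ∀ t ∈ l₂, src t ≠ p := by
  induction l with
  | nil => simp [gErase] at h
  | cons a l ih =>
    rw [gErase] at h
    split_ifs at h with hif
    · obtain ⟨rfl, -⟩ := List.cons.inj h
      exact ⟨[], l, rfl, hif.1, hif.2⟩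
    · obtain ⟨l₁, l₂, rfl, h1, h2⟩ := ih h
      exact ⟨a :: l₁, l₂, rfl, h1, h2⟩

lemma infix_of_mem_flatten {L : List (List α)} {g : List α} (h : g ∈ L) : g <:+: L.flatten := by
  obtain ⟨s, t, rfl⟩ := List.append_of_mem h
  exact ⟨s.flatten, t.flatten, by simp⟩

end Walks

lemma lpairs_map_fst (l : List Label) (e : Label) : (lpairs (l ++ [e])).map Prod.fst = l := by
  induction l with
  | nil => rfl
  | cons x l ih =>
    cases l with
    | nil => rfl
    | cons y l => simpa [lpairs] using ih

lemma lpairs_walk (x e : Label) (m : List Label) :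
    IsWalk Prod.fst Prod.snd x (lpairs (x :: (m ++ [e]))) e := by
  induction m generalizing x with
  | nil => exact ⟨rfl, rfl⟩
  | cons y m ih => exact ⟨rfl, ih y⟩

/-- The label sequences of paths from `p` to `q`, or from `p` via `q` to `r`. -/
structure IsRoute (l m : List Label) (e : Label) : Prop where
  eq : l = P :: (m ++ [e])
  chain : l.IsChain fun x y => y ∈ nb x
  last : (e = Q ∧ ∀ x ∈ m, x ∈ active false) ∨ (e = R ∧ ∀ x ∈ m, x ≠ R)

namespace IsRoute

variable {l m : List Label} {e : Label}

lemma lpairs_fst (h : IsRoute l m e) : (lpairs l).map Prod.fst = P :: m := by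
  rw [h.eq, ← List.cons_append, lpairs_map_fst]

lemma end_notMem (h : IsRoute l m e) : e ∉ P :: m := by
  rcases h.last with ⟨rfl, h1⟩ | ⟨rfl, h1⟩ <;> intro h2
  · rcases List.mem_cons.1 h2 with h2 | h2
    · exact absurd h2 (by decide)
    · exact absurd (h1 _ h2) (by decide)
  · rcases List.mem_cons.1 h2 with h2 | h2
    · exact absurd h2 (by decide)
    · exact h1 _ h2 rfl

lemma headD_eq (h : IsRoute l m e) : l.headD P = P := by rw [h.eq]; rfl

lemma walk (h : IsRoute l m e) : IsWalk Prod.fst Prod.snd P (loopEraseL l) e ∧ loopEraseL l ≠ [] := by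
  have h1 := lpairs_walk P e m
  rw [← h.eq] at h1
  rw [loopEraseL, h.headD_eq]
  refine gErase_walk h1 ?_
  intro h0
  have := h.lpairs_fst
  rw [h0] at this
  simp at this

lemma sublist (l : List Label) : (loopEraseL l).Sublist (lpairs l) := gErase_sublist _ _

lemma nb_of_mem (h : IsRoute l m e) {s : Label × Label} (hs : s ∈ loopEraseL l) : s.2 ∈ nb s.1 :=
  mem_lpairs h.chain ((sublist l).subset hs)

lemma nodup (h : IsRoute l m e) : ((loopEraseL l).map Prod.fst ++ [e]).Nodup := by
  rw [List.nodup_append]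
  refine ⟨gErase_nodup _ _, by simp, ?_⟩
  intro a ha b hb hab
  rw [List.mem_singleton] at hb
  have := ((sublist l).map Prod.fst).subset ha
  rw [h.lpairs_fst, hab, hb] at this
  exact h.end_notMem this

/-- A loop-erased path passes through a triangle in at most two steps. -/
lemma group_eq (h : IsRoute l m e) {G : List (Label × Label)} (hG : G ∈ (loopEraseL l).splitBy sameL) :
    (∃ x y, G = [(x, y)]) ∨ ∃ x y z, G = [(x, y), (y, z)] ∧ x ≠ z := by
  have hinf : G <:+: loopEraseL l := by
    have := infix_of_mem_flatten hG
    rwa [List.flatten_splitBy] at this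
  have hnb : ∀ s ∈ G, s.2 ∈ nb s.1 := fun s hs => h.nb_of_mem (hinf.subset hs)
  obtain ⟨A, B, hAB⟩ := hinf
  have hw := h.walk.1
  have hnd := h.nodup
  rw [← hAB] at hw hnd
  obtain ⟨b, hw1, hB⟩ := isWalk_append.1 hw
  obtain ⟨a, -, hGw⟩ := isWalk_append.1 hw1
  obtain ⟨t, ht⟩ := hB.exists_cons
  have hch := List.isChain_of_mem_splitBy hG
  have hne := List.ne_nil_of_mem_splitBy hG
  rw [List.map_append, List.map_append, List.append_assoc, ht] at hnd
  match G, hne, hGw, hch, hnb, hnd with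
  | [(x, y)], _, _, _, _, _ => exact Or.inl ⟨x, y, rfl⟩
  | [(x, y), (y', z)], _, hGw, _, _, hnd =>
    obtain ⟨rfl, rfl, hz⟩ := hGw
    obtain rfl : z = b := hz
    refine Or.inr ⟨x, y', z, rfl, ?_⟩
    rintro rfl
    simp [List.nodup_append] at hnd
  | (x₁, x₂) :: (x₂', x₃) :: (x₃', x₄) :: rest, _, hGw, hch, hnb, hnd =>
    exfalso
    obtain ⟨rfl, rfl, rfl, hrest⟩ := hGw
    obtain ⟨t', ht'⟩ := IsWalk.exists_cons hrest
    have e1 : (List.map Prod.fst ((x₁, x₂') :: (x₂', x₃') :: (x₃', x₄) :: rest)) ++ b :: t =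
        x₁ :: x₂' :: x₃' :: (x₄ :: (t' ++ t)) := by
      have : List.map Prod.fst rest ++ b :: t = x₄ :: (t' ++ t) := by
        rw [List.append_cons, ht']; rfl
      simp [this]
    rw [List.append_assoc, e1] at hnd
    rw [List.isChain_cons_cons, List.isChain_cons_cons] at hch
    have h1 := of_decide_eq_true hch.1
    have h2 := of_decide_eq_true hch.2.1
    -- Three steps along the sides of one triangle, without backtracking, return to their starting
    -- point, which a loop-erased path does not do.
    have key : ∀ x₁, ∀ x₂ ∈ nb x₁, ∀ x₃ ∈ nb x₂, ∀ x₄ ∈ nb x₃,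
        (Config.inTri 0 1 1 0 x₁ x₂ x₃ ∧ Config.inTri 0 1 1 0 x₂ x₃ x₄ ∧ x₁ ≠ x₃ ∧ x₂ ≠ x₄) →
        x₁ = x₄ := by decide +kernel
    have hnd := (List.nodup_append.1 hnd).2.1
    simp only [List.nodup_cons, List.mem_cons, not_or] at hnd
    exact hnd.1.2.2.1 (key x₁ x₂' (hnb (x₁, x₂') (by simp)) x₃' (hnb (x₂', x₃') (by simp)) x₄
      (hnb (x₃', x₄) (by simp)) ⟨h1, h2, hnd.1.2.1, hnd.2.1.2.1⟩)

/-- The kept steps start at different labels, of which there are twelve. Only finiteness matters: it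
makes the generating functions polynomials. -/
lemma length_shapeL_le (l : List Label) : (shapeL l).length ≤ 12 := by
  have h1 : ((loopEraseL l).splitBy sameL).length ≤ (loopEraseL l).length := by
    conv_rhs => rw [← List.flatten_splitBy sameL (loopEraseL l)]
    rw [List.length_flatten]
    refine le_trans (le_of_eq ?_) (List.length_le_sum_of_one_le _ ?_)
    · simp
    · intro i hi
      obtain ⟨G, hG, rfl⟩ := List.mem_map.1 hi
      exact List.length_pos_iff.2 (List.ne_nil_of_mem_splitBy hG)
  have h2 : (loopEraseL l).length ≤ 12 := by
    have := (gErase_nodup (src := Prod.fst) (tgt := Prod.snd) (l.headD P)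
      (lpairs l)).length_le_card
    rw [List.length_map] at this
    exact this.trans (by decide)
  rw [shapeL, List.length_map]
  exact h1.trans h2

lemma mem_shapeL (h : IsRoute l m e) {n : ℕ} (hn : n ∈ shapeL l) : n = 1 ∨ n = 2 := by
  obtain ⟨G, hG, rfl⟩ := List.mem_map.1 hn
  rcases h.group_eq hG with ⟨x, y, rfl⟩ | ⟨x, y, z, rfl, -⟩
  · exact Or.inl rfl
  · exact Or.inr rfl

/-- Two corners of a triangle are not adjacent at the next level and have no common triangle of half
the size. This is the source of the factor 2 in ν. -/
lemma two_le_length_shapeL (h : IsRoute l m e) : 2 ≤ (shapeL l).length := by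
  rw [shapeL, List.length_map]
  by_contra hlt
  have hne : (loopEraseL l).splitBy sameL ≠ [] := List.splitBy_ne_nil.2 h.walk.2
  obtain ⟨G, hG⟩ : ∃ G, (loopEraseL l).splitBy sameL = [G] := by
    rw [← List.length_eq_one_iff]
    have := List.length_pos_iff.2 hne
    omega
  have hfl := List.flatten_splitBy sameL (loopEraseL l)
  rw [hG, List.flatten_singleton] at hfl
  have hmem : G ∈ (loopEraseL l).splitBy sameL := by rw [hG]; simp
  have hch := List.isChain_of_mem_splitBy hmem
  have hw := h.walk.1
  have hnb := fun s hs => h.nb_of_mem (s := s) hs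
  rw [← hfl] at hw hnb
  have he : e = Q ∨ e = R := h.last.imp And.left And.left
  have key : ∀ e, (e = Q ∨ e = R) → e ∉ nb P ∧
    ∀ y ∈ nb P, e ∈ nb y → ¬ Config.inTri 0 1 1 0 P y e := by decide +kernel
  rcases h.group_eq hmem with ⟨x, y, rfl⟩ | ⟨x, y, z, rfl, -⟩
  · obtain ⟨rfl, rfl⟩ := hw
    exact (key _ he).1 (hnb _ (by simp))
  · obtain ⟨rfl, -, rfl⟩ := hw
    refine (key _ he).2 y (hnb (_, y) (by simp)) (hnb (y, _) (by simp)) ?_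
    rw [List.isChain_cons_cons] at hch
    exact of_decide_eq_true hch.1

/-- The first step of the loop erasure leads into the triangle `pqr`. -/
lemma first_step (h : IsRoute l m e) {s : Label × Label} {r : List (Label × Label)} (hs : loopEraseL l = s :: r) :
    s = (P, PQ) ∨ s = (P, PR) := by
  have hnb := h.nb_of_mem (s := s) (by rw [hs]; simp)
  rw [loopEraseL, h.headD_eq] at hs
  obtain ⟨l₁, l₂, h1, h2, h3⟩ := gErase_cons_split hs
  have hw := lpairs_walk P e m
  rw [← h.eq, h1, isWalk_append] at hw
  obtain ⟨c, -, -, hw⟩ := hw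
  have hnb2 : ∀ t ∈ l₂, t.2 ∈ nb t.1 := fun t ht =>
    mem_lpairs h.chain (by rw [h1]; simp [ht])
  -- After the last departure from `p`, the second triangle at `p` would be a trap: its only
  -- labelled exit is `p` itself.
  have key : ∀ (l₂ : List (Label × Label)) y, IsWalk Prod.fst Prod.snd y l₂ e →
      (∀ t ∈ l₂, t.2 ∈ nb t.1) → (∀ t ∈ l₂, t.1 ≠ P) → y ∈ [P, PP1, PP2, P12] →
      e ∈ [P, PP1, PP2, P12] := by
    intro l₂
    induction l₂ with
    | nil => rintro y (rfl : y = e) _ _ hy; exact hy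
    | cons t l₂ ih =>
      rintro y ⟨rfl, hw⟩ k1 k2 hy
      refine ih t.2 hw (fun t' ht => k1 t' (by simp [ht])) (fun t' ht => k2 t' (by simp [ht])) ?_
      have k3 := k1 t (by simp)
      have k4 := k2 t (by simp)
      have : ∀ x y, x ∈ [P, PP1, PP2, P12] → x ≠ P → y ∈ nb x → y ∈ [P, PP1, PP2, P12] := by
        decide
      exact this _ _ hy k4 k3
  have he : e = Q ∨ e = R := h.last.imp And.left And.left
  obtain ⟨x, y⟩ := s
  obtain rfl : x = P := h2
  have k1 : y ∉ [P, PP1, PP2, P12] := by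
    intro hy
    have := key l₂ y hw hnb2 h3 hy
    rcases he with rfl | rfl <;> exact absurd this (by decide)
  have k2 : ∀ y ∈ nb P, y ∉ [P, PP1, PP2, P12] → (P, y) = (P, PQ) ∨ (P, y) = (P, PR) := by
    decide
  exact k2 y hnb k1

/-- The last step of the loop erasure comes from the triangle `pqr`. -/
lemma last_step (h : IsRoute l m e) {s : Label × Label} {r : List (Label × Label)} (hs : loopEraseL l = r ++ [s]) :
    s.2 = e ∧ ((s.1 = QR) ∨ (s.1 = PQ ∧ e = Q) ∨ (s.1 = PR ∧ e = R)) := by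
  have hmem : s ∈ loopEraseL l := by rw [hs]; simp
  have hnb := h.nb_of_mem hmem
  have hw := h.walk.1
  rw [hs] at hw
  obtain ⟨c, -, rfl, hw⟩ := isWalk_append.1 hw
  have hw : s.2 = e := hw
  refine ⟨hw, ?_⟩
  have h1 : s.1 ∈ P :: m := by
    rw [← h.lpairs_fst]
    exact List.mem_map.2 ⟨s, (sublist l).subset hmem, rfl⟩
  rw [hw] at hnb
  rcases h.last with ⟨rfl, h2⟩ | ⟨rfl, -⟩
  · have h3 : s.1 ∈ active false := by
      rcases List.mem_cons.1 h1 with h1 | h1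
      · rw [h1]; decide
      · exact h2 _ h1
    -- A path stopped at `q` has never been in the second triangle at `q`, so it arrives from a
    -- midpoint of a side of `pqr`.
    have : ∀ x ∈ active false, Q ∈ nb x → x = QR ∨ (x = PQ ∧ Q = Q) ∨ (x = PR ∧ Q = R) := by
      decide
    exact this _ h3 hnb
  · have : ∀ x, R ∈ nb x → x = QR ∨ (x = PQ ∧ R = Q) ∨ (x = PR ∧ R = R) := by decide
    exact this _ hnb

end IsRoute

lemma isRoute_of_mem {l : List Label} (h : l ∈ SegL false) : ∃ m, IsRoute l m Q := by
  obtain ⟨m, h1, h2, h3⟩ := h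
  exact ⟨m, h1, h2, Or.inl ⟨rfl, h3⟩⟩

lemma isRoute_append {l₁ l₂ : List Label} (h₁ : l₁ ∈ SegL false) (h₂ : l₂ ∈ SegL true) :
    ∃ m, IsRoute (l₁.dropLast ++ l₂) m R := by
  obtain ⟨m₁, rfl, h2, h3⟩ := h₁
  obtain ⟨m₂, rfl, h5, h6⟩ := h₂
  have e : (startL false :: (m₁ ++ [endL false])).dropLast ++ startL true :: (m₂ ++ [endL true]) =
      P :: ((m₁ ++ Q :: m₂) ++ [R]) := by
    rw [← List.cons_append, List.dropLast_concat]
    simp [startL, endL]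
  refine ⟨m₁ ++ Q :: m₂, e, ?_, Or.inr ⟨rfl, ?_⟩⟩
  · rw [← List.cons_append, List.dropLast_concat]
    rw [← List.cons_append] at h2
    rw [List.isChain_append] at h2 ⊢
    refine ⟨h2.1, h5, ?_⟩
    intro x hx y hy
    refine h2.2.2 x hx y ?_
    simpa [startL, endL] using hy
  · have k1 : ∀ x ∈ active false, x ≠ R := by decide
    have k2 : ∀ x ∈ active true, x ≠ R := by decide
    intro x hx
    rcases List.mem_append.1 hx with hx | hx
    · exact k1 x (h3 x hx)
    · rcases List.mem_cons.1 hx with rfl | hx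
      · decide
      · exact k2 x (h6 x hx)

/-! ### Configurations -/

lemma exists_other {i k : Fin 3} (h : i ≠ k) : ∃ i', i ≠ i' ∧ ∀ m, m ≠ k ↔ m = i ∨ m = i' := by
  revert i k; decide

lemma IsInner.exists_role {N : ℕ} {t : ℤ × ℤ} {i : Fin 3} (h : IsInner N (t + corner i))
    (ht : t ∈ cells base N) :
    ∃ i', i ≠ i' ∧ ∀ m, t + corner i - corner m ∈ cells base N ↔ m = i ∨ m = i' := by
  obtain ⟨k, hk⟩ := h
  have hik : i ≠ k := (hk i).1 (by simpa using ht)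
  obtain ⟨i', h1, h2⟩ := exists_other hik
  exact ⟨i', h1, fun m => (hk m).trans (h2 m)⟩

lemma exists_config₁ {N : ℕ} {t : ℤ × ℤ} (ht : t ∈ cells base N) {i j : Fin 3} (hij : i ≠ j)
    (hi : IsInner N (t + corner i)) :
    ∃ (c : Config) (p : ℤ × ℤ), c.IsAt N p false ∧ c.emb N p P = lp N (t + corner i) ∧
      c.emb N p Q = lp N (t + corner j) := by
  obtain ⟨i', hi', h⟩ := hi.exists_role ht
  -- Paths stopped at `q` do not enter the second triangle there; any `j'` different from `j` will
  -- do.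
  refine ⟨⟨i, j, i', j + 1, hij, hi', by
    have : ∀ j : Fin 3, j ≠ j + 1 := by decide
    exact this j⟩, t + corner i, ⟨?_, ?_⟩, ?_, ?_⟩
  · rintro (_ | _)
    · simpa [Config.tri] using ht
    · have := (h i').2 (Or.inr rfl)
      rwa [sub_eq_add_neg] at this
  · intro m hm
    simp only [Config.vert, add_zero] at hm ⊢
    rcases (h m).1 hm with rfl | rfl
    · exact ⟨false, by rw [sub_eq_add_neg]; rfl⟩
    · exact ⟨true, by rw [sub_eq_add_neg]; rfl⟩
  · exact Config.emb_corner.1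
  · rw [Config.emb_corner.2.1]
    congr 1
    simp

lemma exists_config₂ {N : ℕ} {t : ℤ × ℤ} (ht : t ∈ cells base N) {i j k : Fin 3} (hij : i ≠ j)
    (hik : i ≠ k) (hjk : j ≠ k)
    (hi : IsInner N (t + corner i)) (hj : IsInner N (t + corner j)) :
    ∃ (c : Config) (p : ℤ × ℤ), c.IsAt N p false ∧ c.IsAt N p true ∧
      c.emb N p P = lp N (t + corner i) ∧ c.emb N p Q = lp N (t + corner j) ∧
      c.emb N p R = lp N (t + corner k) := by
  obtain ⟨i', hi', h⟩ := hi.exists_role ht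
  obtain ⟨j', hj', h'⟩ := hj.exists_role ht
  have hk : k = -(i + j) := by
    have : ∀ i j k : Fin 3, i ≠ j → i ≠ k → j ≠ k → k = -(i + j) := by decide
    exact this i j k hij hik hjk
  refine ⟨⟨i, j, i', j', hij, hi', hj'⟩, t + corner i, ⟨?_, ?_⟩, ⟨?_, ?_⟩, ?_, ?_, ?_⟩
  · rintro (_ | _)
    · simpa [Config.tri] using ht
    · have := (h i').2 (Or.inr rfl)
      rwa [sub_eq_add_neg] at this
  · intro m hm
    simp only [Config.vert, add_zero] at hm ⊢
    rcases (h m).1 hm with rfl | rfl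
    · exact ⟨false, by rw [sub_eq_add_neg]; rfl⟩
    · exact ⟨true, by rw [sub_eq_add_neg]; rfl⟩
  · rintro (_ | _)
    · simpa [Config.tri] using ht
    · have := (h' j').2 (Or.inr rfl)
      have e : t + corner i + (corner j - corner i - corner j') = t + corner j - corner j' := by
        abel
      simp only [Config.tri]
      rwa [e]
  · intro m hm
    simp only [Config.vert] at hm ⊢
    have e : ∀ m, t + corner i + (corner j - corner i) - corner m = t + corner j - corner m := by
      intro m; abel
    rw [e] at hm
    rw [e]
    rcases (h' m).1 hm with rfl | rfl
    · exact ⟨false, by simp [Config.tri]⟩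
    · refine ⟨true, ?_⟩
      simp only [Config.tri]
      abel
  · exact Config.emb_corner.1
  · rw [Config.emb_corner.2.1]
    congr 1
    simp
  · rw [Config.emb_corner.2.2, hk]
    congr 1
    simp

/-! ### Chains -/

lemma isChain_joinPath {r : Pt → Pt → Prop} {p q : Pt} {S : List Path}
    (hS : IsWalk psrc ptgt p S q) (h2 : ∀ s ∈ S, 2 ≤ s.length) :
    (p :: S.flatMap List.tail).IsChain r ↔ ∀ s ∈ S, s.IsChain r := by
  induction S generalizing p with
  | nil => simp
  | cons s S ih =>
    have hs := h2 s (by simp)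
    have hne : s ≠ [] := by rintro rfl; simp at hs
    have e : p :: (s :: S).flatMap List.tail = s.dropLast ++ ptgt s :: S.flatMap List.tail := by
      rw [← hS.1, List.flatMap_cons, ← List.cons_append, ← eq_psrc_cons hne]
      conv_lhs => rw [eq_dropLast_ptgt hne]
      simp
    rw [e, List.isChain_split, ← eq_dropLast_ptgt hne, ih hS.2 fun t ht => h2 t (by simp [ht])]
    simp

lemma edge_ne {N : ℕ} {p q : Pt} (h : s(p, q) ∈ EV N) : p ∈ GV N ∧ q ∈ GV N ∧ p ≠ q := by
  obtain ⟨t, ht, i, j, hij, he⟩ := mem_EV.1 h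
  rcases Sym2.eq_iff.1 he with ⟨rfl, rfl⟩ | ⟨rfl, rfl⟩
  · refine ⟨mem_GV.2 ⟨t, ht, i, rfl⟩, mem_GV.2 ⟨t, ht, j, rfl⟩, fun h => hij ?_⟩
    exact corner_injective (add_left_cancel (lp_injective _ h))
  · refine ⟨mem_GV.2 ⟨t, ht, j, rfl⟩, mem_GV.2 ⟨t, ht, i, rfl⟩, fun h => hij ?_⟩
    exact (corner_injective (add_left_cancel (lp_injective _ h))).symm

lemma exists_edge_cell {N : ℕ} {p q : Pt} (h : s(p, q) ∈ EV N) : ∃ t ∈ cells base N, ∃ i j,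
    i ≠ j ∧ p = lp N (t + corner i) ∧ q = lp N (t + corner j) := by
  obtain ⟨t, ht, i, j, hij, he⟩ := mem_EV.1 h
  rcases Sym2.eq_iff.1 he with ⟨h1, h2⟩ | ⟨h1, h2⟩
  · exact ⟨t, ht, i, j, hij, h1, h2⟩
  · exact ⟨t, ht, j, i, hij.symm, h1, h2⟩

lemma mem_pairs {w : Path} {r : Pt → Pt → Prop} (hw : w.IsChain r) {s : Path}
    (hs : s ∈ pairs w) : r (psrc s) (ptgt s) ∧ psrc s ∈ w.dropLast ∧ s = [psrc s, ptgt s] := by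
  induction w with
  | nil => simp [pairs] at hs
  | cons p w ih =>
    cases w with
    | nil => simp [pairs] at hs
    | cons q w =>
      rw [List.isChain_cons_cons] at hw
      rw [pairs, List.mem_cons] at hs
      rcases hs with rfl | hs
      · exact ⟨hw.1, by simp, rfl⟩
      · obtain ⟨h1, h2, h3⟩ := ih hw.2 hs
        exact ⟨h1, by simpa using Or.inr h2, h3⟩

lemma blocks_eq_pairs {N : ℕ} {w : Path} (hw : w.IsChain fun a b => s(a, b) ∈ EV N)
    (h2 : 2 ≤ w.length) : blocks (GV N) w = pairs w := by
  have hne : w ≠ [] := by rintro rfl; simp at h2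
  obtain ⟨p, l, rfl⟩ := List.exists_cons_of_ne_nil hne
  have h := pairs_walk p l
  conv_lhs => rw [← joinPath_pairs h2]
  rw [blocks_joinPath h fun s hs => isSegment_of_length (mem_pairs_length hs) _,
    gBlocks_singletons h, List.map_map]
  · exact (List.map_congr_left fun s _ => rfl).trans (List.map_id _)
  · intro s hs
    have := edge_ne (mem_pairs hw hs).1
    exact ⟨this.2.1, this.2.2.symm⟩

lemma eraseAt_eq {N : ℕ} {w : Path} (hw : w.IsChain fun a b => s(a, b) ∈ EV N)
    (h2 : 2 ≤ w.length) : eraseAt N w = joinPath (loopErase w) := by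
  rw [eraseAt, blocks_eq_pairs hw h2]
  rfl

/-- Unlike a corner, the midpoint of a side belongs to a single triangle; parity shows that the
right-hand side is a midpoint too. -/
lemma mid_inj {T T' : ℤ × ℤ} {m n m' n' : Fin 3} (hmn : m ≠ n)
    (h : (2 : ℤ) • T + corner m + corner n = (2 : ℤ) • T' + corner m' + corner n') : T = T' := by
  have h1 := congrArg Prod.fst h
  have h2 := congrArg Prod.snd h
  clear h
  fin_cases m <;> fin_cases n <;> (first | exact absurd rfl hmn | skip) <;>
    fin_cases m' <;> fin_cases n' <;> simp [corner] at h1 h2 <;>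
    first
    | (exfalso; omega)
    | exact Prod.ext (by omega) (by omega)

/-! ### Groups of segments in one triangle -/

/-- The segments in `g` run along the triangle of a configuration. -/
structure IsGroup (N : ℕ) (g : List Path) (c : Config) (p : ℤ × ℤ) (l m : List Label)
    (e : Label) : Prop where
  route : IsRoute l m e
  join : joinPath g = l.map (c.emb N p)
  chain : (l.map (c.emb N p)).IsChain fun a b => s(a, b) ∈ EV (N + 1)
  mem : p - corner c.i ∈ cells base N
  src_eq : gsrc psrc g = c.emb N p P
  tgt_eq : gtgt ptgt g = c.emb N p e
  ends : ∀ s ∈ g, ∃ x y, isCorner x = true ∧ isCorner y = true ∧ x ≠ y ∧ psrc s = c.emb N p x ∧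
    ptgt s = c.emb N p y

namespace IsGroup

variable {N : ℕ} {g : List Path} {c : Config} {p : ℤ × ℤ} {l m : List Label} {e : Label}

lemma l_ne_nil (h : IsGroup N g c p l m e) : l ≠ [] := by rw [h.route.eq]; simp

lemma loopErase_eq (h : IsGroup N g c p l m e) : loopErase (joinPath g) =
    (loopEraseL l).map fun e => [c.emb N p e.1, c.emb N p e.2] := by
  rw [h.join, Config.loopErase_map h.l_ne_nil]

lemma splitBy_eq (h : IsGroup N g c p l m e) :
    (loopErase (joinPath g)).splitBy (sameTriangle (N + 1)) =
      ((loopEraseL l).splitBy sameL).map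
        (List.map fun e => [c.emb N p e.1, c.emb N p e.2]) := by
  rw [h.join, Config.shape_map h.route.chain h.chain h.l_ne_nil]

lemma shape_eq (h : IsGroup N g c p l m e) : shape N (joinPath g) = shapeL l := by
  rw [shape, h.splitBy_eq, shapeL, List.map_map]
  exact List.map_congr_left fun G _ => by simp

lemma two_le_length (h : IsGroup N g c p l m e) : 2 ≤ (joinPath g).length := by
  rw [h.join, h.route.eq]
  simp

lemma walk (h : IsGroup N g c p l m e) :
    IsWalk psrc ptgt (gsrc psrc g) (loopErase (joinPath g)) (gtgt ptgt g) ∧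
      loopErase (joinPath g) ≠ [] := by
  obtain ⟨h1, h2⟩ := h.route.walk
  rw [h.loopErase_eq, h.src_eq, h.tgt_eq]
  refine ⟨?_, by simpa using h2⟩
  generalize loopEraseL l = L at h1
  clear h2
  revert h1
  generalize P = x
  intro h1
  induction L generalizing x with
  | nil => exact congrArg (c.emb N p) h1
  | cons a L ih => exact ⟨congrArg (c.emb N p) h1.1, ih _ h1.2⟩

lemma sublist (h : IsGroup N g c p l m e) :
    (loopErase (joinPath g)).Sublist (pairs (joinPath g)) := by
  rw [loopErase, eraseLoops_eq]
  · exact gErase_sublist _ _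
  · rintro s hs rfl
    have := mem_pairs_length hs
    simp at this

lemma mem_pairs (h : IsGroup N g c p l m e) {s : Path} (hs : s ∈ loopErase (joinPath g)) :
    s(psrc s, ptgt s) ∈ EV (N + 1) ∧ s = [psrc s, ptgt s] ∧
      psrc s ∈ (joinPath g).dropLast := by
  have h1 := h.chain
  rw [← h.join] at h1
  have := ELLF.mem_pairs h1 (h.sublist.subset hs)
  exact ⟨this.1, this.2.2, this.2.1⟩

lemma splitBy_cases (h : IsGroup N g c p l m e) {G : List Path}
    (hG : G ∈ (loopErase (joinPath g)).splitBy (sameTriangle (N + 1))) :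
    (∃ a b, G = [[a, b]]) ∨ ∃ a b d, G = [[a, b], [b, d]] ∧ a ≠ d := by
  rw [h.splitBy_eq] at hG
  obtain ⟨G', hG', rfl⟩ := List.mem_map.1 hG
  rcases h.route.group_eq hG' with ⟨x, y, rfl⟩ | ⟨x, y, z, rfl, hxz⟩
  · exact Or.inl ⟨_, _, rfl⟩
  · exact Or.inr ⟨_, _, _, rfl, fun h => hxz (Config.emb_injective h)⟩

lemma emb_corner_eq (_ : IsGroup N g c p l m e) {x : Label} (hx : isCorner x = true) :
    ∃ k, c.emb N p x = lp N (p - corner c.i + corner k) := by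
  obtain ⟨h1, h2, h3⟩ := Config.emb_corner (c := c) (N := N) (p := p)
  cases x <;> simp [isCorner] at hx
  · exact ⟨c.i, by rw [h1]; congr 1; abel⟩
  · exact ⟨c.j, h2⟩
  · exact ⟨_, h3⟩

/-- `p - corner c.i` is the lower left corner of `pqr`, and the first step runs in its subtriangle
at `p`. -/
lemma first_eq (h : IsGroup N g c p l m e) {s : Path} (hs : s ∈ (loopErase (joinPath g)).head?) :
    ∃ m n n', n ≠ n' ∧
      psrc s = lp (N + 1) ((2 : ℤ) • (p - corner c.i) + corner m + corner n) ∧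
      ptgt s = lp (N + 1) ((2 : ℤ) • (p - corner c.i) + corner m + corner n') := by
  have hij := c.hij
  have hik : c.i ≠ -(c.i + c.j) := by
    have : ∀ i j : Fin 3, i ≠ j → i ≠ -(i + j) := by decide
    exact this _ _ hij
  rw [h.loopErase_eq] at hs
  obtain ⟨x, L, hL⟩ := List.exists_cons_of_ne_nil h.route.walk.2
  rw [hL] at hs
  simp only [List.map_cons, List.head?_cons, Option.mem_def, Option.some.injEq] at hs
  subst hs
  rcases h.route.first_step hL with rfl | rfl
  · refine ⟨c.i, c.i, c.j, hij, ?_, ?_⟩ <;>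
      simp only [psrc_pair, ptgt_pair, Config.emb, Config.off, Config.pos] <;> congr 1 <;>
      simp only [smul_sub, two_smul] <;> abel
  · refine ⟨c.i, c.i, _, hik, ?_, ?_⟩ <;>
      simp only [psrc_pair, ptgt_pair, Config.emb, Config.off, Config.pos] <;> congr 1 <;>
      simp only [smul_sub, two_smul] <;> abel

lemma last_eq (h : IsGroup N g c p l m e) {s : Path}
    (hs : s ∈ (loopErase (joinPath g)).getLast?) : ∃ m n, m ≠ n ∧
      psrc s = lp (N + 1) ((2 : ℤ) • (p - corner c.i) + corner m + corner n) := by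
  have hij := c.hij
  have hk : c.i ≠ -(c.i + c.j) ∧ c.j ≠ -(c.i + c.j) := by
    have : ∀ i j : Fin 3, i ≠ j → i ≠ -(i + j) ∧ j ≠ -(i + j) := by decide
    exact this _ _ hij
  rw [h.loopErase_eq] at hs
  obtain ⟨L, x, hL⟩ := (List.eq_nil_or_concat' (loopEraseL l)).resolve_left h.route.walk.2
  rw [hL] at hs
  simp only [List.map_append, List.map_cons, List.map_nil, List.getLast?_append,
    List.getLast?_singleton, Option.some_or, Option.mem_def, Option.some.injEq] at hs
  subst hs
  rcases (h.route.last_step hL).2 with h1 | ⟨h1, -⟩ | ⟨h1, -⟩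
  · refine ⟨_, _, hk.2, ?_⟩
    simp only [psrc_pair, Config.emb, Config.off, Config.pos, h1]
    congr 1
    simp only [smul_sub, two_smul]
    abel
  · refine ⟨_, _, hij, ?_⟩
    simp only [psrc_pair, Config.emb, Config.off, Config.pos, h1]
    congr 1
    simp only [smul_sub, two_smul]
    abel
  · refine ⟨_, _, hk.1, ?_⟩
    simp only [psrc_pair, Config.emb, Config.off, Config.pos, h1]
    congr 1
    simp only [smul_sub, two_smul]
    abel

/-- The loop erasures of successive groups do not meet in one triangle of level `N + 1`. -/
lemma not_sameTriangle (h : IsGroup N g c p l m e) {g' : List Path} {c' : Config} {p' : ℤ × ℤ}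
    {l' m' : List Label} {e' : Label} (h' : IsGroup N g' c' p' l' m' e')
    (hg : ∃ (ha : g ≠ []) (hb : g' ≠ []), sameTriangle N (g.getLast ha) (g'.head hb) = false)
    {s s' : Path} (hs : s ∈ (loopErase (joinPath g)).getLast?)
    (hs' : s' ∈ (loopErase (joinPath g')).head?) : sameTriangle (N + 1) s s' = false := by
  obtain ⟨ha, hb, hn⟩ := hg
  by_contra htrue
  have htri : InTriangle (N + 1) (psrc s) (psrc s') (ptgt s') :=
    of_decide_eq_true ((Bool.not_eq_false _).mp htrue)
  have hn : ¬ InTriangle N (psrc (g.getLast ha)) (psrc (g'.head hb)) (ptgt (g'.head hb)) :=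
    of_decide_eq_false hn
  obtain ⟨m₁, n₁, hmn, hs1⟩ := h.last_eq hs
  obtain ⟨m₂, n₂, n₃, hn23, hs2, hs3⟩ := h'.first_eq hs'
  have ht : (2 : ℤ) • (p' - corner c'.i) + corner m₂ ∈ cells base (N + 1) :=
    mem_cells_succ.2 h'.mem
  rw [hs1, hs2, hs3, inTriangle_iff ht hn23] at htri
  obtain ⟨k, hk⟩ := htri
  -- The last step of the first group starts at a midpoint, which fixes the triangle of level `N`. A
  -- common small triangle would therefore put both groups in the same triangle, where they would
  -- not have been separated.
  have hT := mid_inj hmn hk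
  obtain ⟨x, -, hx, -, -, hx1, -⟩ := h.ends _ (List.getLast_mem ha)
  obtain ⟨y, z, hy, hz, hyz, hy1, hz1⟩ := h'.ends _ (List.head_mem hb)
  obtain ⟨i, hi⟩ := h.emb_corner_eq hx
  obtain ⟨j, hj⟩ := h'.emb_corner_eq hy
  obtain ⟨k, hk⟩ := h'.emb_corner_eq hz
  rw [hx1, hy1, hz1, hi, hj, hk, inTriangle_iff h'.mem] at hn
  · exact hn ⟨i, by rw [hT]⟩
  · rintro rfl
    exact hyz (Config.emb_injective (hj.trans hk.symm))

end IsGroup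

lemma isGroup_one {N : ℕ} {c : Config} {p : ℤ × ℤ} (h : c.IsAt N p false) {l : List Label}
    (hl : l ∈ SegL false) : ∃ m, IsGroup N [l.map (c.emb N p)] c p l m Q := by
  obtain ⟨m, hm⟩ := isRoute_of_mem hl
  have hseg : l.map (c.emb N p) ∈ Seg N (c.emb N p P) (c.emb N p Q) := by
    have := h.seg_eq
    rw [startL, endL] at this
    rw [this]
    exact ⟨l, hl, rfl⟩
  obtain ⟨m', he, hch, -⟩ := hseg
  have h1 : psrc (l.map (c.emb N p)) = c.emb N p P := by rw [he]; rfl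
  have h2 : ptgt (l.map (c.emb N p)) = c.emb N p Q := by
    rw [he, ← List.cons_append, ptgt_append (by simp)]; rfl
  refine ⟨m, hm, rfl, hch, h.mem_first, h1, h2, ?_⟩
  intro s hs
  rw [List.mem_singleton] at hs
  subst hs
  exact ⟨P, Q, rfl, rfl, by decide, h1, h2⟩

lemma isGroup_two {N : ℕ} {c : Config} {p : ℤ × ℤ} (h : c.IsAt N p false) (h' : c.IsAt N p true)
    {l₁ l₂ : List Label} (h₁ : l₁ ∈ SegL false) (h₂ : l₂ ∈ SegL true) :
    ∃ m, IsGroup N [l₁.map (c.emb N p), l₂.map (c.emb N p)] c p (l₁.dropLast ++ l₂) m R := by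
  obtain ⟨m, hm⟩ := isRoute_append h₁ h₂
  have hseg₁ : l₁.map (c.emb N p) ∈ Seg N (c.emb N p P) (c.emb N p Q) := by
    have := h.seg_eq
    rw [startL, endL] at this
    rw [this]
    exact ⟨l₁, h₁, rfl⟩
  have hseg₂ : l₂.map (c.emb N p) ∈ Seg N (c.emb N p Q) (c.emb N p R) := by
    have := h'.seg_eq
    rw [startL, endL] at this
    rw [this]
    exact ⟨l₂, h₂, rfl⟩
  obtain ⟨m₁, he₁, hch₁, -⟩ := hseg₁
  obtain ⟨m₂, he₂, hch₂, -⟩ := hseg₂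
  have a1 : psrc (l₁.map (c.emb N p)) = c.emb N p P := by rw [he₁]; rfl
  have a2 : ptgt (l₁.map (c.emb N p)) = c.emb N p Q := by
    rw [he₁, ← List.cons_append, ptgt_append (by simp)]; rfl
  have b1 : psrc (l₂.map (c.emb N p)) = c.emb N p Q := by rw [he₂]; rfl
  have b2 : ptgt (l₂.map (c.emb N p)) = c.emb N p R := by
    rw [he₂, ← List.cons_append, ptgt_append (by simp)]; rfl
  have hj : joinPath [l₁.map (c.emb N p), l₂.map (c.emb N p)] =
      (l₁.dropLast ++ l₂).map (c.emb N p) := by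
    simp [joinPath]
  have hw : IsWalk psrc ptgt (c.emb N p P) [l₁.map (c.emb N p), l₂.map (c.emb N p)]
      (c.emb N p R) := ⟨a1, a2 ▸ b1, b2⟩
  have hlen : ∀ s ∈ [l₁.map (c.emb N p), l₂.map (c.emb N p)], 2 ≤ s.length := by
    intro s hs
    simp only [List.mem_cons, List.not_mem_nil, or_false] at hs
    rcases hs with rfl | rfl
    · rw [he₁]; simp
    · rw [he₂]; simp
  refine ⟨m, hm, hj, ?_, h.mem_first, a1, b2, ?_⟩
  · rw [← hj, joinPath_eq' hw hlen (by simp), isChain_joinPath hw hlen]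
    intro s hs
    simp only [List.mem_cons, List.not_mem_nil, or_false] at hs
    rcases hs with rfl | rfl
    · exact hch₁
    · exact hch₂
  · intro s hs
    simp only [List.mem_cons, List.not_mem_nil, or_false] at hs
    rcases hs with rfl | rfl
    · exact ⟨P, Q, rfl, rfl, by decide, a1, a2⟩
    · exact ⟨Q, R, rfl, rfl, by decide, b1, b2⟩

/-! ### Stopped paths -/

/-- The paths of level `N` from `O`, stopped at `a`, with coarse-graining `c` at level `0`. -/
def X (c : Path) (N : ℕ) : Set Path :=
  {w | w.head? = some ptO ∧ w.getLast? = some ptA ∧ w.IsChain (fun p q => s(p, q) ∈ EV N) ∧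
    (∀ p ∈ w.dropLast, p ≠ ptA) ∧ coarse 0 w = c}

/-- The possible coarse-grainings at level `0`. -/
def IsSimple (c : Path) : Prop := c = [ptO, ptA] ∨ c = [ptO, ptB, ptA]

lemma pairs_map_psrc (w : Path) : (pairs w).map psrc = w.dropLast := by
  induction w with
  | nil => rfl
  | cons p w ih =>
    cases w with
    | nil => rfl
    | cons q w => rw [pairs, List.map_cons, ih]; rfl

lemma pairs_map_ends (w : Path) : (pairs w).map ends = pairs w := by
  refine (List.map_congr_left fun s hs => ?_).trans (List.map_id _)
  match s, mem_pairs_length hs with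
  | [p, q], _ => rfl

lemma head_getLast_eq {w : Path} (h : w.head? = some ptO) (h' : w.getLast? = some ptA) :
    w ≠ [] ∧ psrc w = ptO ∧ ptgt w = ptA ∧ 2 ≤ w.length := by
  have hne : w ≠ [] := by rintro rfl; simp at h
  have h1 : psrc w = ptO := by rw [psrc, h]; rfl
  have h2 : ptgt w = ptA := by rw [ptgt, h']; rfl
  refine ⟨hne, h1, h2, ?_⟩
  match w, hne with
  | [p], _ =>
    have h3 : p = ptO := h1
    have h4 : p = ptA := h2
    rw [h3] at h4
    exact absurd h4 (by decide +kernel)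
  | _ :: _ :: _, _ => simp

section Stopped

variable {c w : Path} {N : ℕ}

lemma isCut_pairs (h : w.head? = some ptO) (h' : w.getLast? = some ptA)
    (hch : w.IsChain fun p q => s(p, q) ∈ EV N) (ha : ∀ p ∈ w.dropLast, p ≠ ptA) :
    IsCut N ptA (pairs w) := by
  obtain ⟨hne, h1, h2, h3⟩ := head_getLast_eq h h'
  refine ⟨⟨?_, by decide +kernel, ?_, ?_⟩, fun s hs => isSegment_of_length (mem_pairs_length hs) _, ?_⟩
  · obtain ⟨p, l, rfl⟩ := List.exists_cons_of_ne_nil hne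
    rw [← h1, ← h2]
    exact pairs_walk p l
  · intro s hs
    exact ha _ (mem_pairs hch hs).2.1
  · match w, h3 with
    | _ :: _ :: _, _ => simp [pairs]
  · intro s hs
    have := edge_ne (mem_pairs hch hs).1
    exact ⟨this.2.1, this.2.2.symm⟩

lemma isCut_of_mem (h : w ∈ X c N) : IsCut N ptA (pairs w) :=
  isCut_pairs h.1 h.2.1 h.2.2.1 h.2.2.2.1

lemma joinPath_pairs_of_mem (h : w ∈ X c N) : joinPath (pairs w) = w :=
  joinPath_pairs (head_getLast_eq h.1 h.2.1).2.2.2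

lemma mem_dropLast_joinPath {p q : Pt} {S : List Path} (hS : IsWalk psrc ptgt p S q)
    (h2 : ∀ s ∈ S, 2 ≤ s.length) {y : Pt} (hy : y ∈ (joinPath S).dropLast) :
    ∃ s ∈ S, y ∈ s.dropLast := by
  induction S generalizing p with
  | nil => simp [joinPath] at hy
  | cons s S ih =>
    cases S with
    | nil => exact ⟨s, by simp, hy⟩
    | cons t S =>
      have := two_le_length_joinPath hS.2 (fun s hs => h2 s (by simp [hs])) (by simp)
      rw [joinPath, List.dropLast_append_of_ne_nil (by rintro h0; simp [h0] at this),
        List.mem_append] at hy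
      rcases hy with hy | hy
      · exact ⟨s, by simp, hy⟩
      · obtain ⟨s', hs', hy⟩ := ih hS.2 (fun s hs => h2 s (by simp [hs])) hy
        exact ⟨s', by simp [hs'], hy⟩

lemma mem_of_mem_blocksAux {A : Finset Pt} {d p y : Pt} {acc l : Path} (hy : y ∈ l) (hA : y ∈ A) :
    y = p ∨ y ∈ (blocksAux A p acc l).map fun s => s.getLast?.getD d := by
  induction l generalizing p acc with
  | nil => simp at hy
  | cons q l ih =>
    rw [blocksAux]
    split_ifs with hif
    · rw [List.map_cons, List.mem_cons]
      rcases List.mem_cons.1 hy with rfl | hy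
      · exact Or.inr (Or.inl (by simp))
      · rcases ih (p := q) (acc := [q]) hy with rfl | h
        · exact Or.inr (Or.inl (by simp))
        · exact Or.inr (Or.inr h)
    · rcases List.mem_cons.1 hy with rfl | hy
      · left
        by_contra hne
        exact hif ⟨hA, hne⟩
      · exact ih hy

/-- The vertices of the coarser lattice on a path are on its coarse-graining. -/
lemma mem_coarse {M : ℕ} {y : Pt} (hy : y ∈ w) (hM : y ∈ GV M) : y ∈ coarse M w := by
  cases w with
  | nil => simp at hy
  | cons p l =>
    rw [coarse, List.mem_cons]
    rcases List.mem_cons.1 hy with rfl | hy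
    · exact Or.inl rfl
    · exact mem_of_mem_blocksAux hy hM

lemma mem_of_isSimple (hc : IsSimple c) {y : Pt} (hy : y ∈ c) : y = ptO ∨ y = ptB ∨ y = ptA := by
  rcases hc with rfl | rfl <;> simp at hy <;> tauto

/-- The points of a stopped path before the last one belong to two triangles. -/
lemma isInner_of_mem (hc : IsSimple c) (h : w ∈ X c N) {z : ℤ × ℤ} {i : Fin 3}
    (hz : lp N z ∈ w.dropLast) (hi : z - corner i ∈ cells base N) : IsInner N z := by
  rcases isInner_or hi with h1 | ⟨o, ho, rfl⟩
  · exact h1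
  -- A vertex in a single triangle is an outer vertex of level 0. It would appear in the
  -- coarse-graining `c`, where only `O` and `b` precede the end `a`, and these belong to two
  -- triangles.
  exfalso
  have e : lp N ((2 : ℤ) ^ N • o) = lp 0 o := by
    have : (2 : ℚ) ^ N ≠ 0 := by positivity
    ext <;> simp [lp]
  have hne := h.2.2.2.1 _ hz
  rw [e] at hz hne
  have hmem : lp 0 o ∈ GV 0 := by
    rcases ho with rfl | rfl | rfl | rfl | rfl <;> decide +kernel
  have := mem_coarse (List.dropLast_subset _ hz) hmem
  rw [h.2.2.2.2] at this
  have key : lp 0 o = ptO ∨ lp 0 o = ptB := by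
    rcases mem_of_isSimple hc this with h | h | h
    · exact Or.inl h
    · exact Or.inr h
    · exact absurd h hne
  rcases ho with rfl | rfl | rfl | rfl | rfl <;> revert key <;> decide +kernel

end Stopped

/-! ### Segments and edges -/

lemma odd_ne {m n : Fin 3} (hmn : m ≠ n) (T y : ℤ × ℤ) :
    (2 : ℤ) • T + corner m + corner n ≠ (2 : ℤ) • y := by
  intro h
  have h1 := congrArg Prod.fst h
  have h2 := congrArg Prod.snd h
  fin_cases m <;> fin_cases n <;> simp [corner] at h1 h2 hmn <;> omega

lemma two_smul_add_two (T : ℤ × ℤ) (m : Fin 3) :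
    (2 : ℤ) • T + corner m + corner m = (2 : ℤ) • (T + corner m) := by
  rw [smul_add, two_smul ℤ (corner m)]; abel

/-- `y` is the midpoint of a side of a triangle with corner `p`. -/
def IsMid (N : ℕ) (p y : Pt) : Prop := ∃ T ∈ cells base N, ∃ i m n, m ≠ n ∧
  p = lp N (T + corner i) ∧ y = lp (N + 1) ((2 : ℤ) • T + corner m + corner n)

lemma isMid_or {N : ℕ} {p y y' : Pt} (hp : p ∈ GV N) (hy : y = p ∨ IsMid N p y)
    (he : s(y, y') ∈ EV (N + 1)) : IsMid N p y' ∨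
      ∃ T ∈ cells base N, ∃ i m, p = lp N (T + corner i) ∧ y' = lp N (T + corner m) := by
  obtain ⟨t, ⟨T', hT', m', rfl⟩, n', k, hnk, h1, h2⟩ := exists_edge_cell he
  rcases hy with rfl | ⟨T, hT, i, m, n, hmn, hpT, hyT⟩
  · obtain ⟨P₀, hP₀⟩ := lp_mem_GV_succ (h1 ▸ hp)
    obtain rfl : m' = n' := by
      by_contra hne
      exact odd_ne hne _ _ hP₀
    rw [two_smul_add_two, lp_succ] at h1
    exact Or.inl ⟨T', hT', m', m', k, hnk, h1, h2⟩
  · rw [hyT] at h1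
    obtain rfl := mid_inj hmn (lp_injective _ h1)
    by_cases hk : m' = k
    · subst hk
      exact Or.inr ⟨T, hT, i, m', hpT, by rw [h2, two_smul_add_two, lp_succ]⟩
    · exact Or.inl ⟨T, hT, i, m', k, hk, hpT, h2⟩

/-- Until the next hit the path is at `p` or at a midpoint in a triangle with corner `p`, so the hit
is another corner of such a triangle. -/
lemma edge_of_chain {N : ℕ} {p q y : Pt} {m : Path} (hp : p ∈ GV N) (hq : q ∈ GV N) (hpq : p ≠ q)
    (hch : (y :: (m ++ [q])).IsChain fun a b => s(a, b) ∈ EV (N + 1))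
    (hm : ∀ x ∈ m, x ∈ GV N → x = p) (hy : y = p ∨ IsMid N p y) : s(p, q) ∈ EV N := by
  induction m generalizing y with
  | nil =>
    rw [List.nil_append, List.isChain_cons_cons] at hch
    rcases isMid_or hp hy hch.1 with ⟨T, hT, i, m, n, hmn, -, hqT⟩ | ⟨T, hT, i, m, hpT, hqT⟩
    · obtain ⟨z, hz⟩ := lp_mem_GV_succ (hqT ▸ hq)
      exact absurd hz (odd_ne hmn _ _)
    · rw [mem_EV]
      refine ⟨T, hT, i, m, ?_, by rw [hpT, hqT]⟩
      rintro rfl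
      exact hpq (hpT.trans hqT.symm)
  | cons y' m ih =>
    rw [List.cons_append, List.isChain_cons_cons] at hch
    refine ih hch.2 (fun x hx => hm x (by simp [hx])) ?_
    rcases isMid_or hp hy hch.1 with h | ⟨T, hT, i, n, hpT, hqT⟩
    · exact Or.inr h
    · exact Or.inl (hm y' (by simp) (mem_GV.2 ⟨T, hT, n, hqT⟩))

/-- The end points of a segment are neighbours. -/
lemma edge_of_seg {N : ℕ} {p q : Pt} {s : Path} (hp : p ∈ GV N) (hq : q ∈ GV N) (hpq : p ≠ q)
    (hs : s ∈ Seg N p q) : s(p, q) ∈ EV N := by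
  obtain ⟨m, rfl, hch, hm⟩ := hs
  exact edge_of_chain hp hq hpq hch hm (Or.inl rfl)

/-! ### Refinement of paths -/

/-- The segments in `S` refine the steps in `D`. -/
def Fits (N : ℕ) (D S : List Path) : Prop :=
  List.Forall₂ (fun d s => s ∈ Seg N (psrc d) (ptgt d)) D S

section Fits

variable {N : ℕ} {D S : List Path}

lemma psrc_of_seg {p q : Pt} {s : Path} (h : s ∈ Seg N p q) : psrc s = p := by
  obtain ⟨m, rfl, -⟩ := h; rfl

lemma ptgt_of_seg {p q : Pt} {s : Path} (h : s ∈ Seg N p q) : ptgt s = q := by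
  obtain ⟨m, rfl, -⟩ := h
  rw [← List.cons_append, ptgt_append (by simp)]; rfl

lemma isSegment_of_seg {p q : Pt} {s : Path} (h : s ∈ Seg N p q) : IsSegment (GV N) s := by
  obtain ⟨m, rfl, -, hm⟩ := h
  exact ⟨by simp, fun x hx => hm x (by simpa using hx)⟩

lemma eq_of_mem_seg_dropLast {p q y : Pt} {s : Path} (h : s ∈ Seg N p q) (hy : y ∈ s.dropLast)
    (hN : y ∈ GV N) : y = p := by
  obtain ⟨m, rfl, -, hm⟩ := h
  rw [← List.cons_append, List.dropLast_concat] at hy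
  rcases List.mem_cons.1 hy with rfl | hy
  · rfl
  · exact hm y hy hN

lemma Fits.ends (h : Fits N D S) : S.map ends = D.map ends := by
  induction h with
  | nil => rfl
  | cons h _ ih => rw [List.map_cons, List.map_cons, ih, ELLF.ends, psrc_of_seg h, ptgt_of_seg h]; rfl

lemma Fits.exists_mem (h : Fits N D S) {s : Path} (hs : s ∈ S) :
    s ∈ Seg N (psrc s) (ptgt s) ∧ ELLF.ends s ∈ D.map ELLF.ends := by
  constructor
  · induction h with
    | nil => simp at hs
    | cons h _ ih =>
      rcases List.mem_cons.1 hs with rfl | hs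
      · rwa [psrc_of_seg h, ptgt_of_seg h]
      · exact ih hs
  · rw [← h.ends]
    exact List.mem_map_of_mem hs

lemma Fits.walk (h : Fits N D S) {p q : Pt} (hD : IsWalk psrc ptgt p D q) :
    IsWalk psrc ptgt p S q := by
  have key := fun S => isWalk_map (f := ELLF.ends) (src := psrc) (tgt := ptgt) (src' := psrc)
    (tgt' := ptgt) (fun _ => rfl) (fun _ => rfl) p q S
  rw [← key, h.ends, key]
  exact hD

lemma Fits.ends_pairs {z : Path} (h : Fits N (pairs z) S) : S.map ELLF.ends = pairs z := by
  rw [h.ends, pairs_map_ends]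

end Fits

section Decomposition

variable {c w z : Path} {N : ℕ} {S : List Path}

lemma isCut_of_fits (hz : z ∈ X c N) (h : Fits N (pairs z) S) : IsCut N ptA S := by
  have hD := isCut_of_mem hz
  refine ⟨⟨h.walk hD.walk, hD.mem, fun s hs => ?_, ?_⟩, fun s hs => isSegment_of_seg (h.exists_mem hs).1,
    fun s hs => ?_⟩
  · have := (h.exists_mem hs).2
    rw [pairs_map_ends] at this
    exact hD.ne (ends s) this
  · rintro rfl
    have := h.ends_pairs
    exact hD.ne_nil this.symm
  · have := (h.exists_mem hs).2
    rw [pairs_map_ends] at this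
    exact hD.hits (ends s) this

lemma coarse_of_fits (hz : z ∈ X c N) (h : Fits N (pairs z) S) :
    joinPath (S.map ends) = z ∧ coarse N (joinPath S) = z ∧ blocks (GV N) (joinPath S) = S := by
  have hS := isCut_of_fits hz h
  have h1 : joinPath (S.map ends) = z := by rw [h.ends_pairs, joinPath_pairs_of_mem hz]
  exact ⟨h1, by rw [hS.coarse_eq, h1], hS.blocks_eq⟩

lemma joinPath_mem (hz : z ∈ X c N) (h : Fits N (pairs z) S) : joinPath S ∈ X c (N + 1) := by
  have hS := isCut_of_fits hz h
  have h2 : ∀ s ∈ S, 2 ≤ s.length := fun s hs => (hS.seg s hs).two_le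
  have hlen := two_le_length_joinPath hS.walk h2 hS.ne_nil
  have hne : joinPath S ≠ [] := by
    intro h0; rw [h0] at hlen; simp at hlen
  have h3 := psrc_joinPath hS.walk h2 hS.ne_nil
  have h4 := ptgt_joinPath hS.walk h2 hS.ne_nil
  refine ⟨?_, ?_, ?_, ?_, ?_⟩
  · rw [eq_psrc_cons hne, h3]; rfl
  · rw [eq_dropLast_ptgt hne, h4]; simp
  · rw [joinPath_eq' hS.walk h2 hS.ne_nil, isChain_joinPath hS.walk h2]
    intro s hs
    obtain ⟨m, he, hch, -⟩ := (h.exists_mem hs).1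
    exact hch
  · rintro y hy rfl
    obtain ⟨s, hs, hy⟩ := mem_dropLast_joinPath hS.walk h2 hy
    have := eq_of_mem_seg_dropLast (h.exists_mem hs).1 hy (GV_mono (Nat.zero_le N) (by decide +kernel))
    exact hS.ne s hs this.symm
  · have := hS.coarse_coarse (Nat.zero_le N)
    rw [← this, (coarse_of_fits hz h).1]
    exact hz.2.2.2.2

/-- Together with `joinPath_mem` and `coarse_of_fits`, this identifies paths of level `N + 1` with
paths of level `N` equipped with a refinement of each step. -/
lemma exists_fits (hw : w ∈ X c (N + 1)) :
    coarse N w ∈ X c N ∧ Fits N (pairs (coarse N w)) (blocks (GV N) w) ∧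
      joinPath (blocks (GV N) w) = w := by
  have hP := isCut_of_mem hw
  have hB := gBlocks_isBlock hP.walk (ptO_mem N)
  set L := gBlocks psrc ptgt (GV N) (pairs w) with hL
  have hflat : L.flatten = pairs w := hP.gBlocks_flatten N
  have hbl : blocks (GV N) w = L.map joinPath := by
    conv_lhs => rw [← joinPath_pairs_of_mem hw]
    exact blocks_joinPath hP.walk fun s hs => isSegment_of_length
      (mem_pairs_length hs) _
  have hmem : ∀ b ∈ L, ∀ s ∈ b, s ∈ pairs w := fun b hb s hs => by
    rw [← hflat]; exact List.mem_flatten.2 ⟨b, hb, hs⟩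
  have h2 : ∀ b ∈ L, ∀ s ∈ b, 2 ≤ s.length := fun b hb s hs =>
    (mem_pairs_length (hmem b hb s hs)).ge
  have hsrc : ∀ b ∈ L, psrc (joinPath b) = gsrc psrc b := fun b hb =>
    psrc_joinPath (hB b hb).walk (h2 b hb) (hB b hb).ne_nil
  have htgt : ∀ b ∈ L, ptgt (joinPath b) = gtgt ptgt b := fun b hb =>
    ptgt_joinPath (hB b hb).walk (h2 b hb) (hB b hb).ne_nil
  have hjoin : joinPath (L.map joinPath) = w := by
    rw [joinPath_map_joinPath (p := ptO) (q := ptA), hflat, joinPath_pairs_of_mem hw]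
    · rw [hflat]; exact hP.walk
    · rw [hflat]; exact fun s hs => (mem_pairs_length hs).ge
    · exact fun b hb => (hB b hb).ne_nil
  have hseg : ∀ b ∈ L, joinPath b ∈ Seg N (gsrc psrc b) (gtgt ptgt b) := by
    intro b hb
    have hlen := two_le_length_joinPath (hB b hb).walk (h2 b hb) (hB b hb).ne_nil
    have he := eq_psrc_interior_ptgt hlen
    rw [hsrc b hb, htgt b hb] at he
    refine ⟨_, he, ?_, ?_⟩
    · rw [joinPath_eq' (hB b hb).walk (h2 b hb) (hB b hb).ne_nil,
        isChain_joinPath (hB b hb).walk (h2 b hb)]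
      intro s hs
      obtain ⟨h3, -, h4⟩ := mem_pairs hw.2.2.1 (hmem b hb s hs)
      rw [h4]
      simpa using h3
    · intro y hy hyN
      have hy' : y ∈ (joinPath b).dropLast := by
        rw [he, ← List.cons_append, List.dropLast_concat]
        exact List.mem_cons_of_mem _ hy
      obtain ⟨s, hs, hys⟩ := mem_dropLast_joinPath (hB b hb).walk (h2 b hb) hy'
      obtain ⟨-, -, h4⟩ := mem_pairs hw.2.2.1 (hmem b hb s hs)
      rw [h4] at hys
      have hys : y = psrc s := by simpa using hys
      rw [hys]
      exact (hB b hb).src_eq s hs (hys ▸ hyN)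
  have hcut : IsCut N ptA (L.map joinPath) := by
    refine ⟨⟨?_, hP.mem, ?_, ?_⟩, ?_, ?_⟩
    · have h3 : IsWalk psrc ptgt ptO L.flatten ptA := by rw [hflat]; exact hP.walk
      have h4 := ((isWalk_flatten fun b hb => (hB b hb).ne_nil).1 h3).1
      clear_value L
      clear hbl hjoin hL hflat h3
      revert h4 hsrc htgt
      generalize ptO = p
      intro hsrc htgt h4
      induction L generalizing p with
      | nil => exact h4
      | cons b L ih =>
        refine ⟨(hsrc b (by simp)).trans h4.1, ?_⟩
        rw [htgt b (by simp)]
        exact ih (fun b hb => hB b (by simp [hb])) (fun b hb => hmem b (by simp [hb]))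
          (fun b hb => h2 b (by simp [hb])) (fun b hb => hseg b (by simp [hb])) _
          (fun b hb => hsrc b (by simp [hb]))
          (fun b hb => htgt b (by simp [hb])) h4.2
    · simp only [List.forall_mem_map]
      intro b hb
      rw [hsrc b hb]
      obtain ⟨s, b', rfl⟩ := List.exists_cons_of_ne_nil (hB b hb).ne_nil
      exact hP.ne s (hmem _ hb s (by simp))
    · intro h0
      rw [List.map_eq_nil_iff] at h0
      rw [h0] at hflat
      exact hP.ne_nil hflat.symm
    · simp only [List.forall_mem_map]
      exact fun b hb => isSegment_of_seg (hseg b hb)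
    · simp only [List.forall_mem_map]
      intro b hb
      rw [hsrc b hb, htgt b hb]
      exact ⟨(hB b hb).tgt_mem, (hB b hb).tgt_ne⟩
  have hz : coarse N w = joinPath ((L.map joinPath).map ends) := by
    rw [← hcut.coarse_eq, hjoin]
  have hE := hcut.ends
  have hpairs : pairs (joinPath ((L.map joinPath).map ends)) = (L.map joinPath).map ends :=
    pairs_joinPath hE.walk (by simp [ends]) hE.ne_nil
  have hlen := two_le_length_joinPath hE.walk (fun s hs => (hE.seg s hs).two_le) hE.ne_nil
  have hne : joinPath ((L.map joinPath).map ends) ≠ [] := by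
    intro h0; rw [h0] at hlen; simp at hlen
  have h3 := psrc_joinPath hE.walk (fun s hs => (hE.seg s hs).two_le) hE.ne_nil
  have h4 := ptgt_joinPath hE.walk (fun s hs => (hE.seg s hs).two_le) hE.ne_nil
  rw [hz, hbl]
  refine ⟨⟨?_, ?_, ?_, ?_, ?_⟩, ?_, hjoin⟩
  · rw [eq_psrc_cons hne, h3]; rfl
  · rw [eq_dropLast_ptgt hne, h4]; simp
  · rw [joinPath_eq' hE.walk (fun s hs => (hE.seg s hs).two_le) hE.ne_nil,
      isChain_joinPath hE.walk (fun s hs => (hE.seg s hs).two_le)]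
    simp only [List.forall_mem_map]
    intro b hb
    have := edge_of_seg (hB b hb).src_mem (hB b hb).tgt_mem (hB b hb).tgt_ne.symm (hseg b hb)
    rw [ends, hsrc b hb, htgt b hb]
    simpa using this
  · intro y hy
    rw [← pairs_map_psrc, hpairs] at hy
    obtain ⟨s, hs, rfl⟩ := List.mem_map.1 hy
    exact hE.ne s hs
  · rw [hcut.coarse_coarse (Nat.zero_le N), hjoin]
    exact hw.2.2.2.2
  · rw [hpairs, List.map_map]
    clear_value L
    clear hbl hjoin hL hflat hcut hz hE hpairs hlen hne h3 h4
    induction L with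
    | nil => exact List.Forall₂.nil
    | cons b L ih =>
      refine List.Forall₂.cons ?_ (ih (fun b hb => hB b (by simp [hb]))
        (fun b hb => hmem b (by simp [hb]))
        (fun b hb => h2 b (by simp [hb])) 
        (fun b hb => hsrc b (by simp [hb]))
        (fun b hb => htgt b (by simp [hb])) (fun b hb => hseg b (by simp [hb])))
      have := hseg b (by simp)
      rwa [← hsrc b (by simp), ← htgt b (by simp)] at this

lemma coarse_zero_of_chain {w : Path} (hch : w.IsChain fun p q => s(p, q) ∈ EV 0)
    (h2 : 2 ≤ w.length) : coarse 0 w = w := by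
  have h := blocks_eq_pairs hch h2
  obtain ⟨p, l, rfl⟩ := List.exists_cons_of_ne_nil (l := w) (by rintro rfl; simp at h2)
  rw [coarse, h]
  congr 1
  clear h h2 hch
  induction l generalizing p with
  | nil => rfl
  | cons q l ih =>
    rw [pairs, List.map_cons]
    refine congrArg₂ _ rfl ((List.map_congr_left fun s hs => ?_).trans (ih q))
    rw [List.getLast?_eq_some_getLast]
    · rfl
    · rintro rfl
      have := mem_pairs_length hs
      simp at this

lemma X_zero (hc : IsSimple c) : X c 0 = {c} := by
  ext w
  constructor
  · intro h
    rw [Set.mem_singleton_iff, ← h.2.2.2.2]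
    exact (coarse_zero_of_chain h.2.2.1 (head_getLast_eq h.1 h.2.1).2.2.2).symm
  · rintro rfl
    have hch : w.IsChain fun p q => s(p, q) ∈ EV 0 := by
      rcases hc with rfl | rfl <;> decide +kernel
    have h2 : 2 ≤ w.length := by rcases hc with rfl | rfl <;> simp
    refine ⟨?_, ?_, hch, ?_, coarse_zero_of_chain hch h2⟩
    · rcases hc with rfl | rfl <;> rfl
    · rcases hc with rfl | rfl <;> rfl
    · rcases hc with rfl | rfl <;> decide +kernel

end Decomposition

/-! ### The triangles passed through by the loop erasure -/

section Groups

variable {c w z : Path} {N : ℕ} {S : List Path}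

/-- If the relation fails at every junction, no group straddles two pieces. -/
lemma splitBy_flatMap {α β : Type*} {r : β → β → Bool} {f : α → List β} {L : List α}
    (hne : ∀ g ∈ L, f g ≠ [])
    (h : L.IsChain fun g g' => ∀ s ∈ (f g).getLast?, ∀ s' ∈ (f g').head?, r s s' = false) :
    (L.flatMap f).splitBy r = L.flatMap fun g => (f g).splitBy r := by
  induction L with
  | nil => simp
  | cons g L ih =>
    rw [List.flatMap_cons, List.flatMap_cons, List.splitBy_append,
      ih (fun g hg => hne g (by simp [hg])) h.tail]
    intro s hs s' hs'
    cases L with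
    | nil => simp at hs'
    | cons g' L =>
      rw [List.isChain_cons_cons] at h
      refine h.1 s hs s' ?_
      rwa [List.flatMap_cons, List.head?_append_of_ne_nil _ (hne g' (by simp))] at hs'

/-- The steps of `w` have level `N` already, so after erasure at this level the coarse-graining
`Q_N` changes nothing. -/
lemma skeleton_hatQ (h : w ∈ X c N) : skeleton N (hatQ N w) = groups N (pairs w) ∧
    hatQ N w = erased N w := by
  have hP := isCut_of_mem h
  have hD := hP.gErased N
  have he : erased N w = joinPath (gErased psrc ptgt N (pairs w)) := by
    conv_lhs => rw [← joinPath_pairs_of_mem h]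
    exact erased_joinPath le_rfl hP.toIsStopped hP.seg
  have h1 : hatQ N w = erased N w := by
    rw [hatQ, he, hD.coarse_eq]
    congr 1
    refine (List.map_congr_left fun s hs => ?_).trans (List.map_id _)
    have hs := (gErased_sublist N _).subset hs
    match s, mem_pairs_length hs with
    | [p, q], _ => rfl
  refine ⟨?_, h1⟩
  rw [h1]
  conv_lhs => rw [← joinPath_pairs_of_mem h]
  exact hP.skeleton_erased

/-- A triangle of level `N` passed through in one or two steps, starting from inner vertices. -/
def Passage (N : ℕ) (g : List Path) : Prop :=
  (∃ t ∈ cells base N, ∃ i j, i ≠ j ∧ IsInner N (t + corner i) ∧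
    g = [[lp N (t + corner i), lp N (t + corner j)]]) ∨
  ∃ t ∈ cells base N, ∃ i j k, i ≠ j ∧ i ≠ k ∧ j ≠ k ∧ IsInner N (t + corner i) ∧
    IsInner N (t + corner j) ∧
    g = [[lp N (t + corner i), lp N (t + corner j)], [lp N (t + corner j), lp N (t + corner k)]]

lemma mem_of_mem_groups {g : List Path} (hg : g ∈ groups N S) {s : Path} (hs : s ∈ g) :
    s ∈ S := by
  refine (gErased_sublist (src := psrc) (tgt := ptgt) N S).subset ?_
  have := List.flatten_splitBy (sameTriangle N) (gErased psrc ptgt N S)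
  rw [← this]
  exact List.mem_flatten.2 ⟨g, hg, hs⟩

lemma exists_isGroup {D g : List Path} (hD : Passage N D) (h : Fits N D g) :
    ∃ c p l m e, IsGroup N g c p l m e := by
  rcases hD with ⟨t, ht, i, j, hij, hi, rfl⟩ | ⟨t, ht, i, j, k, hij, hik, hjk, hi, hj, rfl⟩
  · obtain ⟨c, p, hc, hP, hQ⟩ := exists_config₁ ht hij hi
    obtain ⟨s, u, hs, hu, rfl⟩ := List.forall₂_cons_left_iff.1 h
    obtain rfl := List.forall₂_nil_left_iff.1 hu
    rw [psrc_pair, ptgt_pair, ← hP, ← hQ] at hs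
    have := hc.seg_eq
    rw [startL, endL] at this
    rw [this] at hs
    obtain ⟨l, hl, rfl⟩ := hs
    obtain ⟨m, hm⟩ := isGroup_one hc hl
    exact ⟨c, p, l, m, _, hm⟩
  · obtain ⟨c, p, hc, hc', hP, hQ, hR⟩ := exists_config₂ ht hij hik hjk hi hj
    obtain ⟨s, u, hs, hu, rfl⟩ := List.forall₂_cons_left_iff.1 h
    obtain ⟨s', u', hs', hu', rfl⟩ := List.forall₂_cons_left_iff.1 hu
    obtain rfl := List.forall₂_nil_left_iff.1 hu'
    rw [psrc_pair, ptgt_pair, ← hP, ← hQ] at hs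
    rw [psrc_pair, ptgt_pair, ← hQ, ← hR] at hs'
    have h1 : Seg N (c.emb N p P) (c.emb N p Q) = _ := hc.seg_eq
    have h2 : Seg N (c.emb N p Q) (c.emb N p R) = _ := hc'.seg_eq
    rw [h1] at hs
    rw [h2] at hs'
    obtain ⟨l, hl, rfl⟩ := hs
    obtain ⟨l', hl', rfl⟩ := hs'
    obtain ⟨m, hm⟩ := isGroup_two hc hc' hl hl'
    exact ⟨c, p, _, m, _, hm⟩

lemma fits_of_ends {D S : List Path} (h : S.map ends = D.map ends)
    (hS : ∀ s ∈ S, s ∈ Seg N (psrc s) (ptgt s)) : Fits N D S := by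
  induction D generalizing S with
  | nil =>
    obtain rfl : S = [] := by simpa using h
    exact List.Forall₂.nil
  | cons d D ih =>
    cases S with
    | nil => simp at h
    | cons s S =>
      rw [List.map_cons, List.map_cons, List.cons.injEq] at h
      have h1 : psrc s = psrc d ∧ ptgt s = ptgt d := by simpa [ends] using h.1
      refine List.Forall₂.cons ?_ (ih h.2 fun s hs => hS s (by simp [hs]))
      rw [← h1.1, ← h1.2]
      exact hS s (by simp)

lemma fits_group {D : List Path} (h : Fits N D S) {g : List Path} (hg : g ∈ groups N S) :
    g.map ends ∈ groups N (D.map ends) ∧ Fits N (g.map ends) g := by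
  constructor
  · rw [← h.ends, groups_map_ends]
    exact List.mem_map_of_mem hg
  · refine fits_of_ends ?_ fun s hs => (h.exists_mem (mem_of_mem_groups hg hs)).1
    rw [List.map_map]
    rfl

lemma exists_isGroup_of_fits (hz : ∀ g ∈ groups N (pairs z), Passage N g)
    (h : Fits N (pairs z) S) {g : List Path} (hg : g ∈ groups N S) :
    ∃ c p l m e, IsGroup N g c p l m e := by
  obtain ⟨h1, h2⟩ := fits_group h hg
  rw [pairs_map_ends] at h1
  exact exists_isGroup (hz _ h1) h2

/-- One step of the recursion for the triangles passed through. -/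
lemma groups_succ (hX : z ∈ X c N) (hz : ∀ g ∈ groups N (pairs z), Passage N g)
    (h : Fits N (pairs z) S) : groups (N + 1) (pairs (joinPath S)) =
      (groups N S).flatMap fun g => (loopErase (joinPath g)).splitBy (sameTriangle (N + 1)) := by
  have hS := isCut_of_fits hX h
  have hw := joinPath_mem hX h
  have hG : ∀ g ∈ groups N S, ∃ c p l m e, IsGroup N g c p l m e :=
    fun g hg => exists_isGroup_of_fits hz h hg
  have hgne : ∀ g ∈ groups N S, g ≠ [] := fun g hg => List.ne_nil_of_mem_splitBy hg
  have hflat : (groups N S).flatten = gErased psrc ptgt N S := List.flatten_splitBy _ _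
  have hwalk : IsWalk (gsrc psrc) (gtgt ptgt) ptO (groups N S) ptA := by
    have := (hS.gErased N).walk
    rw [← hflat] at this
    exact ((isWalk_flatten hgne).1 this).1
  set T := (groups N S).flatMap fun g => loopErase (joinPath g) with hT
  have hTw : IsWalk psrc ptgt ptO T ptA := by
    refine isWalk_flatMap _ hwalk fun g hg => ?_
    obtain ⟨c, p, l, m, e, hg⟩ := hG g hg
    exact hg.walk.1
  have hTe : ∀ s ∈ T, s(psrc s, ptgt s) ∈ EV (N + 1) ∧ s = [psrc s, ptgt s] := by
    intro s hs
    obtain ⟨g, hg, hs⟩ := List.mem_flatMap.1 hs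
    obtain ⟨c, p, l, m, e, hg⟩ := hG g hg
    exact ⟨(hg.mem_pairs hs).1, (hg.mem_pairs hs).2.1⟩
  have hT2 : ∀ s ∈ T, s.length = 2 := by
    intro s hs
    rw [(hTe s hs).2]; rfl
  have herase : erased (N + 1) (joinPath S) = joinPath T := by
    rw [hS.erased_succ, hT, List.flatMap_def, ← joinPath_map_joinPath (p := ptO) (q := ptA),
      List.map_map]
    · congr 1
      refine List.map_congr_left fun g hg => ?_
      obtain ⟨c, p, l, m, e, hg⟩ := hG g hg
      have := hg.chain
      rw [← hg.join] at this
      rw [eraseAt_eq this hg.two_le_length]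
      rfl
    · rw [← List.flatMap_def]
      exact hTw
    · rw [← List.flatMap_def]
      exact fun s hs => (hT2 s hs).ge
    · intro b hb
      obtain ⟨g, hg, rfl⟩ := List.mem_map.1 hb
      obtain ⟨c, p, l, m, e, hg⟩ := hG g hg
      exact hg.walk.2
  have hblocks : blocks (GV (N + 1)) (joinPath T) = T := by
    rw [blocks_joinPath hTw fun s hs => isSegment_of_length (hT2 s hs) _,
      gBlocks_singletons hTw, List.map_map]
    · exact (List.map_congr_left fun s _ => rfl).trans (List.map_id _)
    · intro s hs
      have := edge_ne (hTe s hs).1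
      exact ⟨this.2.1, this.2.2.symm⟩
  have h1 := skeleton_hatQ hw
  rw [h1.2, herase, skeleton, hblocks] at h1
  rw [← h1.1, hT, splitBy_flatMap]
  · intro g hg
    obtain ⟨c, p, l, m, e, hg⟩ := hG g hg
    exact hg.walk.2
  -- The junctions of the groups are those at which the relation of lying in one triangle fails, as
  -- needed for the new triangles to stay apart.
  · have hch := List.isChain_getLast_head_splitBy (sameTriangle N) (gErased psrc ptgt N S)
    change (groups N S).IsChain _ at hch
    refine List.IsChain.imp_of_mem_imp ?_ hch
    intro g g' hg hg' hgg s hs s' hs'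
    obtain ⟨c, p, l, m, e, hg⟩ := hG g hg
    obtain ⟨c', p', l', m', e', hg'⟩ := hG g' hg'
    exact hg.not_sameTriangle hg' hgg hs hs'

lemma passage_of_group (hc : IsSimple c) (hX : z ∈ X c N) {g : List Path}
    (hg : g ∈ groups N (pairs z))
    (h : (∃ a b, g = [[a, b]]) ∨ ∃ a b d, g = [[a, b], [b, d]] ∧ a ≠ d) : Passage N g := by
  have hmem : ∀ {a b}, [a, b] ∈ g → s(a, b) ∈ EV N ∧ a ∈ z.dropLast := by
    intro a b hab
    have := mem_pairs hX.2.2.1 (mem_of_mem_groups hg hab)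
    exact ⟨this.1, this.2.1⟩
  rcases h with ⟨a, b, rfl⟩ | ⟨a, b, d, rfl, had⟩
  · obtain ⟨h1, h2⟩ := hmem (a := a) (b := b) (by simp)
    obtain ⟨t, ht, i, j, hij, rfl, rfl⟩ := exists_edge_cell h1
    exact Or.inl ⟨t, ht, i, j, hij, isInner_of_mem hc hX h2 (i := i) (by simpa using ht), rfl⟩
  · obtain ⟨h1, h2⟩ := hmem (a := a) (b := b) (by simp)
    obtain ⟨h3, h4⟩ := hmem (a := b) (b := d) (by simp)
    obtain ⟨-, -, hab⟩ := edge_ne h1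
    obtain ⟨t, ht, j, k, hjk, rfl, rfl⟩ := exists_edge_cell h3
    have hch := List.isChain_of_mem_splitBy hg
    rw [List.isChain_cons_cons] at hch
    have htri : InTriangle N a (lp N (t + corner j)) (lp N (t + corner k)) :=
      of_decide_eq_true hch.1
    obtain ⟨t', ht', i', j', -, rfl, -⟩ := exists_edge_cell h1
    rw [inTriangle_iff ht hjk] at htri
    obtain ⟨i, hi⟩ := htri
    rw [hi] at h2 had hab ⊢
    refine Or.inr ⟨t, ht, i, j, k, ?_, ?_, hjk, isInner_of_mem hc hX h2 (i := i) (by simpa using ht),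
      isInner_of_mem hc hX h4 (i := j) (by simpa using ht), rfl⟩
    · rintro rfl; exact hab rfl
    · rintro rfl; exact had rfl

/-- The loop erasure passes through each triangle in one or two steps. -/
lemma passage (hc : IsSimple c) (hX : z ∈ X c N) : ∀ g ∈ groups N (pairs z), Passage N g := by
  induction N generalizing z with
  | zero =>
    have hz := hX
    rw [X_zero hc] at hz
    obtain rfl : z = c := hz
    intro g hg
    refine passage_of_group hc hX hg ?_
    have hg' : g ∈ (pairs z).splitBy (sameTriangle 0) := hg
    rcases hc with rfl | rfl
    · left
      have : (pairs [ptO, ptA]).splitBy (sameTriangle 0) = [[[ptO, ptA]]] := by decide +kernel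
      rw [this, List.mem_singleton] at hg'
      exact ⟨_, _, hg'⟩
    · right
      have : (pairs [ptO, ptB, ptA]).splitBy (sameTriangle 0) = [[[ptO, ptB], [ptB, ptA]]] := by
        decide +kernel
      rw [this, List.mem_singleton] at hg'
      exact ⟨_, _, _, hg', by decide +kernel⟩
  | succ N ih =>
    intro g hg
    refine passage_of_group hc hX hg ?_
    obtain ⟨h1, h2, h3⟩ := exists_fits hX
    rw [← h3, groups_succ h1 (ih h1) h2] at hg
    obtain ⟨g', hg', hg⟩ := List.mem_flatMap.1 hg
    obtain ⟨c', p, l, m, e, h4⟩ := exists_isGroup_of_fits (ih h1) h2 hg'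
    exact h4.splitBy_cases hg

lemma typeCount_hatQ (h : w ∈ X c N) (j : ℕ) :
    typeCount N j (hatQ N w) = ((groups N (pairs w)).map List.length).count j := by
  rw [typeCount, (skeleton_hatQ h).1, List.count_eq_countP, List.countP_map]
  refine List.countP_congr fun g _ => ?_
  simp [beq_iff_eq]

end Groups

/-! ### The sets `W` and `V` -/

lemma cells_bound {N : ℕ} {t : ℤ × ℤ} (h : t ∈ cells {0} N) :
    0 ≤ t.1 ∧ 0 ≤ t.2 ∧ t.1 + t.2 < 2 ^ N := by
  induction N generalizing t with
  | zero =>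
    obtain rfl : t = 0 := h
    simp
  | succ N ih =>
    obtain ⟨T, hT, i, rfl⟩ := h
    obtain ⟨h1, h2, h3⟩ := ih hT
    rw [pow_succ]
    fin_cases i <;> simp [corner] <;> omega

lemma mem_G_bound {N : ℕ} {z : ℤ × ℤ} (h : lp N z ∈ G N) : 0 ≤ z.2 ∧ z.1 + z.2 ≤ 2 ^ N := by
  obtain ⟨t, ht, i, he⟩ := mem_G.1 h
  obtain rfl := lp_injective _ he
  obtain ⟨T, hT, o, ho, rfl⟩ := mem_cells.1 ht
  obtain ⟨h1, h2, h3⟩ := cells_bound hT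
  have : (0 : ℤ) < 2 ^ N := by positivity
  rcases ho with rfl | rfl <;> fin_cases i <;> simp [corner] <;> omega

/-- `F_N` and the additional copy `F'_N + b` meet in `b` only, so a path avoiding `b` cannot leave
`F_N`. -/
lemma edge_of_mem_G {N : ℕ} {p q : Pt} (h : s(p, q) ∈ EV N) (hp : p ∈ G N) (hb : p ≠ ptB) :
    s(p, q) ∈ E N ∧ q ∈ G N := by
  obtain ⟨t, ht, i, j, hij, rfl, rfl⟩ := exists_edge_cell h
  obtain ⟨T, hT, o, ho, rfl⟩ := mem_cells.1 ht
  have key : ∀ o ∈ ({(0, 0), (-1, 0)} : Set (ℤ × ℤ)), T + (2 : ℤ) ^ N • o ∈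
      cells {(0, 0), (-1, 0)} N := fun o ho => mem_cells.2 ⟨T, hT, o, ho, rfl⟩
  rcases ho with rfl | rfl | rfl
  · exact ⟨mem_E.2 ⟨_, key _ (by simp), i, j, hij, rfl⟩, mem_G.2 ⟨_, key _ (by simp), j, rfl⟩⟩
  · exact ⟨mem_E.2 ⟨_, key _ (by simp), i, j, hij, rfl⟩, mem_G.2 ⟨_, key _ (by simp), j, rfl⟩⟩
  · exfalso
    have h1 := mem_G_bound hp
    obtain ⟨h2, h3, -⟩ := cells_bound hT
    refine hb ?_
    have hz : T + (2 : ℤ) ^ N • ((1, 0) : ℤ × ℤ) + corner i = ((2 : ℤ) ^ N, 0) := by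
      fin_cases i <;> simp [corner, Prod.ext_iff] at h1 ⊢ <;> omega
    rw [hz]
    have : (2 : ℚ) ^ N ≠ 0 := by positivity
    ext <;> simp [lp, ptB, this]

lemma E_subset (N : ℕ) : E N ⊆ EV N := Finset.subset_union_left

lemma G_inter (N : ℕ) {p : Pt} (h : p ∈ G N) (h0 : p ∈ GV 0) : p ∈ G 0 := by
  obtain ⟨z, rfl⟩ : ∃ z, p = lp 0 z := by
    obtain ⟨t, -, i, rfl⟩ := mem_GV.1 h0
    exact ⟨_, rfl⟩
  have e : lp N ((2 : ℤ) ^ N • z) = lp 0 z := by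
    have : (2 : ℚ) ^ N ≠ 0 := by positivity
    ext <;> simp [lp]
  rw [← e] at h
  have hb := mem_G_bound h
  have : z.1 + z.2 ≤ 1 := by
    have h2 := hb.2
    simp only [Prod.smul_fst, Prod.smul_snd, smul_eq_mul, ← mul_add] at h2
    have : (0 : ℤ) < 2 ^ N := by positivity
    exact le_of_mul_le_mul_left (by linarith) this
  obtain ⟨t, ht, i, he⟩ := mem_GV.1 h0
  obtain rfl := lp_injective _ he
  rcases ht with rfl | rfl | rfl <;> fin_cases i <;> first
    | decide +kernel
    | (simp [corner] at this)

lemma coarse_zero_of_interior {m : Path} (hm : ∀ x ∈ m, x ∈ GV 0 → x = ptO) :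
    coarse 0 (ptO :: (m ++ [ptA])) = [ptO, ptA] ∧
      blocks (GV 0) (ptO :: (m ++ [ptA])) = [ptO :: (m ++ [ptA])] := by
  have h : blocks (GV 0) (ptO :: (m ++ [ptA])) = [ptO :: (m ++ [ptA])] := by
    rw [blocks, blocksAux_step _ _ _ _ _ [] hm, if_pos (by decide +kernel)]
    rfl
  refine ⟨?_, h⟩
  rw [coarse, h, List.map_singleton, ← List.cons_append, List.getLast?_append]
  rfl

lemma eq_cons_append {w : Path} (h : w.head? = some ptO) (h' : w.getLast? = some ptA) :
    w = ptO :: (w.tail.dropLast ++ [ptA]) ∧ w.dropLast = ptO :: w.tail.dropLast := by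
  obtain ⟨hne, h1, h2, h3⟩ := head_getLast_eq h h'
  have he := eq_psrc_interior_ptgt h3
  rw [h1, h2] at he
  refine ⟨he, ?_⟩
  conv_lhs => rw [he, ← List.cons_append, List.dropLast_concat]

/-- Coarse-graining `(O, a)` excludes all vertices of level 0 other than `O` before the end, in
particular `b`, so the larger graph `F_N^V` offers nothing new. This puts `W_N` and `V_N` in one
family. -/
lemma W_eq (N : ℕ) : W N = X [ptO, ptA] N := by
  ext w
  constructor
  · rintro ⟨h1, h2, h3, h4⟩
    have hch : w.IsChain fun p q => s(p, q) ∈ EV N := h3.imp fun a b h => E_subset N h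
    have hG : ∀ p ∈ w.dropLast, p ∈ G N := by
      intro p hp
      rw [← pairs_map_psrc] at hp
      obtain ⟨s, hs, rfl⟩ := List.mem_map.1 hp
      have := (mem_pairs h3 hs).1
      obtain ⟨t, ht, i, j, hij, he⟩ := mem_E.1 this
      rcases Sym2.eq_iff.1 he with ⟨h5, -⟩ | ⟨h5, -⟩
      · exact mem_G.2 ⟨t, ht, i, h5⟩
      · exact mem_G.2 ⟨t, ht, j, h5⟩
    have hO : ∀ p ∈ w.dropLast, p ∈ GV 0 → p = ptO := by
      intro p hp h0
      by_contra hne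
      exact h4 p hp (by simp [G_inter N (hG p hp) h0, hne])
    refine ⟨h1, h2, hch, ?_, ?_⟩
    · rintro p hp rfl
      exact absurd (hO _ hp (by decide +kernel)) (by decide +kernel)
    · obtain ⟨e1, e2⟩ := eq_cons_append h1 h2
      rw [e1]
      refine (coarse_zero_of_interior fun x hx => hO x ?_).1
      rw [e2]
      exact List.mem_cons_of_mem _ hx
  · intro hX
    obtain ⟨h1, h2, h3, h4, h5⟩ := hX
    have h0 : ∀ p ∈ w, p ∈ GV 0 → p = ptO ∨ p = ptA := by
      intro p hp hp0
      have := mem_coarse hp hp0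
      rw [h5] at this
      simpa using this
    refine ⟨h1, h2, ?_, ?_⟩
    · have hb : ∀ p ∈ w, p ≠ ptB := by
        rintro p hp rfl
        have := h0 _ hp (by decide +kernel)
        revert this
        decide +kernel
      have hO : ∀ p ∈ w.head?, p ∈ G N := by
        rw [h1]
        rintro p hp
        obtain rfl : ptO = p := by simpa using hp
        have h0 : (0 : ℤ × ℤ) ∈ cells {0} N := by
          clear * -
          induction N with
          | zero => rfl
          | succ N ih => exact ⟨0, ih, 0, rfl⟩
        refine mem_G.2 ⟨0, mem_cells.2 ⟨0, h0, (0, 0), by simp, by ext <;> simp⟩, 0, ?_⟩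
        ext <;> simp [lp, corner, ptO]
      clear h1 h2 h4 h5 h0
      induction w with
      | nil => exact List.isChain_nil
      | cons p w ih =>
        cases w with
        | nil => exact List.isChain_singleton _
        | cons q w =>
          rw [List.isChain_cons_cons] at h3 ⊢
          have := edge_of_mem_G h3.1 (hO p (by simp)) (hb p (by simp))
          refine ⟨this.1, ih h3.2 (fun p hp => hb p (by simp [hp])) ?_⟩
          simpa using this.2
    · intro p hp hmem
      simp only [Finset.mem_sdiff, Finset.mem_singleton] at hmem
      rcases h0 p (List.dropLast_subset _ hp) (Finset.subset_union_left hmem.1) with h | h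
      · exact hmem.2 h
      · exact h4 p hp h

/-! ### Probabilities -/

section Prob

variable {c w z : Path} {N : ℕ} {S : List Path}

lemma prob_joinPath {p q : Pt} {b : List Path} (u x : ℝ) (hw : IsWalk psrc ptgt p b q)
    (hseg : ∀ s ∈ b, IsSegment (GV N) s) (hits : ∀ s ∈ b, ptgt s ∈ GV N ∧ ptgt s ≠ psrc s)
    (hne : b ≠ []) (hp : p ∈ GV N) :
    prob u x (N + 1) (joinPath b) =
      prob u x N (joinPath (b.map ends)) * (b.map (segWeight u x N)).prod := by
  have h1 : blocks (GV N) (joinPath b) = b := by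
    rw [blocks_joinPath hw hseg, gBlocks_singletons hw hits, List.map_map]
    exact (List.map_congr_left fun s _ => rfl).trans (List.map_id b)
  have hw' : IsWalk psrc ptgt p (b.map ends) q :=
    (isWalk_map (fun _ => rfl) (fun _ => rfl) _ _ _).2 hw
  have h2 : coarse N (joinPath b) = joinPath (b.map ends) := by
    rw [coarse_joinPath hw hseg hne hp, gBlocks_singletons hw hits,
      joinPath_eq' hw' (by simp [ends]) (by simpa using hne), List.map_map, List.flatMap_map]
    simp [ends, Function.comp_def, List.map_eq_flatMap]
  rw [prob, h1, h2]

/-- The recursion for `prob` holds on each segment of level 0, and the product over these segments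
inherits it. So `prob'` obeys one recursion for both starting types. -/
lemma prob'_joinPath (u x : ℝ) (hz : z ∈ X c N) (h : Fits N (pairs z) S) :
    prob' u x (N + 1) (joinPath S) = prob' u x N z * (S.map (segWeight u x N)).prod := by
  have hS := isCut_of_fits hz h
  have hE := hS.ends
  have hB := gBlocks_isBlock (A := GV 0) hS.walk (ptO_mem 0)
  have hflat := hS.gBlocks_flatten 0
  have hmem : ∀ b ∈ gBlocks psrc ptgt (GV 0) S, ∀ s ∈ b, s ∈ S := fun b hb s hs => by
    rw [← hflat]; exact List.mem_flatten.2 ⟨b, hb, hs⟩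
  have h1 : blocks (GV 0) (joinPath S) = (gBlocks psrc ptgt (GV 0) S).map joinPath :=
    blocks_joinPath hS.walk fun s hs => (hS.seg s hs).mono (GV_mono (Nat.zero_le N))
  have h2 : blocks (GV 0) z =
      (gBlocks psrc ptgt (GV 0) S).map fun b => joinPath (b.map ends) := by
    conv_lhs => rw [← (coarse_of_fits hz h).1]
    rw [blocks_joinPath hE.walk fun s hs => (hE.seg s hs).mono (GV_mono (Nat.zero_le N)),
      gBlocks_map (f := ends) (src := psrc) (tgt := ptgt) (fun _ => rfl) (fun _ => rfl),
      List.map_map]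
    rfl
  rw [prob', prob', h1, h2, List.map_map, List.map_map]
  have h3 : (S.map (segWeight u x N)).prod = ((gBlocks psrc ptgt (GV 0) S).map fun b =>
      (b.map (segWeight u x N)).prod).prod := by
    conv_lhs => rw [← hflat, List.map_flatten, List.prod_flatten, List.map_map]
    rfl
  rw [h3, ← List.prod_map_mul]
  congr 1
  refine List.map_congr_left fun b hb => ?_
  exact prob_joinPath u x (hB b hb).walk (fun s hs => hS.seg s (hmem b hb s hs))
    (fun s hs => hS.hits s (hmem b hb s hs)) (hB b hb).ne_nil
    (GV_mono (Nat.zero_le N) (hB b hb).src_mem)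

lemma prob'_eq_prob (u x : ℝ) (hw : w ∈ X [ptO, ptA] N) : prob' u x N w = prob u x N w := by
  obtain ⟨e1, e2⟩ := eq_cons_append hw.1 hw.2.1
  have : blocks (GV 0) w = [w] := by
    rw [e1]
    refine (coarse_zero_of_interior fun y hy h0 => ?_).2
    have hy : y ∈ w.dropLast := by rw [e2]; exact List.mem_cons_of_mem _ hy
    have := mem_coarse (List.dropLast_subset _ hy) h0
    rw [hw.2.2.2.2] at this
    have h3 := hw.2.2.2.1 y hy
    simpa [h3] using this
  rw [prob', this]
  simp

lemma prob'_zero (u x : ℝ) (w : Path) : prob' u x 0 w = 1 := by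
  simp [prob', prob]

lemma segWeight_nonneg {u x : ℝ} (hu : 0 ≤ u) (hx : 0 ≤ x) (N : ℕ) (s : Path) :
    0 ≤ segWeight u x N s := by unfold segWeight; positivity

lemma prob_nonneg {u x : ℝ} (hu : 0 ≤ u) (hx : 0 ≤ x) (N : ℕ) (w : Path) : 0 ≤ prob u x N w := by
  induction N generalizing w with
  | zero => exact zero_le_one
  | succ N ih =>
    refine mul_nonneg (ih _) (List.prod_nonneg ?_)
    simp only [List.forall_mem_map]
    exact fun s _ => segWeight_nonneg hu hx N s

lemma prob'_nonneg {u x : ℝ} (hu : 0 ≤ u) (hx : 0 ≤ x) (N : ℕ) (w : Path) :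
    0 ≤ prob' u x N w := by
  refine List.prod_nonneg ?_
  simp only [List.forall_mem_map]
  exact fun s _ => prob_nonneg hu hx N s

lemma tsum_X_succ (c : Path) (N : ℕ) (f : Path → ENNReal) :
    ∑' w : X c (N + 1), f w = ∑' z : X c N, ∑' S : {S // Fits N (pairs z) S}, f (joinPath S) := by
  let e : (Σ z : X c N, {S // Fits N (pairs z) S}) → X c (N + 1) :=
    fun a => ⟨joinPath a.2.1, joinPath_mem a.1.2 a.2.2⟩
  have he : Function.Bijective e := by
    constructor
    · rintro ⟨⟨z, hz⟩, ⟨S, hS⟩⟩ ⟨⟨z', hz'⟩, ⟨S', hS'⟩⟩ heq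
      have h : joinPath S = joinPath S' := congrArg Subtype.val heq
      clear heq
      obtain ⟨-, h1, h2⟩ := coarse_of_fits hz hS
      obtain ⟨-, h3, h4⟩ := coarse_of_fits hz' hS'
      obtain rfl : z = z' := by rw [← h1, ← h3, h]
      obtain rfl : S = S' := by rw [← h2, ← h4, h]
      rfl
    · rintro ⟨w, hw⟩
      obtain ⟨h1, h2, h3⟩ := exists_fits hw
      exact ⟨⟨⟨_, h1⟩, ⟨_, h2⟩⟩, Subtype.ext h3⟩
  rw [← (Equiv.ofBijective e he).tsum_eq, ENNReal.tsum_sigma']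
  rfl

end Prob

/-! ### Sums over refinements -/

/-- The weighted sum over the refinements of a list of steps. -/
noncomputable def lsum (wt : Path → ENNReal) (N : ℕ) :
    List Path → (List Path → ENNReal) → ENNReal
  | [], f => f []
  | d :: D, f => ∑' s : Seg N (psrc d) (ptgt d), wt s * lsum wt N D fun S => f (s :: S)

section Lsum

variable {wt : Path → ENNReal} {N : ℕ}

lemma tsum_fits (D : List Path) (f : List Path → ENNReal) :
    ∑' S : {S // Fits N D S}, (S.1.map wt).prod * f S = lsum wt N D f := by
  induction D generalizing f with
  | nil =>
    rw [tsum_eq_single ⟨[], List.Forall₂.nil⟩]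
    · simp [lsum]
    · rintro ⟨S, hS⟩ h
      obtain rfl := List.forall₂_nil_left_iff.1 hS
      exact absurd rfl h
  | cons d D ih =>
    let e : Seg N (psrc d) (ptgt d) × {S // Fits N D S} → {S // Fits N (d :: D) S} :=
      fun a => ⟨a.1.1 :: a.2.1, List.Forall₂.cons a.1.2 a.2.2⟩
    have he : Function.Bijective e := by
      constructor
      · rintro ⟨⟨s, hs⟩, ⟨S, hS⟩⟩ ⟨⟨s', hs'⟩, ⟨S', hS'⟩⟩ h
        have h : s :: S = s' :: S' := congrArg Subtype.val h
        obtain ⟨rfl, rfl⟩ := List.cons.inj h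
        rfl
      · rintro ⟨S, hS⟩
        obtain ⟨s, S', hs, hS', rfl⟩ := List.forall₂_cons_left_iff.1 hS
        exact ⟨⟨⟨s, hs⟩, ⟨S', hS'⟩⟩, rfl⟩
    rw [← (Equiv.ofBijective e he).tsum_eq, ENNReal.tsum_prod', lsum]
    refine tsum_congr fun s => ?_
    rw [← ih, ← ENNReal.tsum_mul_left]
    refine tsum_congr fun S => ?_
    simp [e, mul_assoc]

lemma lsum_congr {D : List Path} {f f' : List Path → ENNReal}
    (h : ∀ S, Fits N D S → f S = f' S) : lsum wt N D f = lsum wt N D f' := by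
  induction D generalizing f f' with
  | nil => exact h _ List.Forall₂.nil
  | cons d D ih =>
    refine tsum_congr fun s => ?_
    rw [ih fun S hS => h _ (List.Forall₂.cons s.2 hS)]

lemma lsum_append (D D' : List Path) (f : List Path → ENNReal) :
    lsum wt N (D ++ D') f = lsum wt N D fun S => lsum wt N D' fun S' => f (S ++ S') := by
  induction D generalizing f with
  | nil => rfl
  | cons d D ih => exact tsum_congr fun s => congrArg _ (ih _)

lemma lsum_mul_left (D : List Path) (a : ENNReal) (f : List Path → ENNReal) :
    (lsum wt N D fun S => a * f S) = a * lsum wt N D f := by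
  induction D generalizing f with
  | nil => rfl
  | cons d D ih =>
    rw [lsum, lsum, ← ENNReal.tsum_mul_left]
    exact tsum_congr fun s => by rw [ih, mul_left_comm]

lemma lsum_mul_right (D : List Path) (a : ENNReal) (f : List Path → ENNReal) :
    (lsum wt N D fun S => f S * a) = lsum wt N D f * a := by
  simp_rw [mul_comm _ a, lsum_mul_left]

/-- Segments on which the function does not depend are summed out, each contributing the factor one.
In the application they are the segments removed with the larger loops. -/
lemma lsum_sel {D : List Path} (hD : ∀ d ∈ D, ∑' s : Seg N (psrc d) (ptgt d), wt s = 1)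
    (J : List ℕ) (k : ℕ) (f : List Path → ENNReal) :
    (lsum wt N D fun S => f (sel J k S)) = lsum wt N (sel J k D) f := by
  induction D generalizing k f with
  | nil => rfl
  | cons d D ih =>
    have ih := ih fun d hd => hD d (by simp [hd])
    rw [lsum, sel]
    split_ifs with hk
    · refine tsum_congr fun s => ?_
      simp only [sel, if_pos hk]
      rw [ih (k + 1) fun S => f (s :: S)]
    · simp only [sel, if_neg hk]
      rw [ENNReal.tsum_mul_right, hD d (by simp), one_mul, ih]

lemma mem_getLast?_of_ends {D S : List Path} (h : S.map ends = D.map ends) {s : Path}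
    (hs : s ∈ S.getLast?) : ∃ d ∈ D.getLast?, ends d = ends s := by
  have h1 : ends s ∈ (S.map ends).getLast? := by
    rw [List.getLast?_map, Option.mem_def, Option.mem_def.1 hs]; rfl
  rw [h, List.getLast?_map] at h1
  exact Option.mem_map.1 h1

lemma mem_head?_of_ends {D S : List Path} (h : S.map ends = D.map ends) {s : Path}
    (hs : s ∈ S.head?) : ∃ d ∈ D.head?, ends d = ends s := by
  have h1 : ends s ∈ (S.map ends).head? := by
    rw [List.head?_map, Option.mem_def, Option.mem_def.1 hs]; rfl
  rw [h, List.head?_map] at h1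
  exact Option.mem_map.1 h1

lemma sameTriangle_congr {s s' t t' : Path} (hs : ends s = ends s') (ht : ends t = ends t') :
    sameTriangle N s t = sameTriangle N s' t' := by
  change sameTriangle N (ends s) (ends t) = sameTriangle N (ends s') (ends t')
  rw [hs, ht]

/-- The sums over the refinements in different triangles are independent. -/
lemma lsum_splitBy {L : List (List Path)} (hne : ∀ g ∈ L, g ≠ [])
    (hsame : ∀ g ∈ L, g.IsChain fun s t => sameTriangle N s t = true)
    (hch : L.IsChain fun g g' => ∃ (ha : g ≠ []) (hb : g' ≠ []),
      sameTriangle N (g.getLast ha) (g'.head hb) = false) (Ψ : List Path → ENNReal) :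
    (lsum wt N L.flatten fun S => ((S.splitBy (sameTriangle N)).map Ψ).prod) =
      (L.map fun g => lsum wt N g Ψ).prod := by
  induction L with
  | nil => simp [lsum]
  | cons g L ih =>
    rw [List.flatten_cons, lsum_append, List.map_cons, List.prod_cons,
      ← ih (fun g hg => hne g (by simp [hg])) (fun g hg => hsame g (by simp [hg])) hch.tail,
      ← lsum_mul_right]
    refine lsum_congr fun S hS => ?_
    rw [← lsum_mul_left]
    refine lsum_congr fun S' hS' => ?_
    have hSne : S ≠ [] := by
      rintro rfl
      have := hS.ends
      simp only [List.map_nil] at this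
      exact hne g (by simp) (List.map_eq_nil_iff.1 this.symm)
    have hSch : S.IsChain fun s t => sameTriangle N s t = true := by
      have key : ∀ S : List Path, (S.map ends).IsChain (fun s t => sameTriangle N s t = true) ↔
          S.IsChain fun s t => sameTriangle N s t = true := fun S => List.isChain_map _
      rw [← key, hS.ends, key]
      exact hsame g (by simp)
    -- Refinement keeps the end points of the steps, hence the grouping: `S` is one group and is
    -- separated from what follows.
    rw [List.splitBy_append, List.splitBy_of_isChain hSne hSch]
    · simp
    · intro s hs t ht
      obtain ⟨d, hd, hds⟩ := mem_getLast?_of_ends hS.ends hs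
      obtain ⟨d', hd', hdt⟩ := mem_head?_of_ends hS'.ends ht
      cases L with
      | nil => simp at hd'
      | cons g' L =>
        rw [List.isChain_cons_cons] at hch
        obtain ⟨ha, hb, h⟩ := hch.1
        rw [List.flatten_cons, List.head?_append_of_ne_nil _ hb, List.head?_eq_some_head hb] at hd'
        rw [List.getLast?_eq_some_getLast ha] at hd
        obtain rfl : g.getLast ha = d := by simpa using hd
        obtain rfl : g'.head hb = d' := by simpa using hd'
        rw [← h]
        exact sameTriangle_congr hds.symm hdt.symm

end Lsum

/-! ### Generating functions -/

/-- The monomial belonging to a list of numbers of steps. -/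
noncomputable def mono (x y : ENNReal) (L : List ℕ) : ENNReal := x ^ L.count 1 * y ^ L.count 2

lemma mono_append (x y : ENNReal) (L L' : List ℕ) :
    mono x y (L ++ L') = mono x y L * mono x y L' := by
  simp only [mono, List.count_append, pow_add]
  ring

lemma mono_flatMap {α : Type*} (x y : ENNReal) (L : List α) (f : α → List ℕ) :
    mono x y (L.flatMap f) = (L.map fun a => mono x y (f a)).prod := by
  induction L with
  | nil => simp [mono]
  | cons a L ih => rw [List.flatMap_cons, mono_append, ih, List.map_cons, List.prod_cons]

section Gen

variable (u ξ : ℝ)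

/-- The generating function of the numbers of triangles for paths in one triangle. -/
noncomputable def gen₁ (x y : ENNReal) : ENNReal :=
  ∑' l : SegL false, ENNReal.ofReal (wtL u ξ l) * mono x y (shapeL l)

/-- The generating function of the numbers of triangles for pairs of paths in one triangle. -/
noncomputable def gen₂ (x y : ENNReal) : ENNReal :=
  ∑' l₁ : SegL false, ENNReal.ofReal (wtL u ξ l₁) * ∑' l₂ : SegL true,
    ENNReal.ofReal (wtL u ξ l₂) * mono x y (shapeL (l₁.1.dropLast ++ l₂.1))

variable {u ξ} {N : ℕ}

/-- Transfers sums over segments to sums over label sequences, where weights no longer depend on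
place, scale or orientation. -/
lemma tsum_seg {c : Config} {p : ℤ × ℤ} {s : Bool} (h : c.IsAt N p s) (f : Path → ENNReal) :
    ∑' a : Seg N (c.emb N p (startL s)) (c.emb N p (endL s)),
      ENNReal.ofReal (segWeight u ξ N a) * f a =
    ∑' l : SegL s, ENNReal.ofReal (wtL u ξ l) * f (l.1.map (c.emb N p)) := by
  rw [h.seg_eq, tsum_image (fun a => ENNReal.ofReal (segWeight u ξ N a) * f a)
    (List.map_injective_iff.2 Config.emb_injective).injOn]
  refine tsum_congr fun l => ?_
  obtain ⟨m, -, hch, -⟩ := l.2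
  rw [Config.segWeight_map h.mem_first u ξ hch]

/-- The type of the triangle alone decides the law of its offspring; `D.length` is 1 or 2, and the
monomial picks `gen₁` or `gen₂`. -/
lemma lsum_passage {D : List Path} (hD : Passage N D) (x y : ENNReal) :
    lsum (fun s => ENNReal.ofReal (segWeight u ξ N s)) N D
      (fun g => mono x y (shape N (joinPath g))) =
    mono (gen₁ u ξ x y) (gen₂ u ξ x y) [D.length] := by
  rcases hD with ⟨t, ht, i, j, hij, hi, rfl⟩ | ⟨t, ht, i, j, k, hij, hik, hjk, hi, hj, rfl⟩
  · obtain ⟨c, p, hc, hP, hQ⟩ := exists_config₁ ht hij hi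
    have e1 : mono (gen₁ u ξ x y) (gen₂ u ξ x y)
        [[[lp N (t + corner i), lp N (t + corner j)]].length] = gen₁ u ξ x y := by
      simp [mono]
    rw [e1, lsum, psrc_pair, ptgt_pair, ← hP, ← hQ]
    refine (tsum_seg hc fun s => mono x y (shape N (joinPath [s]))).trans ?_
    refine tsum_congr fun l => ?_
    obtain ⟨m, hm⟩ := isGroup_one hc l.2
    rw [hm.shape_eq]
  · obtain ⟨c, p, hc, hc', hP, hQ, hR⟩ := exists_config₂ ht hij hik hjk hi hj
    have e1 : mono (gen₁ u ξ x y) (gen₂ u ξ x y)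
        [[[lp N (t + corner i), lp N (t + corner j)],
          [lp N (t + corner j), lp N (t + corner k)]].length] = gen₂ u ξ x y := by
      simp [mono]
    rw [e1, lsum, psrc_pair, ptgt_pair, ← hP, ← hQ]
    refine (tsum_seg hc fun s => lsum _ N _ fun S => mono x y (shape N (joinPath (s :: S)))).trans ?_
    refine tsum_congr fun l => ?_
    congr 1
    rw [lsum, psrc_pair, ptgt_pair, ← hR]
    refine (tsum_seg hc' fun s => mono x y (shape N (joinPath [l.1.map (c.emb N p), s]))).trans ?_
    refine tsum_congr fun l' => ?_
    obtain ⟨m, hm⟩ := isGroup_two hc hc' l.2 l'.2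
    rw [hm.shape_eq]

lemma W_one_eq : W 1 = Seg 0 ptO ptA := by
  have hc : IsSimple [ptO, ptA] := Or.inl rfl
  have hX : [ptO, ptA] ∈ X [ptO, ptA] 0 := by rw [X_zero hc]; rfl
  rw [W_eq]
  ext w
  constructor
  · intro hw
    obtain ⟨h1, h2, h3⟩ := exists_fits hw
    rw [hw.2.2.2.2] at h2
    obtain ⟨s, S, hs, hS, he⟩ := List.forall₂_cons_left_iff.1 h2
    obtain rfl := List.forall₂_nil_left_iff.1 hS
    rw [he] at h3
    rw [← h3]
    exact hs
  · intro hw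
    exact joinPath_mem (S := [w]) hX (List.Forall₂.cons hw List.Forall₂.nil)

lemma isInner_corner_zero : IsInner 0 ((0, 0) + corner 0) :=
  ⟨2, by simp [corner, base, cells, Fin.forall_fin_succ, Prod.ext_iff]⟩

lemma tsum_W_one (hξ : IsFixedPoint u ξ) (hu : 0 ≤ u) :
    ∑' w : W 1, ENNReal.ofReal (segWeight u ξ 0 w) = 1 := by
  have h1 : HasSum (fun w : W 1 => segWeight u ξ 0 w) 1 := by
    -- Dividing the fixed point equation by ξ turns the exponent `ℓ(w)` into `ℓ(w) - 1`.
    have := hξ.2.mul_left ξ⁻¹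
    rw [inv_mul_cancel₀ hξ.1.ne'] at this
    refine this.congr_fun fun w => ?_
    have h2 := (head_getLast_eq w.2.1 w.2.2.1).2.2.2
    obtain ⟨n, hn⟩ : ∃ n, steps w.1 = n + 1 := ⟨steps w.1 - 1, by unfold steps; omega⟩
    have := hξ.1.ne'
    rw [segWeight, hn, Nat.add_sub_cancel]
    field_simp
    ring
  rw [← ENNReal.ofReal_tsum_of_nonneg (f := fun w : W 1 => segWeight u ξ 0 w)
    (fun w => segWeight_nonneg hu hξ.1.le 0 w) h1.summable, h1.tsum_eq, ENNReal.ofReal_one]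

/-- The weights of the segments between two neighbours sum up to one. -/
lemma tsum_seg_eq_one (hξ : IsFixedPoint u ξ) (hu : 0 ≤ u) {t : ℤ × ℤ} (ht : t ∈ cells base N)
    {i j : Fin 3} (hij : i ≠ j) (hi : IsInner N (t + corner i)) :
    ∑' s : Seg N (lp N (t + corner i)) (lp N (t + corner j)),
      ENNReal.ofReal (segWeight u ξ N s) = 1 := by
  -- The sum is the same for all edges starting at inner vertices, so it is evaluated on the edge
  -- from `O` to `a`, where it is the sum over `W_1`.
  have key : ∀ {N : ℕ} {t : ℤ × ℤ} {i j : Fin 3}, t ∈ cells base N → i ≠ j →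
      IsInner N (t + corner i) → ∑' s : Seg N (lp N (t + corner i)) (lp N (t + corner j)),
      ENNReal.ofReal (segWeight u ξ N s) = ∑' l : SegL false, ENNReal.ofReal (wtL u ξ l) := by
    intro N t i j ht hij hi
    obtain ⟨c, p, hc, hP, hQ⟩ := exists_config₁ ht hij hi
    have := tsum_seg (u := u) (ξ := ξ) hc fun _ => 1
    simp only [mul_one] at this
    rw [← hP, ← hQ]
    exact this
  rw [key ht hij hi, ← tsum_W_one hξ hu, W_one_eq]
  have := key (N := 0) (t := (0, 0)) (i := 0) (j := 2) (Or.inl rfl) (by decide)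
    isInner_corner_zero
  rw [← this]
  have e0 : lp 0 ((0, 0) + corner 0) = ptO := by decide +kernel
  have e2 : lp 0 ((0, 0) + corner 2) = ptA := by decide +kernel
  rw [e0, e2]

variable (u ξ) in
/-- The generating function of the numbers of triangles of Type 1 and 2 at level `N`. -/
noncomputable def gen (c : Path) (N : ℕ) (x y : ENNReal) : ENNReal :=
  ∑' w : X c N, ENNReal.ofReal (prob' u ξ N w) *
    mono x y ((groups N (pairs w)).map List.length)

/-- The branching property: conditionally on the path of level `N`, the triangles of its loop
erasure have independent offspring with laws given by their types. -/
lemma gen_succ (hξ : IsFixedPoint u ξ) (hu : 0 ≤ u) {c : Path} (hc : IsSimple c) (N : ℕ)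
    (x y : ENNReal) :
    gen u ξ c (N + 1) x y = gen u ξ c N (gen₁ u ξ x y) (gen₂ u ξ x y) := by
  rw [gen, tsum_X_succ c N fun w => ENNReal.ofReal (prob' u ξ (N + 1) w) *
    mono x y ((groups (N + 1) (pairs w)).map List.length)]
  refine tsum_congr fun z => ?_
  obtain ⟨z, hz⟩ := z
  have hpass := passage hc hz
  set wt : Path → ENNReal := fun s => ENNReal.ofReal (segWeight u ξ N s) with hwt
  set Ψ : List Path → ENNReal := fun g => mono x y (shape N (joinPath g)) with hΨ
  have h1 : ∀ S : {S // Fits N (pairs z) S}, ENNReal.ofReal (prob' u ξ (N + 1) (joinPath S.1)) *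
      mono x y ((groups (N + 1) (pairs (joinPath S.1))).map List.length) =
      ENNReal.ofReal (prob' u ξ N z) * ((S.1.map wt).prod * ((groups N S.1).map Ψ).prod) := by
    rintro ⟨S, hS⟩
    have e1 : ENNReal.ofReal ((S.map (segWeight u ξ N)).prod) = (S.map wt).prod := by
      clear hS
      induction S with
      | nil => simp
      | cons s S ih =>
        rw [List.map_cons, List.prod_cons, ENNReal.ofReal_mul (segWeight_nonneg hu hξ.1.le N s), ih,
          List.map_cons, List.prod_cons]
    rw [prob'_joinPath u ξ hz hS, ENNReal.ofReal_mul (prob'_nonneg hu hξ.1.le N z), e1,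
      groups_succ hz hpass hS, List.map_flatMap, mono_flatMap, mul_assoc]
    rfl
  rw [tsum_congr h1, ENNReal.tsum_mul_left]
  congr 1
  have hmass : ∀ d ∈ pairs z, ∑' s : Seg N (psrc d) (ptgt d), wt s = 1 := by
    intro d hd
    obtain ⟨h2, h3, -⟩ := mem_pairs hz.2.2.1 hd
    obtain ⟨t, ht, i, j, hij, e1, e2⟩ := exists_edge_cell h2
    rw [e1] at h3
    rw [e1, e2]
    exact tsum_seg_eq_one hξ hu ht hij (isInner_of_mem hc hz h3 (i := i) (by simpa using ht))
  -- The indices of the surviving segments are functions of `z` alone, not of the refinement `S`.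
  have hsel : ∀ S, Fits N (pairs z) S →
      groups N S = (sel (keptIdx N (pairs z)) 0 S).splitBy (sameTriangle N) := by
    intro S hS
    rw [groups, gErased_eq_sel, hS.ends_pairs]
  have hsel' : sel (keptIdx N (pairs z)) 0 (pairs z) = (groups N (pairs z)).flatten := by
    have := gErased_eq_sel N (pairs z)
    rw [pairs_map_ends] at this
    rw [← this]
    exact (List.flatten_splitBy _ _).symm
  rw [tsum_fits (pairs z) fun S => ((groups N S).map Ψ).prod,
    lsum_congr fun S hS => by rw [hsel S hS],
    lsum_sel hmass (keptIdx N (pairs z)) 0 fun S => ((S.splitBy (sameTriangle N)).map Ψ).prod,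
    hsel', lsum_splitBy (L := groups N (pairs z)) (fun g hg => List.ne_nil_of_mem_splitBy hg)
      (fun g hg => List.isChain_of_mem_splitBy hg) (List.isChain_getLast_head_splitBy _ _),
    List.map_congr_left fun g hg => lsum_passage (hpass g hg) x y, ← mono_flatMap,
    List.map_eq_flatMap]

lemma gen_zero (x y : ENNReal) :
    gen u ξ [ptO, ptA] 0 x y = x ∧ gen u ξ [ptO, ptB, ptA] 0 x y = y := by
  have key : ∀ c : Path, IsSimple c → gen u ξ c 0 x y =
      mono x y ((groups 0 (pairs c)).map List.length) := by
    intro c hc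
    have hX := X_zero hc
    rw [gen, tsum_eq_single ⟨c, by rw [hX]; rfl⟩]
    · simp [prob'_zero]
    · rintro ⟨w, hw⟩ h
      rw [hX] at hw
      exact absurd (Subtype.ext (Set.mem_singleton_iff.1 hw)) h
  have e1 : groups 0 (pairs [ptO, ptA]) = [[[ptO, ptA]]] := by
    change (pairs [ptO, ptA]).splitBy (sameTriangle 0) = _
    decide +kernel
  have e2 : groups 0 (pairs [ptO, ptB, ptA]) = [[[ptO, ptB], [ptB, ptA]]] := by
    change (pairs [ptO, ptB, ptA]).splitBy (sameTriangle 0) = _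
    decide +kernel
  rw [key _ (Or.inl rfl), key _ (Or.inr rfl), e1, e2]
  simp [mono]

end Gen

/-! ### The offspring distributions -/

/-- The numbers of triangles of Type 1 and 2. -/
def types (N : ℕ) (w : Path) : ℕ × ℕ :=
  (((groups N (pairs w)).map List.length).count 1, ((groups N (pairs w)).map List.length).count 2)

/-- The possible numbers of triangles of Type 1 and 2 at level `1`. -/
def range₁ : Finset (ℕ × ℕ) :=
  (Finset.range 13 ×ˢ Finset.range 13).filter fun k => 2 ≤ k.1 + k.2

lemma count_add_count {L : List ℕ} (h : ∀ n ∈ L, n = 1 ∨ n = 2) :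
    L.count 1 + L.count 2 = L.length := by
  induction L with
  | nil => rfl
  | cons n L ih =>
    have := ih fun n hn => h n (by simp [hn])
    rcases h n (by simp) with rfl | rfl <;> simp <;> omega

/-- At level 0 there is a single triangle, so the whole path forms one group and the bounds on
shapes apply. -/
lemma types_mem {c w : Path} (hc : IsSimple c) (hw : w ∈ X c 1) : types 1 w ∈ range₁ := by
  obtain ⟨h1, h2, h3⟩ := exists_fits hw
  set S := blocks (GV 0) w
  have hpass := passage hc h1
  have hz : coarse 0 w = c := hw.2.2.2.2
  rw [hz] at h1 h2 hpass
  obtain ⟨D, hD⟩ : ∃ D, groups 0 (pairs c) = [D] := by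
    have e1 : groups 0 (pairs [ptO, ptA]) = [[[ptO, ptA]]] := by
      change (pairs [ptO, ptA]).splitBy (sameTriangle 0) = _
      decide +kernel
    have e2 : groups 0 (pairs [ptO, ptB, ptA]) = [[[ptO, ptB], [ptB, ptA]]] := by
      change (pairs [ptO, ptB, ptA]).splitBy (sameTriangle 0) = _
      decide +kernel
    rcases hc with rfl | rfl
    · exact ⟨_, e1⟩
    · exact ⟨_, e2⟩
  have hlen : (groups 0 S).length = 1 := by
    have := groups_map_ends 0 S
    rw [h2.ends_pairs, hD] at this
    have := congrArg List.length this
    simpa using this.symm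
  obtain ⟨g, hg⟩ := List.length_eq_one_iff.1 hlen
  obtain ⟨c', p, l, m, e, hG⟩ := exists_isGroup_of_fits hpass h2 (g := g) (by rw [hg]; simp)
  have hL : (groups 1 (pairs w)).map List.length = shapeL l := by
    rw [← h3, groups_succ h1 hpass h2, hg, List.flatMap_singleton]
    exact hG.shape_eq
  have hsum := count_add_count (L := shapeL l) fun n hn => hG.route.mem_shapeL hn
  have hle := IsRoute.length_shapeL_le l
  have hge := hG.route.two_le_length_shapeL
  simp only [range₁, Finset.mem_filter, Finset.mem_product, Finset.mem_range, types, hL]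
  omega

section Coef

variable (u ξ : ℝ)

/-- The probability of given numbers of triangles of Type 1 and 2. -/
noncomputable def coef (c : Path) (k : ℕ × ℕ) : ENNReal :=
  ∑' w : X c 1, if types 1 w = k then ENNReal.ofReal (prob' u ξ 1 w) else 0

variable {u ξ}

lemma tsum_eq_sum_coef {c : Path} (hc : IsSimple c) (φ : ℕ × ℕ → ENNReal) :
    ∑' w : X c 1, ENNReal.ofReal (prob' u ξ 1 w) * φ (types 1 w) =
      ∑ k ∈ range₁, coef u ξ c k * φ k := by
  simp only [coef, ← ENNReal.tsum_mul_right]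
  rw [← Summable.tsum_finsetSum fun _ _ => ENNReal.summable]
  refine tsum_congr fun w => ?_
  rw [Finset.sum_eq_single (types 1 w.1)]
  · simp
  · intro k _ hk
    rw [if_neg hk.symm, zero_mul]
  · exact fun h => absurd (types_mem hc w.2) h

lemma gen_eq_tsum (c : Path) (N : ℕ) (x y : ENNReal) : gen u ξ c N x y =
    ∑' w : X c N, ENNReal.ofReal (prob' u ξ N w) * (x ^ (types N w).1 * y ^ (types N w).2) := rfl

lemma gen_one_eq_sum {c : Path} (hc : IsSimple c) (x y : ENNReal) :
    gen u ξ c 1 x y = ∑ k ∈ range₁, coef u ξ c k * (x ^ k.1 * y ^ k.2) :=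
  tsum_eq_sum_coef hc fun k => x ^ k.1 * y ^ k.2

lemma gen_one (hξ : IsFixedPoint u ξ) (hu : 0 ≤ u) (x y : ENNReal) :
    gen u ξ [ptO, ptA] 1 x y = gen₁ u ξ x y ∧ gen u ξ [ptO, ptB, ptA] 1 x y = gen₂ u ξ x y := by
  rw [gen_succ hξ hu (Or.inl rfl), gen_succ hξ hu (Or.inr rfl)]
  exact ⟨(gen_zero _ _).1, (gen_zero _ _).2⟩

lemma isInner_corner_one : IsInner 0 ((0, 0) + corner 1) :=
  ⟨2, by simp [corner, base, cells, Fin.forall_fin_succ, Prod.ext_iff]⟩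

lemma gen_one_one (hξ : IsFixedPoint u ξ) (hu : 0 ≤ u) :
    gen₁ u ξ 1 1 = 1 ∧ gen₂ u ξ 1 1 = 1 := by
  have hm : ∀ L, mono 1 1 L = 1 := fun L => by simp [mono]
  have ht : ((0, 0) : ℤ × ℤ) ∈ cells base 0 := Or.inl rfl
  obtain ⟨c, p, hc, hc', hP, hQ, hR⟩ := exists_config₂ (i := 0) (j := 1) (k := 2) ht (by decide)
    (by decide) (by decide) isInner_corner_zero isInner_corner_one
  have e1 := tsum_seg_eq_one (N := 0) hξ hu ht (i := 0) (j := 1) (by decide) isInner_corner_zero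
  have e2 := tsum_seg_eq_one (N := 0) hξ hu ht (i := 1) (j := 2) (by decide) isInner_corner_one
  rw [← hP, ← hQ] at e1
  rw [← hQ, ← hR] at e2
  have k1 := tsum_seg (u := u) (ξ := ξ) hc fun _ => 1
  have k2 := tsum_seg (u := u) (ξ := ξ) hc' fun _ => 1
  simp only [mul_one] at k1 k2
  have k1 := k1.symm.trans e1
  have k2 := k2.symm.trans e2
  simp only [gen₁, gen₂, hm, mul_one, k1, k2, and_self]

lemma sum_coef (hξ : IsFixedPoint u ξ) (hu : 0 ≤ u) {c : Path} (hc : IsSimple c) :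
    ∑ k ∈ range₁, coef u ξ c k = 1 := by
  have h := gen_one_eq_sum (u := u) (ξ := ξ) hc 1 1
  simp only [one_pow, mul_one] at h
  rw [← h]
  rcases hc with rfl | rfl
  · rw [(gen_one hξ hu 1 1).1, (gen_one_one hξ hu).1]
  · rw [(gen_one hξ hu 1 1).2, (gen_one_one hξ hu).2]

lemma prob_pos (hu : 0 < u) (hξ : 0 < ξ) (N : ℕ) (w : Path) : 0 < prob u ξ N w := by
  induction N generalizing w with
  | zero => exact zero_lt_one
  | succ N ih =>
    refine mul_pos (ih _) (List.prod_pos ?_)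
    simp only [List.forall_mem_map]
    intro s _
    unfold segWeight
    positivity

lemma coef_pos (hu : 0 < u) (hξ : 0 < ξ) {c w : Path} (hw : w ∈ X c 1) :
    0 < coef u ξ c (types 1 w) := by
  have h : 0 < ENNReal.ofReal (prob' u ξ 1 w) := by
    refine ENNReal.ofReal_pos.2 (List.prod_pos ?_)
    simp only [List.forall_mem_map]
    exact fun s _ => prob_pos hu hξ 1 s
  refine h.trans_le ?_
  have := ENNReal.le_tsum (f := fun w' : X c 1 => if types 1 w'.1 = types 1 w then
    ENNReal.ofReal (prob' u ξ 1 w') else 0) ⟨w, hw⟩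
  rwa [if_pos rfl] at this

instance (c : Path) (N : ℕ) (w : Path) : Decidable (w ∈ X c N) :=
  inferInstanceAs (Decidable (_ ∧ _))

/-- The midpoints of the sides of the triangle `Oab`. -/
def midOA : Pt := (0, 1 / 2)
def midOB : Pt := (1 / 2, 0)
def midAB : Pt := (1 / 2, 1 / 2)

/-- Three witnesses: the direct path; a detour along the other two sides, which has three triangles
and forces λ > 2; and a path via `b` whose loop at the midpoint of `Oa` is erased, leaving the
direct path. -/
lemma mem_X_short : [ptO, midOA, ptA] ∈ X [ptO, ptA] 1 ∧
    [ptO, midOB, midAB, ptA] ∈ X [ptO, ptA] 1 ∧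
    [ptO, midOA, midOB, ptB, midAB, midOA, ptA] ∈ X [ptO, ptB, ptA] 1 := by
  refine ⟨?_, ?_, ?_⟩ <;> decide +kernel

lemma types_short : types 1 [ptO, midOA, ptA] = (2, 0) ∧
    types 1 [ptO, midOB, midAB, ptA] = (3, 0) ∧
    types 1 [ptO, midOA, midOB, ptB, midAB, midOA, ptA] = (2, 0) := by
  refine ⟨?_, ?_, ?_⟩ <;> decide +kernel

lemma coef_short_pos (hu : 0 < u) (hξ : 0 < ξ) : 0 < coef u ξ [ptO, ptA] (2, 0) ∧
    0 < coef u ξ [ptO, ptA] (3, 0) ∧ 0 < coef u ξ [ptO, ptB, ptA] (2, 0) := by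
  obtain ⟨h1, h2, h3⟩ := mem_X_short
  obtain ⟨k1, k2, k3⟩ := types_short
  exact ⟨k1 ▸ coef_pos hu hξ h1, k2 ▸ coef_pos hu hξ h2, k3 ▸ coef_pos hu hξ h3⟩

end Coef

/-! ### Real generating functions -/

/-- The coarse-grainings at level `0` of the paths in `W_N` and `V_N`. -/
def start : Fin 2 → Path := ![[ptO, ptA], [ptO, ptB, ptA]]

lemma isSimple_start (i : Fin 2) : IsSimple (start i) := by
  fin_cases i
  · exact Or.inl rfl
  · exact Or.inr rfl

section Real

variable (u ξ : ℝ)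

/-- The offspring distributions. -/
noncomputable def offspring (i : Fin 2) (k : ℕ × ℕ) : ℝ := (coef u ξ (start i) k).toReal

/-- The generating functions of the offspring distributions. -/
noncomputable def genR (z : Fin 2 → ℝ) (i : Fin 2) : ℝ :=
  ∑ k ∈ range₁, offspring u ξ i k * (z 0 ^ k.1 * z 1 ^ k.2)

variable {u ξ}

lemma coef_ne_top (hξ : IsFixedPoint u ξ) (hu : 0 ≤ u) (i : Fin 2) {k : ℕ × ℕ} (hk : k ∈ range₁) :
    coef u ξ (start i) k ≠ ⊤ := by
  have h := sum_coef hξ hu (isSimple_start i)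
  have h2 : coef u ξ (start i) k ≤ 1 := by
    rw [← h]
    exact Finset.single_le_sum (f := coef u ξ (start i)) (fun _ _ => zero_le) hk
  exact ne_top_of_le_ne_top ENNReal.one_ne_top h2

lemma offspring_nonneg (i : Fin 2) (k : ℕ × ℕ) : 0 ≤ offspring u ξ i k := ENNReal.toReal_nonneg

lemma sum_offspring (hξ : IsFixedPoint u ξ) (hu : 0 ≤ u) (i : Fin 2) :
    ∑ k ∈ range₁, offspring u ξ i k = 1 := by
  have h := congrArg ENNReal.toReal (sum_coef hξ hu (isSimple_start i))
  rwa [ENNReal.toReal_sum fun k hk => coef_ne_top hξ hu i hk, ENNReal.toReal_one] at h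

lemma offspring_pos (hξ : IsFixedPoint u ξ) (hu : 0 < u) :
    (∀ i, 0 < offspring u ξ i (2, 0)) ∧ 0 < offspring u ξ 0 (3, 0) := by
  obtain ⟨h1, h2, h3⟩ := coef_short_pos hu hξ.1
  have hm : (2, 0) ∈ range₁ ∧ (3, 0) ∈ range₁ := by decide
  refine ⟨fun i => ?_, ENNReal.toReal_pos h2.ne' (coef_ne_top hξ hu.le 0 hm.2)⟩
  refine ENNReal.toReal_pos ?_ (coef_ne_top hξ hu.le i hm.1)
  fin_cases i
  · exact h1.ne'
  · exact h3.ne'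

lemma gen_one_ofReal (hξ : IsFixedPoint u ξ) (hu : 0 ≤ u) (i : Fin 2) {z : Fin 2 → ℝ}
    (hz : ∀ j, 0 ≤ z j) : gen u ξ (start i) 1 (ENNReal.ofReal (z 0)) (ENNReal.ofReal (z 1)) =
      ENNReal.ofReal (genR u ξ z i) := by
  have h0 := hz 0
  have h1 := hz 1
  rw [gen_one_eq_sum (isSimple_start i), genR, ENNReal.ofReal_sum_of_nonneg]
  · refine Finset.sum_congr rfl fun k hk => ?_
    rw [ENNReal.ofReal_mul (offspring_nonneg i k), offspring,
      ENNReal.ofReal_toReal (coef_ne_top hξ hu i hk), ENNReal.ofReal_mul (by positivity),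
      ENNReal.ofReal_pow h0, ENNReal.ofReal_pow h1]
  · intro k _
    have := offspring_nonneg (u := u) (ξ := ξ) i k
    positivity

lemma genR_nonneg {z : Fin 2 → ℝ} (hz : ∀ j, 0 ≤ z j) (i : Fin 2) : 0 ≤ genR u ξ z i := by
  have h0 := hz 0
  have h1 := hz 1
  refine Finset.sum_nonneg fun k _ => ?_
  have := offspring_nonneg (u := u) (ξ := ξ) i k
  positivity

lemma iterate_genR_nonneg {z : Fin 2 → ℝ} (hz : ∀ j, 0 ≤ z j) (N : ℕ) (i : Fin 2) :
    0 ≤ (genR u ξ)^[N] z i := by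
  induction N generalizing z with
  | zero => exact hz i
  | succ N ih => exact ih (fun j => genR_nonneg hz j)

/-- The generating functions at level `N` are the iterates of those at level `1`. -/
lemma gen_ofReal (hξ : IsFixedPoint u ξ) (hu : 0 ≤ u) (N : ℕ) (i : Fin 2) {z : Fin 2 → ℝ}
    (hz : ∀ j, 0 ≤ z j) : gen u ξ (start i) N (ENNReal.ofReal (z 0)) (ENNReal.ofReal (z 1)) =
      ENNReal.ofReal ((genR u ξ)^[N] z i) := by
  induction N generalizing z with
  | zero =>
    have := gen_zero (u := u) (ξ := ξ) (ENNReal.ofReal (z 0)) (ENNReal.ofReal (z 1))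
    fin_cases i
    · exact this.1
    · exact this.2
  | succ N ih =>
    have h := gen_one hξ hu (ENNReal.ofReal (z 0)) (ENNReal.ofReal (z 1))
    rw [gen_succ hξ hu (isSimple_start i), ← h.1, ← h.2, Function.iterate_succ_apply,
      ← ih fun j => genR_nonneg hz j]
    congr 1
    · exact gen_one_ofReal hξ hu 0 hz
    · exact gen_one_ofReal hξ hu 1 hz

lemma meanMatrix_apply (hξ : IsFixedPoint u ξ) (hu : 0 ≤ u) (i : Fin 2) :
    meanMatrix u ξ i 0 = ∑ k ∈ range₁, offspring u ξ i k * k.1 ∧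
    meanMatrix u ξ i 1 = ∑ k ∈ range₁, offspring u ξ i k * k.2 := by
  have key : ∀ (i : Fin 2) (φ : ℕ × ℕ → ℕ), ∑' w : X (start i) 1, prob' u ξ 1 w * φ (types 1 w) =
      ∑ k ∈ range₁, offspring u ξ i k * φ k := by
    intro i φ
    have h := congrArg ENNReal.toReal (tsum_eq_sum_coef (u := u) (ξ := ξ) (isSimple_start i)
      fun k => (φ k : ENNReal))
    rw [ENNReal.tsum_toReal_eq fun w => by finiteness, ENNReal.toReal_sum fun k hk =>
      ENNReal.mul_ne_top (coef_ne_top hξ hu i hk) (by simp)] at h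
    simp only [ENNReal.toReal_mul, ENNReal.toReal_natCast,
      ENNReal.toReal_ofReal (prob'_nonneg hu hξ.1.le 1 _)] at h
    exact h
  have hW : ∀ j, ∑' w : W 1, prob u ξ 1 w.1 * (typeCount 1 j (hatQ 1 w.1) : ℝ) =
      ∑' w : X (start 0) 1, prob' u ξ 1 w *
        ((((groups 1 (pairs w)).map List.length).count j : ℕ) : ℝ) := by
    intro j
    rw [W_eq]
    refine tsum_congr fun w => ?_
    rw [prob'_eq_prob u ξ w.2, typeCount_hatQ w.2]
  have hV : ∀ j, ∑' w : V 1, prob' u ξ 1 w.1 * (typeCount 1 j (hatQ 1 w.1) : ℝ) =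
      ∑' w : X (start 1) 1, prob' u ξ 1 w *
        ((((groups 1 (pairs w)).map List.length).count j : ℕ) : ℝ) := by
    intro j
    refine tsum_congr fun w => ?_
    rw [typeCount_hatQ w.2]
  fin_cases i
  · exact ⟨(hW 1).trans (key 0 Prod.fst), (hW 2).trans (key 0 Prod.snd)⟩
  · exact ⟨(hV 1).trans (key 1 Prod.fst), (hV 2).trans (key 1 Prod.snd)⟩

end Real

/-! ### Laws -/

section Law

variable {Ω Ω' : Type*} [MeasurableSpace Ω] [MeasurableSpace Ω'] {μ : Measure Ω} {S : ℕ → Set Path}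
  {P : ℕ → Path → ℝ} {Y : ℕ → Ω → Path}

/-- There are countably many paths, so measurability of the level sets is enough for every `f`. -/
lemma IsErasedSequence.measurable (h : IsErasedSequence μ S P Y) (N : ℕ) {β : Type*}
    [MeasurableSpace β] (f : Path → β) : Measurable fun ω => f (Y N ω) := by
  intro s _
  have : (fun ω => f (Y N ω)) ⁻¹' s = ⋃ γ ∈ f ⁻¹' s, {ω | Y N ω = γ} := by
    ext ω; simp
  rw [this]
  exact MeasurableSet.biUnion (Set.to_countable _) fun γ _ => h.1 N γ

/-- Only joint laws of `(Y_0, …, Y_N)` are given; the law of `Y_N` is their sum over all histories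
`τ`. -/
lemma IsErasedSequence.lintegral_eq (h : IsErasedSequence μ S P Y) (N : ℕ) (f : Path → ENNReal) :
    ∫⁻ ω, f (Y N ω) ∂μ = ∑' w : S N, ENNReal.ofReal (P N w) * f (hatQ N w) := by
  classical
  -- The hypothesis is stated for infinite sequences; the values beyond `N` are arbitrary and set to
  -- `[]`.
  let ext : (Fin (N + 1) → Path) → ℕ → Path := fun τ i =>
    if h : i ≤ N then τ ⟨i, Nat.lt_succ_of_le h⟩ else []
  have hext : ∀ (τ : Fin (N + 1) → Path) (y : ℕ → Path),
      (∀ i ≤ N, y i = ext τ i) ↔ (fun i : Fin (N + 1) => y i) = τ := by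
    intro τ y
    rw [funext_iff]
    constructor
    · intro h i
      have hi : (i : ℕ) ≤ N := Nat.le_of_lt_succ i.2
      simpa [ext, hi] using h i hi
    · intro h i hi
      simpa [ext, hi] using h ⟨i, Nat.lt_succ_of_le hi⟩
  let A : (Fin (N + 1) → Path) → Set Ω := fun τ => {ω | ∀ i ≤ N, Y i ω = ext τ i}
  have hA : ∀ τ, MeasurableSet (A τ) := by
    intro τ
    have : A τ = ⋂ i, ⋂ (_ : i ≤ N), {ω | Y i ω = ext τ i} := by
      ext ω; simp [A]
    rw [this]
    exact MeasurableSet.iInter fun i => MeasurableSet.iInter fun _ => h.1 i _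
  have h1 : ∀ ω, f (Y N ω) = ∑' τ, (A τ).indicator (fun _ => f (τ (Fin.last N))) ω := by
    intro ω
    rw [tsum_eq_single fun i : Fin (N + 1) => Y i ω]
    · rw [Set.indicator_of_mem]
      · simp
      · exact (hext _ fun i => Y i ω).2 rfl
    · intro τ hτ
      rw [Set.indicator_of_notMem]
      intro hmem
      exact hτ ((hext _ fun i => Y i ω).1 hmem).symm
  simp_rw [h1]
  rw [lintegral_tsum fun τ => (measurable_const.indicator (hA τ)).aemeasurable]
  have h2 : ∀ τ, ∫⁻ ω, (A τ).indicator (fun _ => f (τ (Fin.last N))) ω ∂μ =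
      ∑' w : S N, if (fun i : Fin (N + 1) => hatQ i w.1) = τ then
        ENNReal.ofReal (P N w) * f (hatQ N w) else 0 := by
    intro τ
    rw [lintegral_indicator_const (hA τ), h.2 N (ext τ), ← ENNReal.tsum_mul_left,
      tsum_subtype (S N) fun w => if (fun i : Fin (N + 1) => hatQ i w) = τ then
        ENNReal.ofReal (P N w) * f (hatQ N w) else 0]
    refine (tsum_subtype {w | w ∈ S N ∧ ∀ i ≤ N, hatQ i w = ext τ i}
        fun w => f (τ (Fin.last N)) * ENNReal.ofReal (P N w)).trans ?_
    refine tsum_congr fun w => ?_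
    by_cases hw : w ∈ S N
    · by_cases hτ : (fun i : Fin (N + 1) => hatQ i w) = τ
      · rw [Set.indicator_of_mem, Set.indicator_of_mem hw, if_pos hτ, mul_comm]
        · congr 2
          rw [← hτ]
          simp
        · exact ⟨hw, (hext τ fun i => hatQ i w).2 hτ⟩
      · rw [Set.indicator_of_notMem, Set.indicator_of_mem hw, if_neg hτ]
        exact fun hmem => hτ ((hext τ fun i => hatQ i w).1 hmem.2)
    · rw [Set.indicator_of_notMem, Set.indicator_of_notMem hw]
      exact fun hmem => hw hmem.1
  simp_rw [h2]
  rw [ENNReal.tsum_comm]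
  refine tsum_congr fun w => ?_
  rw [tsum_eq_single fun i : Fin (N + 1) => hatQ i w.1]
  · rw [if_pos rfl]
  · exact fun τ hτ => if_neg hτ.symm

lemma isErasedSequence_W {u ξ : ℝ} (h : IsErasedSequence μ W (prob u ξ) Y) :
    IsErasedSequence μ (X (start 0)) (prob' u ξ) Y := by
  refine ⟨h.1, fun N γ => ?_⟩
  rw [h.2, W_eq]
  refine tsum_congr fun w => ?_
  rw [prob'_eq_prob u ξ w.2.1]

lemma integral_exp {u ξ : ℝ} (hξ : IsFixedPoint u ξ) (hu : 0 ≤ u) {i : Fin 2}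
    (h : IsErasedSequence μ (X (start i)) (prob' u ξ) Y) (N : ℕ) (s : ℝ) :
    ∫ ω, Real.exp (-s * ((typeCount N 1 (Y N ω) : ℝ) + typeCount N 2 (Y N ω))) ∂μ =
      (genR u ξ)^[N] (fun _ => Real.exp (-s)) i := by
  have hpos : ∀ _ : Fin 2, 0 ≤ Real.exp (-s) := fun _ => (Real.exp_pos _).le
  rw [integral_eq_lintegral_of_nonneg_ae (ae_of_all _ fun ω => (Real.exp_pos _).le)
    (h.measurable N fun γ => Real.exp (-s * ((typeCount N 1 γ : ℝ) + typeCount N 2 γ))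
      ).aestronglyMeasurable,
    h.lintegral_eq N fun γ => ENNReal.ofReal
      (Real.exp (-s * ((typeCount N 1 γ : ℝ) + typeCount N 2 γ)))]
  have := gen_ofReal hξ hu N i (z := fun _ => Real.exp (-s)) hpos
  rw [gen_eq_tsum] at this
  rw [← ENNReal.toReal_ofReal (iterate_genR_nonneg (u := u) (ξ := ξ) hpos N i), ← this]
  congr 1
  refine tsum_congr fun w => ?_
  congr 1
  rw [typeCount_hatQ w.2, typeCount_hatQ w.2, mul_add, Real.exp_add,
    ENNReal.ofReal_mul (Real.exp_pos _).le, mul_comm (-s), mul_comm (-s), Real.exp_nat_mul,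
    Real.exp_nat_mul, ENNReal.ofReal_pow (Real.exp_pos _).le,
    ENNReal.ofReal_pow (Real.exp_pos _).le]
  rfl

variable {Q : Measure Ω'} {B : Ω' → ℝ} {lam : ℝ} {v : Fin 2 → ℝ}

/-- As the limit is distributed as a multiple of `v`, the sum of the two counts, divided by `v 0 + v
1`, already recovers the law of `B`. -/
lemma IsBranchingLimit.identDistrib (hv : 0 < v 0 + v 1)
    (h : IsBranchingLimit μ Y lam v Q B) : ∃ Z : Ω → ℝ, IdentDistrib Z B μ Q ∧
      ∀ᵐ ω ∂μ, Tendsto (fun N : ℕ => (v 0 + v 1)⁻¹ * ((lam ^ N)⁻¹ *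
        ((typeCount N 1 (Y N ω) : ℝ) + typeCount N 2 (Y N ω)))) atTop (𝓝 (Z ω)) := by
  obtain ⟨T, hT, hid⟩ := h
  have hφ : Measurable fun p : ℝ × ℝ => (v 0 + v 1)⁻¹ * (p.1 + p.2) := by fun_prop
  refine ⟨fun ω => (v 0 + v 1)⁻¹ * ((T ω).1 + (T ω).2), ?_, ?_⟩
  · have := hid.comp hφ
    have e : (fun p : ℝ × ℝ => (v 0 + v 1)⁻¹ * (p.1 + p.2)) ∘
        (fun ω' => (B ω' * v 0, B ω' * v 1)) = B := by
      funext ω'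
      simp only [Function.comp]
      rw [← mul_add]
      field_simp
    rwa [e] at this
  · filter_upwards [hT] with ω hω
    have h1 := (continuous_fst.tendsto _).comp hω
    have h2 := (continuous_snd.tendsto _).comp hω
    have := (h1.add h2).const_mul (v 0 + v 1)⁻¹
    refine this.congr fun N => ?_
    simp only [Function.comp, mul_add]

/-- The Laplace transform of the limit is the limit of the generating functions. -/
lemma laplace_limit [IsProbabilityMeasure μ] {u ξ : ℝ} (hξ : IsFixedPoint u ξ) (hu : 0 ≤ u)
    (hlam : 0 < lam)
    {i : Fin 2} (h : IsErasedSequence μ (X (start i)) (prob' u ξ) Y) (hv : 0 < v 0 + v 1)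
    (hB : IsBranchingLimit μ Y lam v Q B) :
    AEMeasurable B Q ∧ (∀ᵐ ω ∂Q, 0 ≤ B ω) ∧ ∀ t, 0 ≤ t →
      Tendsto (fun N : ℕ => (genR u ξ)^[N]
        (fun _ => Real.exp (-(t * (v 0 + v 1)⁻¹ * (lam ^ N)⁻¹))) i) atTop
        (𝓝 (laplace Q B t)) := by
  obtain ⟨Z, hZ, hlim⟩ := hB.identDistrib hv
  refine ⟨hZ.aemeasurable_snd, ?_, ?_⟩
  · refine hZ.ae_snd (p := fun z => 0 ≤ z) measurableSet_Ici ?_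
    filter_upwards [hlim] with ω hω
    refine ge_of_tendsto' hω fun N => ?_
    positivity
  · intro t ht
    have e : laplace Q B t = ∫ ω, Real.exp (-t * Z ω) ∂μ := by
      have hm : Measurable fun z : ℝ => Real.exp (-t * z) := by fun_prop
      exact ((hZ.comp hm).integral_eq).symm
    rw [e]
    have hint := fun N : ℕ => integral_exp hξ hu h N (t * (v 0 + v 1)⁻¹ * (lam ^ N)⁻¹)
    simp_rw [← hint]
    refine tendsto_integral_of_dominated_convergence (fun _ => 1) ?_ (integrable_const _) ?_ ?_
    · intro N
      exact (h.measurable N fun γ => Real.exp (-(t * (v 0 + v 1)⁻¹ * (lam ^ N)⁻¹) *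
        ((typeCount N 1 γ : ℝ) + typeCount N 2 γ))).aestronglyMeasurable
    · refine fun N => ae_of_all _ fun ω => ?_
      rw [Real.norm_eq_abs, abs_of_pos (Real.exp_pos _), Real.exp_le_one_iff, neg_mul,
        Left.neg_nonpos_iff]
      positivity
    · filter_upwards [hlim] with ω hω
      have := (hω.const_mul (-t)).rexp
      refine this.congr fun N => ?_
      congr 1
      ring

end Law

/-! ### Iterates of the generating functions -/

section Iterates

variable {u ξ : ℝ} {lam : ℝ} {r v : Fin 2 → ℝ}

lemma mem_range₁ {k : ℕ × ℕ} (hk : k ∈ range₁) : k.1 ≤ 12 ∧ k.2 ≤ 12 ∧ 2 ≤ k.1 + k.2 := by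
  simp only [range₁, Finset.mem_filter, Finset.mem_product, Finset.mem_range] at hk
  omega

/-- Summing the left eigenvector equation expresses λ as the average of the row sums of the mean
matrix with weights `v`. Both row sums are at least 2, and the first exceeds 2 because three
offspring have positive probability. -/
lemma two_lt_lam (hξ : IsFixedPoint u ξ) (hu : 0 < u)
    (h : IsPerronData (meanMatrix u ξ) lam r v) : 2 < lam := by
  have hM := meanMatrix_apply hξ hu.le
  have hsum := sum_offspring hξ hu.le
  have hsum2 : ∀ i, meanMatrix u ξ i 0 + meanMatrix u ξ i 1 =
      2 + ∑ k ∈ range₁, offspring u ξ i k * ((k.1 : ℝ) + k.2 - 2) := by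
    intro i
    calc _ = ∑ k ∈ range₁, (offspring u ξ i k * 2 +
          offspring u ξ i k * ((k.1 : ℝ) + k.2 - 2)) := by
            rw [(hM i).1, (hM i).2, ← Finset.sum_add_distrib]
            refine Finset.sum_congr rfl fun k _ => ?_
            ring
      _ = _ := by rw [Finset.sum_add_distrib, ← Finset.sum_mul, hsum i, one_mul]
  have hterm : ∀ i, ∀ k ∈ range₁, 0 ≤ offspring u ξ i k * ((k.1 : ℝ) + k.2 - 2) := by
    intro i k hk
    have h2 : (2 : ℝ) ≤ (k.1 : ℝ) + k.2 := by exact_mod_cast (mem_range₁ hk).2.2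
    exact mul_nonneg (offspring_nonneg i k) (by linarith)
  have h0 : 0 < ∑ k ∈ range₁, offspring u ξ 0 k * ((k.1 : ℝ) + k.2 - 2) := by
    refine Finset.sum_pos' (hterm 0) ⟨(3, 0), by decide, ?_⟩
    have := (offspring_pos hξ hu).2
    norm_num
    exact this
  have h1 := Finset.sum_nonneg (hterm 1)
  have e0 := congrFun h.left 0
  have e1 := congrFun h.left 1
  simp only [Matrix.vecMul, dotProduct, Fin.sum_univ_two, Pi.smul_apply, smul_eq_mul] at e0 e1
  have v0 := h.left_pos 0
  have v1 := h.left_pos 1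
  have k0 := hsum2 0
  have k1 := hsum2 1
  have key : lam * (v 0 + v 1) = 2 * (v 0 + v 1) +
      v 0 * ∑ k ∈ range₁, offspring u ξ 0 k * ((k.1 : ℝ) + k.2 - 2) +
      v 1 * ∑ k ∈ range₁, offspring u ξ 1 k * ((k.1 : ℝ) + k.2 - 2) := by
    have : lam * (v 0 + v 1) = v 0 * (meanMatrix u ξ 0 0 + meanMatrix u ξ 0 1) +
        v 1 * (meanMatrix u ξ 1 0 + meanMatrix u ξ 1 1) := by linarith
    rw [this, k0, k1]
    ring
  have h3 := mul_pos v0 h0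
  have h4 := mul_nonneg v1.le h1
  have h5 : 2 * (v 0 + v 1) < lam * (v 0 + v 1) := by linarith
  exact lt_of_mul_lt_mul_right h5 (by linarith)

lemma continuous_genR : Continuous (genR u ξ) := by
  unfold genR
  fun_prop

lemma genR_mono {z z' : Fin 2 → ℝ} (hz : ∀ j, 0 ≤ z j) (hzz : ∀ j, z j ≤ z' j) (i : Fin 2) :
    genR u ξ z i ≤ genR u ξ z' i := by
  have a := hz 0
  have b := hz 1
  refine Finset.sum_le_sum fun k _ => mul_le_mul_of_nonneg_left ?_ (offspring_nonneg i k)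
  have := hzz 0
  have := hzz 1
  have : 0 ≤ z' 0 := by linarith
  gcongr

/-- Every monomial has degree at least 2 and the coefficients sum to one. -/
lemma genR_le_sq (hξ : IsFixedPoint u ξ) (hu : 0 ≤ u) {z : Fin 2 → ℝ} (hz : ∀ j, 0 ≤ z j) {m : ℝ}
    (hm : m ≤ 1) (hzm : ∀ j, z j ≤ m) (i : Fin 2) : genR u ξ z i ≤ m ^ 2 := by
  have hm0 : 0 ≤ m := (hz 0).trans (hzm 0)
  refine (genR_mono hz hzm i).trans ?_
  rw [genR, ← one_mul (m ^ 2), ← sum_offspring hξ hu i, Finset.sum_mul]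
  refine Finset.sum_le_sum fun k hk => mul_le_mul_of_nonneg_left ?_ (offspring_nonneg i k)
  rw [← pow_add]
  exact pow_le_pow_of_le_one hm0 hm (mem_range₁ hk).2.2

lemma le_genR {z : Fin 2 → ℝ} (hz : ∀ j, 0 ≤ z j) (i : Fin 2) :
    offspring u ξ i (2, 0) * z 0 ^ 2 ≤ genR u ξ z i := by
  have h0 := hz 0
  have h1 := hz 1
  have := Finset.single_le_sum (f := fun k => offspring u ξ i k * (z 0 ^ k.1 * z 1 ^ k.2))
    (s := range₁) (fun k _ => mul_nonneg (offspring_nonneg i k) (by positivity))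
    (show (2, 0) ∈ range₁ by decide)
  simpa [genR] using this

lemma exp_neg_le {y : ℝ} (hy : 0 ≤ y) : Real.exp (-y) ≤ 1 - y + y ^ 2 := by
  have h1 := Real.add_one_le_exp y
  have h2 : Real.exp y * Real.exp (-y) = 1 := by rw [← Real.exp_add]; simp
  have h3 := Real.exp_pos (-y)
  have h4 : (y + 1) * Real.exp (-y) ≤ 1 := by
    exact (mul_le_mul_of_nonneg_right h1 h3.le).trans_eq h2
  have h5 : 1 ≤ (y + 1) * (1 - y + y ^ 2) := by
    have : 0 ≤ y ^ 3 := by positivity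
    nlinarith
  exact le_of_mul_le_mul_left (h4.trans h5) (by linarith)

/-- The generating functions at `exp (-s θ lam^{-N})` stay away from `1`, uniformly in `N`. -/
lemma iterate_genR_le (hξ : IsFixedPoint u ξ) (hu : 0 < u)
    (h : IsPerronData (meanMatrix u ξ) lam r v) {θ : ℝ} (hθ : 0 < θ) :
    ∃ K > 0, ∀ N : ℕ, ∀ s : ℝ, 0 ≤ s → K * s ≤ θ → ∀ i,
      (genR u ξ)^[N] (fun _ => Real.exp (-(s * θ * (lam ^ N)⁻¹))) i ≤
        1 - θ * r i * s + K * r i * s ^ 2 := by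
  have hlam := two_lt_lam hξ hu h
  have hr := h.right_pos
  have hr1 : ∀ i, r i ≤ 1 := by
    have := h.sum_eq
    rw [Fin.sum_univ_two] at this
    have h0 := hr 0
    have h1 := hr 1
    intro i
    fin_cases i
    · change r 0 ≤ 1; linarith
    · change r 1 ≤ 1; linarith
  set ρ := min (r 0) (r 1) with hρ
  have hρ0 : 0 < ρ := lt_min (hr 0) (hr 1)
  have hρr : ∀ i, ρ ≤ r i := by
    intro i
    fin_cases i
    · exact min_le_left _ _
    · exact min_le_right _ _
  -- Here 1152 = 2 · 24², where 24 bounds `k.1 * r 0 + k.2 * r 1`. In the induction the old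
  -- quadratic term shrinks by the factor `1/λ < 1/2`, and the other half of `K` absorbs the new
  -- error.
  have hK : ∀ i, 1152 * θ ^ 2 ≤ 1152 * θ ^ 2 / ρ * r i := by
    intro i
    rw [div_mul_eq_mul_div, le_div_iff₀ hρ0]
    exact mul_le_mul_of_nonneg_left (hρr i) (by positivity)
  refine ⟨1152 * θ ^ 2 / ρ, by positivity, ?_⟩
  have hK0 : 0 < 1152 * θ ^ 2 / ρ := by positivity
  generalize 1152 * θ ^ 2 / ρ = K at hK hK0
  intro N
  induction N with
  | zero =>
    intro s hs _ i
    have h1 := exp_neg_le (y := s * θ) (by positivity)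
    simp only [pow_zero, inv_one, mul_one, Function.iterate_zero, id]
    have h2 : θ * r i * s ≤ θ * s := by
      have := mul_le_mul_of_nonneg_left (hr1 i) (mul_nonneg hθ.le hs)
      linarith
    have h3 : θ ^ 2 * s ^ 2 ≤ K * r i * s ^ 2 := by
      refine mul_le_mul_of_nonneg_right (le_trans ?_ (hK i)) (by positivity)
      nlinarith [sq_nonneg θ]
    nlinarith
  | succ N ih =>
    intro s hs hKs i
    have hlam0 : 0 < lam := by linarith
    have hs' : 0 ≤ s / lam := by positivity
    have hss : s / lam ≤ s / 2 := div_le_div_of_nonneg_left hs (by norm_num) hlam.le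
    have hs2 : s / lam ≤ s := by linarith
    have hKs' : K * (s / lam) ≤ θ := (mul_le_mul_of_nonneg_left hs2 hK0.le).trans hKs
    have e : (fun _ : Fin 2 => Real.exp (-(s * θ * (lam ^ (N + 1))⁻¹))) =
        fun _ => Real.exp (-(s / lam * θ * (lam ^ N)⁻¹)) := by
      funext _
      congr 2
      rw [pow_succ, mul_inv]
      ring
    rw [e, Function.iterate_succ_apply']
    have hw0 : ∀ j, 0 ≤ (genR u ξ)^[N] (fun _ => Real.exp (-(s / lam * θ * (lam ^ N)⁻¹))) j :=
      iterate_genR_nonneg (fun _ => (Real.exp_pos _).le) N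
    have hw := ih (s / lam) hs' hKs'
    generalize (genR u ξ)^[N] (fun _ => Real.exp (-(s / lam * θ * (lam ^ N)⁻¹))) = w at hw0 hw
    -- The induction hypothesis reads `w j ≤ 1 - r j * ε ≤ exp (-(r j * ε))`, so each monomial is
    -- bounded by a single exponential.
    set ε := θ * (s / lam) - K * (s / lam) ^ 2 with hε
    have hε0 : 0 ≤ ε := by
      have := mul_le_mul_of_nonneg_right hKs' hs'
      rw [hε]; nlinarith
    have hεs : ε ≤ θ * s := by
      have h1 := mul_le_mul_of_nonneg_left hs2 hθ.le
      have h2 : 0 ≤ K * (s / lam) ^ 2 := by positivity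
      linarith
    have hw' : ∀ j, w j ≤ Real.exp (-(r j * ε)) := by
      intro j
      refine (hw j).trans (le_trans (le_of_eq ?_) (Real.one_sub_le_exp_neg _))
      rw [hε]; ring
    have hterm : ∀ k ∈ range₁, w 0 ^ k.1 * w 1 ^ k.2 ≤
        1 - ε * (k.1 * r 0 + k.2 * r 1) + 576 * (θ * s) ^ 2 := by
      intro k hk
      obtain ⟨hk1, hk2, -⟩ := mem_range₁ hk
      have hk1 : (k.1 : ℝ) ≤ 12 := by exact_mod_cast hk1
      have hk2 : (k.2 : ℝ) ≤ 12 := by exact_mod_cast hk2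
      have r0 := hr 0
      have r1 := hr 1
      have hy : 0 ≤ ε * (k.1 * r 0 + k.2 * r 1) := by positivity
      have h1 : w 0 ^ k.1 * w 1 ^ k.2 ≤ Real.exp (-(ε * (k.1 * r 0 + k.2 * r 1))) := by
        have e : -(ε * (k.1 * r 0 + k.2 * r 1)) = k.1 * (-(r 0 * ε)) + k.2 * (-(r 1 * ε)) := by
          ring
        rw [e, Real.exp_add, Real.exp_nat_mul, Real.exp_nat_mul]
        exact mul_le_mul (pow_le_pow_left₀ (hw0 0) (hw' 0) _) (pow_le_pow_left₀ (hw0 1) (hw' 1) _)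
          (pow_nonneg (hw0 1) _) (by positivity)
      have h2 := exp_neg_le hy
      have h3 : k.1 * r 0 + k.2 * r 1 ≤ 24 := by
        have a := mul_le_mul hk1 (hr1 0) r0.le (by norm_num)
        have b := mul_le_mul hk2 (hr1 1) r1.le (by norm_num)
        linarith
      have h4 : ε * (k.1 * r 0 + k.2 * r 1) ≤ θ * s * 24 :=
        mul_le_mul hεs h3 (by positivity) (by positivity)
      have h5 := pow_le_pow_left₀ hy h4 2
      nlinarith
    -- The right eigenvector equation makes the linear term reproduce itself, the factor λ
    -- cancelling the rescaling of `s`.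
    have hmean : ∑ k ∈ range₁, offspring u ξ i k * ((k.1 : ℝ) * r 0 + k.2 * r 1) = lam * r i := by
      have e := congrFun h.right i
      simp only [Matrix.mulVec, dotProduct, Fin.sum_univ_two, Pi.smul_apply, smul_eq_mul] at e
      rw [(meanMatrix_apply hξ hu.le i).1, (meanMatrix_apply hξ hu.le i).2] at e
      rw [← e, Finset.sum_mul, Finset.sum_mul, ← Finset.sum_add_distrib]
      refine Finset.sum_congr rfl fun k _ => ?_
      ring
    have hbound : genR u ξ w i ≤ 1 - ε * (lam * r i) + 576 * (θ * s) ^ 2 := by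
      refine (Finset.sum_le_sum fun k hk => mul_le_mul_of_nonneg_left (hterm k hk)
        (offspring_nonneg i k)).trans (le_of_eq ?_)
      have hs1 := sum_offspring hξ hu.le i
      calc _ = (1 + 576 * (θ * s) ^ 2) * ∑ k ∈ range₁, offspring u ξ i k -
          ε * ∑ k ∈ range₁, offspring u ξ i k * ((k.1 : ℝ) * r 0 + k.2 * r 1) := by
            rw [Finset.mul_sum, Finset.mul_sum, ← Finset.sum_sub_distrib]
            refine Finset.sum_congr rfl fun k _ => ?_
            ring
        _ = _ := by rw [hs1, hmean]; ring
    refine hbound.trans ?_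
    have e1 : ε * (lam * r i) = θ * r i * s - K * r i * s * (s / lam) := by
      rw [hε]; field_simp
    have e2 : K * r i * s * (s / lam) ≤ K * r i * s ^ 2 / 2 := by
      have hri := hr i
      have := mul_le_mul_of_nonneg_left hss (by positivity : 0 ≤ K * r i * s)
      nlinarith
    have e3 : 576 * (θ * s) ^ 2 ≤ K * r i * s ^ 2 / 2 := by
      have := mul_le_mul_of_nonneg_right (hK i) (sq_nonneg s)
      nlinarith
    linarith

end Iterates

/-! ### Growth of the logarithm of a Laplace transform -/

section Growth

variable {lam : ℝ}

lemma rpow_nu (hlam : 2 < lam) (n : ℕ) : (lam ^ n) ^ nu lam = 2 ^ n := by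
  have h0 : 0 < lam := by linarith
  have hl : Real.log lam ≠ 0 := (Real.log_pos (by linarith)).ne'
  have h1 : lam ^ nu lam = 2 := by
    rw [Real.rpow_def_of_pos h0, nu, mul_div_cancel₀ _ hl, Real.exp_log (by norm_num)]
  rw [← Real.rpow_natCast, ← Real.rpow_mul h0.le, mul_comm, Real.rpow_mul h0.le, h1,
    Real.rpow_natCast]

lemma nu_pos (hlam : 2 < lam) : 0 < nu lam :=
  div_pos (Real.log_pos (by norm_num)) (Real.log_pos (by linarith))

lemma nu_lt_one (hlam : 2 < lam) : nu lam < 1 := by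
  rw [nu, div_lt_one (Real.log_pos (by linarith))]
  exact Real.log_lt_log (by norm_num) hlam

/-- Two-sided bounds from the functional inequalities. -/
lemma log_bounds (hlam : 2 < lam) {g : Fin 2 → ℝ → ℝ} {t₀ q : ℝ} (ht₀ : 0 < t₀) (hq : 0 < q)
    (hpos : ∀ i t, 0 ≤ t → 0 < g i t) (hanti : ∀ i, AntitoneOn (g i) (Set.Ici 0))
    (hlt : ∀ i, g i t₀ < 1)
    (hle : ∀ i t, 0 ≤ t → ∀ m ≤ 1, (∀ j, g j t ≤ m) → g i (lam * t) ≤ m ^ 2)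
    (hge : ∀ i t, 0 ≤ t → q * g 0 t ^ 2 ≤ g i (lam * t)) :
    ∃ C₁ C₂ : ℝ, 0 < C₁ ∧ 0 < C₂ ∧ ∀ i, ∀ t ≥ t₀,
      C₂ * t ^ nu lam ≤ -Real.log (g i t) ∧ -Real.log (g i t) ≤ C₁ * t ^ nu lam := by
  have hlam0 : 0 < lam := by linarith
  have hν := nu_pos hlam
  set m := max (g 0 t₀) (g 1 t₀) with hm
  have hm1 : m < 1 := max_lt (hlt 0) (hlt 1)
  have hm0 : 0 < m := lt_max_of_lt_left (hpos 0 t₀ ht₀.le)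
  have htn : ∀ n : ℕ, 0 ≤ lam ^ n * t₀ := fun n => by positivity
  have hup : ∀ n : ℕ, ∀ i, g i (lam ^ n * t₀) ≤ m ^ 2 ^ n := by
    intro n
    induction n with
    | zero =>
      intro i
      simp only [pow_zero, one_mul, pow_one]
      fin_cases i
      · exact le_max_left _ _
      · exact le_max_right _ _
    | succ n ih =>
      intro i
      have := hle i _ (htn n) (m ^ 2 ^ n) (pow_le_one₀ hm0.le hm1.le) ih
      rw [← mul_assoc, ← pow_succ', ← pow_mul, ← pow_succ] at this
      exact this
  -- With `|log q|` added, the quantity for type 0 at most doubles from `t` to `λt`, and the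
  -- additive error disappears.
  set L := -Real.log (g 0 t₀) + |Real.log q| with hL
  have hlog : ∀ i t, 0 ≤ t → -Real.log (g i (lam * t)) ≤ 2 * -Real.log (g 0 t) + |Real.log q| := by
    intro i t ht
    have h1 := hpos 0 t ht
    have h2 := Real.log_le_log (by positivity) (hge i t ht)
    rw [Real.log_mul hq.ne' (by positivity), Real.log_pow] at h2
    have h3 := neg_le_abs (Real.log q)
    push_cast at h2
    linarith
  have hdown0 : ∀ n : ℕ, -Real.log (g 0 (lam ^ n * t₀)) + |Real.log q| ≤ 2 ^ n * L := by
    intro n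
    induction n with
    | zero => simp [hL]
    | succ n ih =>
      have := hlog 0 _ (htn n)
      rw [← mul_assoc, ← pow_succ'] at this
      rw [pow_succ (2 : ℝ)]
      linarith
  -- The lower bound passes from type 0 to either type in one further step, hence the exponent `n +
  -- 1`.
  have hdown : ∀ n : ℕ, ∀ i, -Real.log (g i (lam ^ (n + 1) * t₀)) ≤ 2 ^ (n + 1) * L := by
    intro n i
    have := hlog i _ (htn n)
    rw [← mul_assoc, ← pow_succ'] at this
    have h2 := hdown0 n
    have h3 := abs_nonneg (Real.log q)
    rw [pow_succ (2 : ℝ)]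
    linarith
  have hlogm : 0 < -Real.log m := neg_pos.2 (Real.log_neg hm0 hm1)
  have hL0 : 0 < L := by
    have := Real.log_neg (hpos 0 t₀ ht₀.le) (hlt 0)
    have := abs_nonneg (Real.log q)
    linarith
  have htν : 0 < t₀ ^ nu lam := Real.rpow_pos_of_pos ht₀ _
  refine ⟨2 * L / t₀ ^ nu lam, -Real.log m / (2 * t₀ ^ nu lam), by positivity, by positivity, ?_⟩
  intro i t ht
  have ht0 : 0 < t := ht₀.trans_le ht
  -- Sandwiching `t` between consecutive `λ^n t₀` costs a factor 2 in each bound, by monotonicity of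
  -- `g i`.
  obtain ⟨n, hn1, hn2⟩ := exists_nat_pow_near (x := t / t₀) (y := lam) ((one_le_div ht₀).2 ht)
    (by linarith)
  rw [le_div_iff₀ ht₀] at hn1
  rw [div_lt_iff₀ ht₀] at hn2
  have k1 : 2 ^ n * t₀ ^ nu lam ≤ t ^ nu lam := by
    rw [← rpow_nu hlam, ← Real.mul_rpow (by positivity) ht₀.le]
    exact Real.rpow_le_rpow (htn n) hn1 hν.le
  have k2 : t ^ nu lam ≤ 2 ^ (n + 1) * t₀ ^ nu lam := by
    rw [← rpow_nu hlam, ← Real.mul_rpow (by positivity) ht₀.le]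
    exact Real.rpow_le_rpow ht0.le hn2.le hν.le
  have g1 : g i t ≤ g i (lam ^ n * t₀) := hanti i (htn n) ht0.le hn1
  have g2 : g i (lam ^ (n + 1) * t₀) ≤ g i t := hanti i ht0.le (htn (n + 1)) hn2.le
  constructor
  · have h1 := Real.log_le_log (hpos i t ht0.le) (g1.trans (hup n i))
    rw [Real.log_pow] at h1
    push_cast at h1
    calc -Real.log m / (2 * t₀ ^ nu lam) * t ^ nu lam
        ≤ -Real.log m / (2 * t₀ ^ nu lam) * (2 ^ (n + 1) * t₀ ^ nu lam) := by gcongr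
      _ = 2 ^ n * -Real.log m := by field_simp; ring
      _ ≤ -Real.log (g i t) := by linarith
  · have h1 := Real.log_le_log (hpos i _ (htn (n + 1))) g2
    calc -Real.log (g i t) ≤ 2 ^ (n + 1) * L := by linarith [hdown n i]
      _ = 2 * L / t₀ ^ nu lam * (2 ^ n * t₀ ^ nu lam) := by field_simp; ring
      _ ≤ _ := by gcongr

end Growth

/-! ### Laplace transforms and tails -/

section Tails

variable {Ω : Type*} [MeasurableSpace Ω] {Q : Measure Ω} [IsProbabilityMeasure Q] {B : Ω → ℝ}

lemma integrable_exp_neg (hm : AEMeasurable B Q) (h0 : ∀ᵐ ω ∂Q, 0 ≤ B ω) {t : ℝ} (ht : 0 ≤ t) :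
    Integrable (fun ω => Real.exp (-t * B ω)) Q := by
  refine Integrable.of_bound (C := 1) (by fun_prop) ?_
  filter_upwards [h0] with ω hω
  rw [Real.norm_eq_abs, abs_of_pos (Real.exp_pos _), Real.exp_le_one_iff, neg_mul,
    Left.neg_nonpos_iff]
  positivity

lemma laplace_pos (hm : AEMeasurable B Q) (h0 : ∀ᵐ ω ∂Q, 0 ≤ B ω) {t : ℝ} (ht : 0 ≤ t) :
    0 < laplace Q B t :=
  integral_exp_pos (integrable_exp_neg hm h0 ht)

lemma laplace_antitone (hm : AEMeasurable B Q) (h0 : ∀ᵐ ω ∂Q, 0 ≤ B ω) :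
    AntitoneOn (laplace Q B) (Set.Ici 0) := by
  intro s hs t ht hst
  refine integral_mono_ae (integrable_exp_neg hm h0 ht) (integrable_exp_neg hm h0 hs) ?_
  filter_upwards [h0] with ω hω
  have := mul_le_mul_of_nonneg_right hst hω
  exact Real.exp_le_exp.2 (by linarith)

/-- The exponential Chebyshev inequality. -/
lemma prob_le_exp_mul_laplace (hm : AEMeasurable B Q) (h0 : ∀ᵐ ω ∂Q, 0 ≤ B ω) {t : ℝ} (ht : 0 ≤ t)
    (y : ℝ) : Q.real {ω | B ω ≤ y} ≤ Real.exp (t * y) * laplace Q B t := by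
  have := measure_le_le_exp_mul_mgf (μ := Q) (X := B) (t := -t) y (by linarith)
    (integrable_exp_neg hm h0 ht)
  rwa [neg_neg] at this

/-- The integrand is at most 1 where `B ≤ y` and at most `exp (-t * y)` elsewhere. This gives the
lower bound for the tail. -/
lemma laplace_le (hm : AEMeasurable B Q) (h0 : ∀ᵐ ω ∂Q, 0 ≤ B ω) {t : ℝ} (ht : 0 ≤ t) (y : ℝ) :
    laplace Q B t ≤ Q.real {ω | B ω ≤ y} + Real.exp (-t * y) := by
  have hA : NullMeasurableSet {ω | B ω ≤ y} Q := nullMeasurableSet_le hm aemeasurable_const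
  have h1 : ∀ᵐ ω ∂Q, Real.exp (-t * B ω) ≤
      {ω | B ω ≤ y}.indicator (fun _ => (1 : ℝ)) ω + Real.exp (-t * y) := by
    filter_upwards [h0] with ω hω
    by_cases hy : B ω ≤ y
    · rw [Set.indicator_of_mem (show ω ∈ {ω | B ω ≤ y} from hy)]
      have : Real.exp (-t * B ω) ≤ 1 := by
        rw [Real.exp_le_one_iff, neg_mul, Left.neg_nonpos_iff]; positivity
      have := Real.exp_pos (-t * y)
      linarith
    · rw [Set.indicator_of_notMem (show ω ∉ {ω | B ω ≤ y} from hy), zero_add]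
      have := mul_le_mul_of_nonneg_left (not_le.1 hy).le ht
      exact Real.exp_le_exp.2 (by linarith)
  have hint : Integrable ({ω | B ω ≤ y}.indicator fun _ => (1 : ℝ)) Q :=
    (integrable_const _).indicator₀ hA
  refine (integral_mono_ae (integrable_exp_neg hm h0 ht) (hint.add (integrable_const _))
    h1).trans (le_of_eq ?_)
  rw [integral_add' hint (integrable_const _), integral_indicator₀ hA]
  simp

/-- Left tails from the growth of the Laplace transform. -/
lemma tail_bounds (hm : AEMeasurable B Q) (h0 : ∀ᵐ ω ∂Q, 0 ≤ B ω) {ν C₁ C₂ t₀ : ℝ} (hν : 0 < ν)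
    (hν1 : ν < 1) (hC₁ : 0 < C₁) (hC₂ : 0 < C₂) (ht₀ : 0 < t₀)
    (h : ∀ t ≥ t₀, C₂ * t ^ ν ≤ -Real.log (laplace Q B t) ∧
      -Real.log (laplace Q B t) ≤ C₁ * t ^ ν) :
    ∃ C₅ C₆ x₀ : ℝ, 0 < C₅ ∧ 0 < C₆ ∧ 0 < x₀ ∧ ∀ y : ℝ, 0 < y → y ≤ x₀ →
      Real.exp (-C₅ * y ^ (-(ν / (1 - ν)))) ≤ Q.real {ω | B ω ≤ y} ∧
      Q.real {ω | B ω ≤ y} ≤ Real.exp (-C₆ * y ^ (-(ν / (1 - ν)))) := by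
  have hν' : 0 < 1 - ν := by linarith
  set ρ := ν / (1 - ν) with hρ
  have hρ0 : 0 < ρ := div_pos hν hν'
  -- The equation `t y = c t^ν` has the solution `t = (c / y)^{1/(1-ν)}`, which exceeds `t₀` for
  -- small `y`.
  have key : ∀ c : ℝ, 0 < c → ∀ y : ℝ, 0 < y → ∃ t : ℝ, 0 < t ∧ t * y = c * t ^ ν ∧
      t ^ ν = c ^ ρ * y ^ (-ρ) ∧ (y ≤ c / t₀ ^ (1 - ν) → t₀ ≤ t) := by
    intro c hc y hy
    have hcy : 0 < c / y := div_pos hc hy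
    refine ⟨(c / y) ^ (1 - ν)⁻¹, by positivity, ?_, ?_, ?_⟩
    · rw [← Real.rpow_mul hcy.le]
      have e : (c / y) ^ (1 - ν)⁻¹ = (c / y) ^ ((1 - ν)⁻¹ * ν) * (c / y) := by
        rw [← Real.rpow_add_one hcy.ne']
        congr 1
        field_simp
        ring
      rw [e]
      field_simp
    · rw [← Real.rpow_mul hcy.le, Real.div_rpow hc.le hy.le, Real.rpow_neg hy.le, hρ,
        div_eq_mul_inv ν, mul_comm ν]
      rfl
    · intro hy'
      rw [le_div_iff₀ (by positivity), mul_comm, ← le_div_iff₀ hy] at hy'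
      calc t₀ = (t₀ ^ (1 - ν)) ^ (1 - ν)⁻¹ := by
            rw [← Real.rpow_mul ht₀.le, mul_inv_cancel₀ hν'.ne', Real.rpow_one]
        _ ≤ _ := Real.rpow_le_rpow (by positivity) hy' (by positivity)
  have hlap : ∀ t ≥ t₀, Real.exp (-(C₁ * t ^ ν)) ≤ laplace Q B t ∧
      laplace Q B t ≤ Real.exp (-(C₂ * t ^ ν)) := by
    intro t ht
    obtain ⟨h1, h2⟩ := h t ht
    have hp := laplace_pos hm h0 (ht₀.le.trans ht)
    constructor
    · rw [← Real.le_log_iff_exp_le hp]; linarith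
    · rw [← Real.log_le_iff_le_exp hp]; linarith
  -- The choices are `c = 2 C₁` for the lower and `c = C₂ / 2` for the upper bound. The first two
  -- bounds on `y` give `t ≥ t₀`; the third gives `C₁ t^ν ≥ log 2` in the lower bound.
  refine ⟨2 * C₁ * (2 * C₁) ^ ρ, C₂ / 2 * (C₂ / 2) ^ ρ,
    min (min (2 * C₁ / t₀ ^ (1 - ν)) (C₂ / 2 / t₀ ^ (1 - ν)))
      ((C₁ * (2 * C₁) ^ ρ / Real.log 2) ^ ρ⁻¹), by positivity, by positivity, ?_, ?_⟩
  · have := Real.log_pos (by norm_num : (1 : ℝ) < 2)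
    positivity
  intro y hy hyx
  rw [le_min_iff, le_min_iff] at hyx
  obtain ⟨⟨hy1, hy2⟩, hy3⟩ := hyx
  constructor
  -- With `E = exp (-C₁ t^ν) ≤ 1/2`, the Laplace transform is at least `E` and `exp (-t y) = E²`, so
  -- the tail is at least `E - E² ≥ E²`.
  · obtain ⟨t, ht, e1, e2, e3⟩ := key (2 * C₁) (by positivity) y hy
    have htt := e3 hy1
    have h1 := (hlap t htt).1
    have h2 := laplace_le hm h0 ht.le y
    have h3 : Real.exp (-t * y) = Real.exp (-(C₁ * t ^ ν)) * Real.exp (-(C₁ * t ^ ν)) := by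
      rw [← Real.exp_add]
      congr 1
      linarith
    have h4 : Real.log 2 ≤ C₁ * t ^ ν := by
      have hl := Real.log_pos (by norm_num : (1 : ℝ) < 2)
      have h5 := Real.rpow_le_rpow hy.le hy3 hρ0.le
      rw [← Real.rpow_mul (by positivity), inv_mul_cancel₀ hρ0.ne', Real.rpow_one,
        le_div_iff₀ hl] at h5
      rw [e2, Real.rpow_neg hy.le, ← mul_assoc, ← div_eq_mul_inv,
        le_div_iff₀ (Real.rpow_pos_of_pos hy _)]
      linarith
    have h5 : Real.exp (-(C₁ * t ^ ν)) ≤ 1 / 2 := by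
      calc _ ≤ Real.exp (-Real.log 2) := Real.exp_le_exp.2 (by linarith)
        _ = _ := by rw [Real.exp_neg, Real.exp_log (by norm_num)]; norm_num
    have h6 := Real.exp_pos (-(C₁ * t ^ ν))
    have h7 : Real.exp (-(2 * C₁ * (2 * C₁) ^ ρ) * y ^ (-ρ)) = Real.exp (-t * y) := by
      congr 1
      rw [neg_mul, neg_mul, e1, e2]
      ring
    rw [h7]
    nlinarith
  -- The factor `exp (t y)` uses up half of the decay `exp (-C₂ t^ν)`.
  · obtain ⟨t, ht, e1, e2, e3⟩ := key (C₂ / 2) (by positivity) y hy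
    have htt := e3 hy2
    refine (prob_le_exp_mul_laplace hm h0 ht.le y).trans ?_
    refine (mul_le_mul_of_nonneg_left (hlap t htt).2 (Real.exp_pos _).le).trans (le_of_eq ?_)
    rw [← Real.exp_add, e1]
    congr 1
    have : -(C₂ / 2 * (C₂ / 2) ^ ρ) * y ^ (-ρ) = -(C₂ / 2 * t ^ ν) := by rw [e2]; ring
    rw [this]
    ring

end Tails

/-! ### Functional equation and conclusion -/

/-- The Laplace transforms of the limits. -/
lemma laplace_bounds {u ξ : ℝ} (hξ : IsFixedPoint u ξ) (hu : 0 < u) {lam : ℝ} {r v : Fin 2 → ℝ}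
    (hp : IsPerronData (meanMatrix u ξ) lam r v) {Ω : Type*} [MeasurableSpace Ω] {Q : Measure Ω}
    [IsProbabilityMeasure Q] {B : Fin 2 → Ω → ℝ} (hm : ∀ i, AEMeasurable (B i) Q)
    (h0 : ∀ i, ∀ᵐ ω ∂Q, 0 ≤ B i ω)
    (hlim : ∀ i t, 0 ≤ t → Tendsto (fun N : ℕ => (genR u ξ)^[N]
      (fun _ => Real.exp (-(t * (v 0 + v 1)⁻¹ * (lam ^ N)⁻¹))) i) atTop
        (𝓝 (laplace Q (B i) t))) :
    ∃ t₀ C₁ C₂ : ℝ, 0 < t₀ ∧ 0 < C₁ ∧ 0 < C₂ ∧ ∀ i, ∀ t ≥ t₀,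
      C₂ * t ^ nu lam ≤ -Real.log (laplace Q (B i) t) ∧
      -Real.log (laplace Q (B i) t) ≤ C₁ * t ^ nu lam := by
  have hlam := two_lt_lam hξ hu hp
  have hv : 0 < v 0 + v 1 := add_pos (hp.left_pos 0) (hp.left_pos 1)
  have hpos : ∀ i t, 0 ≤ t → 0 < laplace Q (B i) t := fun i t ht => laplace_pos (hm i) (h0 i) ht
  -- At argument `λt` the iterate of order `N + 1` is `genR` applied to the iterate of order `N` at
  -- `t`; continuity of `genR` allows passing to the limit.
  have hfun : ∀ i t, 0 ≤ t →
      laplace Q (B i) (lam * t) = genR u ξ (fun j => laplace Q (B j) t) i := by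
    intro i t ht
    have h1 := (tendsto_add_atTop_iff_nat 1).2 (hlim i (lam * t) (by positivity))
    have h2 := (((continuous_apply i).comp (continuous_genR (u := u) (ξ := ξ))).tendsto
      fun j => laplace Q (B j) t).comp (tendsto_pi_nhds.2 fun j => hlim j t ht)
    refine tendsto_nhds_unique h1 (h2.congr fun N => ?_)
    have e : lam * t * (v 0 + v 1)⁻¹ * (lam ^ (N + 1))⁻¹ = t * (v 0 + v 1)⁻¹ * (lam ^ N)⁻¹ := by
      rw [pow_succ]
      field_simp
    rw [Function.iterate_succ_apply', e]
    rfl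
  obtain ⟨K, hK, hbound⟩ := iterate_genR_le hξ hu hp (inv_pos.2 hv)
  set θ := (v 0 + v 1)⁻¹ with hθ
  have hθ0 : 0 < θ := inv_pos.2 hv
  -- At this argument the quadratic term is half the linear one, so the limit stays below 1.
  have ht₀ : 0 < θ / (2 * K) := by positivity
  have hKt : K * (θ / (2 * K)) = θ / 2 := by field_simp
  have hlt : ∀ i, laplace Q (B i) (θ / (2 * K)) < 1 := by
    intro i
    have h1 := le_of_tendsto' (hlim i _ ht₀.le) fun N => hbound N _ ht₀.le
      (by rw [hKt]; linarith) i
    refine h1.trans_lt ?_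
    have hr := hp.right_pos i
    have h2 : K * r i * (θ / (2 * K)) ^ 2 = θ * r i * (θ / (2 * K)) / 2 := by
      field_simp
    have h3 : 0 < θ * r i * (θ / (2 * K)) := by positivity
    linarith
  have hq := (offspring_pos hξ hu).1
  obtain ⟨C₁, C₂, hC₁, hC₂, hC⟩ := log_bounds hlam (g := fun i => laplace Q (B i))
    (q := min (offspring u ξ 0 (2, 0)) (offspring u ξ 1 (2, 0))) ht₀ (lt_min (hq 0) (hq 1)) hpos
    (fun i => laplace_antitone (hm i) (h0 i)) hlt
    (fun i t ht m hm1 hgm => by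
      rw [hfun i t ht]
      exact genR_le_sq hξ hu.le (fun j => (hpos j t ht).le) hm1 hgm i)
    (fun i t ht => by
      rw [hfun i t ht]
      refine le_trans (mul_le_mul_of_nonneg_right ?_ (sq_nonneg _))
        (le_genR (fun j => (hpos j t ht).le) i)
      fin_cases i
      · exact min_le_left _ _
      · exact min_le_right _ _)
  exact ⟨_, C₁, C₂, ht₀, hC₁, hC₂, hC⟩

end ELLF

theorem mainTheorem6
    (u : ℝ) (hu0 : 0 < u) (hu1 : u ≤ 1)
    (x : ℝ) (hx : ELLF.IsFixedPoint u x)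
    (lam : ℝ) (r v : Fin 2 → ℝ) (hlam : ELLF.IsPerronData (ELLF.meanMatrix u x) lam r v)
    {Ω₁ Ω₂ Ω : Type*} [MeasurableSpace Ω₁] [MeasurableSpace Ω₂] [MeasurableSpace Ω]
    (μ₁ : Measure Ω₁) [IsProbabilityMeasure μ₁] (Y₁ : ℕ → Ω₁ → ELLF.Path)
    (hY₁ : ELLF.IsErasedSequence μ₁ ELLF.W (ELLF.prob u x) Y₁)
    (μ₂ : Measure Ω₂) [IsProbabilityMeasure μ₂] (Y₂ : ℕ → Ω₂ → ELLF.Path)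
    (hY₂ : ELLF.IsErasedSequence μ₂ ELLF.V (ELLF.prob' u x) Y₂)
    (P : Measure Ω) [IsProbabilityMeasure P] (B : Fin 2 → Ω → ℝ)
    (hB₁ : ELLF.IsBranchingLimit μ₁ Y₁ lam v P (B 0))
    (hB₂ : ELLF.IsBranchingLimit μ₂ Y₂ lam v P (B 1)) :
    (∃ C₁ C₂ t₀ : ℝ, 0 < C₁ ∧ 0 < C₂ ∧ 0 < t₀ ∧ ∀ i, ∀ t ≥ t₀,
      C₂ ≤ ELLF.h P (B i) (ELLF.nu lam) t ∧ ELLF.h P (B i) (ELLF.nu lam) t ≤ C₁) ∧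
    (∃ C₅ C₆ x₀ : ℝ, 0 < C₅ ∧ 0 < C₆ ∧ 0 < x₀ ∧ ∀ i, ∀ y : ℝ, 0 < y → y ≤ x₀ →
      Real.exp (-C₅ * y ^ (-(ELLF.nu lam / (1 - ELLF.nu lam)))) ≤
          P.real {ω | (v 0 + 2 * v 1) * B i ω ≤ y} ∧
      P.real {ω | (v 0 + 2 * v 1) * B i ω ≤ y} ≤
          Real.exp (-C₆ * y ^ (-(ELLF.nu lam / (1 - ELLF.nu lam))))) := by
  have h2 := ELLF.two_lt_lam hx hu0 hlam
  have hlam0 : 0 < lam := by linarith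
  have v0 := hlam.left_pos 0
  have v1 := hlam.left_pos 1
  have hv : 0 < v 0 + v 1 := add_pos v0 v1
  have hν := ELLF.nu_pos h2
  have hν1 := ELLF.nu_lt_one h2
  obtain ⟨m₁, n₁, l₁⟩ := ELLF.laplace_limit hx hu0.le hlam0 (ELLF.isErasedSequence_W hY₁) hv hB₁
  obtain ⟨m₂, n₂, l₂⟩ := ELLF.laplace_limit (i := 1) hx hu0.le hlam0 hY₂ hv hB₂
  have hm : ∀ i, AEMeasurable (B i) P := Fin.forall_fin_two.2 ⟨m₁, m₂⟩
  have hn : ∀ i, ∀ᵐ ω ∂P, 0 ≤ B i ω := Fin.forall_fin_two.2 ⟨n₁, n₂⟩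
  obtain ⟨t₀, C₁, C₂, ht₀, hC₁, hC₂, hC⟩ := ELLF.laplace_bounds hx hu0 hlam hm hn
    (Fin.forall_fin_two.2 ⟨l₁, l₂⟩)
  generalize ELLF.nu lam = ν at hν hν1 hC
  constructor
  · refine ⟨C₁, C₂, t₀, hC₁, hC₂, ht₀, fun i t ht => ?_⟩
    obtain ⟨h3, h4⟩ := hC i t ht
    have htν : 0 < t ^ ν := Real.rpow_pos_of_pos (ht₀.trans_le ht) _
    have e : ELLF.h P (B i) ν t = -Real.log (ELLF.laplace P (B i) t) / t ^ ν := by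
      rw [ELLF.h, Real.rpow_neg (ht₀.trans_le ht).le]
      field_simp
    rw [e]
    exact ⟨(le_div_iff₀ htν).2 h3, (div_le_iff₀ htν).2 h4⟩
  · set β := v 0 + 2 * v 1 with hβ
    have hβ0 : 0 < β := by positivity
    set ρ := ν / (1 - ν) with hρ
    have hρ0 : 0 < ρ := div_pos hν (by linarith)
    have key : ∀ i, ∃ C₅ C₆ x₀ : ℝ, 0 < C₅ ∧ 0 < C₆ ∧ 0 < x₀ ∧ ∀ y : ℝ, 0 < y → y ≤ x₀ →
        Real.exp (-C₅ * y ^ (-ρ)) ≤ P.real {ω | B i ω ≤ y} ∧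
        P.real {ω | B i ω ≤ y} ≤ Real.exp (-C₆ * y ^ (-ρ)) :=
      fun i => ELLF.tail_bounds (hm i) (hn i) hν hν1 hC₁ hC₂ ht₀ (hC i)
    choose C₅ C₆ x₀ h5 h6 hx₀ hT using key
    refine ⟨max (C₅ 0) (C₅ 1) * β ^ ρ, min (C₆ 0) (C₆ 1) * β ^ ρ, min (x₀ 0) (x₀ 1) * β,
      mul_pos (lt_max_of_lt_left (h5 0)) (by positivity),
      mul_pos (lt_min (h6 0) (h6 1)) (by positivity),
      mul_pos (lt_min (hx₀ 0) (hx₀ 1)) hβ0, fun i y hy hyx => ?_⟩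
    -- Scaling `B i` by β only changes the constants; the worse of the two types is taken in each.
    have hy' : 0 < y / β := div_pos hy hβ0
    have hyx' : y / β ≤ x₀ i := by
      rw [div_le_iff₀ hβ0]
      refine hyx.trans (mul_le_mul_of_nonneg_right ?_ hβ0.le)
      fin_cases i
      · exact min_le_left _ _
      · exact min_le_right _ _
    have hset : {ω | β * B i ω ≤ y} = {ω | B i ω ≤ y / β} := by
      ext ω
      exact (le_div_iff₀' hβ0).symm
    have e : (y / β) ^ (-ρ) = β ^ ρ * y ^ (-ρ) := by
      rw [Real.div_rpow hy.le hβ0.le, Real.rpow_neg hβ0.le, div_inv_eq_mul, mul_comm]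
    have hpos : 0 ≤ (y / β) ^ (-ρ) := by positivity
    have hle5 : C₅ i ≤ max (C₅ 0) (C₅ 1) := by
      fin_cases i
      · exact le_max_left _ _
      · exact le_max_right _ _
    have hle6 : min (C₆ 0) (C₆ 1) ≤ C₆ i := by
      fin_cases i
      · exact min_le_left _ _
      · exact min_le_right _ _
    obtain ⟨a, b⟩ := hT i _ hy' hyx'
    rw [hset, neg_mul, neg_mul, mul_assoc, mul_assoc, ← e]
    constructor
    · refine le_trans (Real.exp_le_exp.2 ?_) a
      have := mul_le_mul_of_nonneg_right hle5 hpos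
      linarith
    · refine b.trans (Real.exp_le_exp.2 ?_)
      have := mul_le_mul_of_nonneg_right hle6 hpos
      linarith
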